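/- \textbf{Setting.} Consider the class of equations $$f(x)u_{tt}=(H(u)u_x)_x+h(x)K(u)u_x, \qquad (1)$$ where $f,h$ are smooth real functions of $x$ on a nonempty open interval $I$, $H,K$ are smooth real functions of $u$ on a nonempty open interval $J$, $f(x)H(u)\neq0$ everywhere, and $(H_u,K_u)$ is not identically $(0,0)$. Write $\theta=(f,h,H,K)$ for the arbitrary elements, together with their intervals $I,J$. A \emph{value} at $\theta$ is a pair $(\varphi,\tilde\theta)$ in which $\varphi:(t,x,u)\mapsto(\tilde t,\tilde x,\tilde u)$ is a nondegenerate point transformation (smooth, injective, with nonvanishing Jacobian) defined for $x\in I$, $u\in J$ and $t$ in some nonempty open interval, and $\tilde\theta$ is a tuple of the same class whose intervals are the ranges of $\tilde x$ and $\tilde u$, such that $\varphi$ maps equation (1) with $\theta$ to equation (1) with $\tilde\theta$ (as subsets of the second-order jet space). An \emph{extended equivalence transformation} is an assignment, multivalued because nonlocal expressions such as $\int h\,dx$ carry integration constants, of at least one value to every tuple $\theta$ of the class, which is the same rule for all tuples in the following sense: if $\theta$ and $\theta'$ coincide for $x\in A$, $u\in B$, where $A,B$ are nonempty open intervals contained in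 the domains of both tuples, then for every value assigned to $\theta$ there is a value assigned to $\theta'$ with the same $t$-interval that coincides with it (in $\varphi$ and in the new arbitrary elements) over $x\in A$, $u\in B$. Apart from this, $\varphi$ and $\tilde\theta$ may depend on $\theta$ in any, possibly nonlocal, way. The \emph{extended equivalence group} $\hat G_1^{\sim}$ of class (1) is the collection of all triples $(\theta,\varphi,\tilde\theta)$ such that $(\varphi,\tilde\theta)$ is a value at $\theta$ of some extended equivalence transformation. \textbf{Theorem.} The extended equivalence group $\hat G_1^{\sim}$ of class (1) is formed by the transformations $$\tilde t=\varepsilon_4t+\varepsilon_1,\qquad \tilde x=\varepsilon_5\int e^{\varepsilon_9\int h}\,dx+\varepsilon_2,\qquad \tilde u=\varepsilon_6u+\varepsilon_3,$$ $$\tilde f=\varepsilon_4^2\varepsilon_5^{-1}\varepsilon_7\,f\,e^{-2\varepsilon_9\int h},\qquad \tilde h=\varepsilon_7\varepsilon_8^{-1}\,h\,e^{-\varepsilon_9\int h},\qquad \tilde H=\varepsilon_5\varepsilon_7H,\qquad \tilde K=\varepsilon_8(K+\varepsilon_9H),$$ where $\varepsilon_1,\dots,\varepsilon_9$ are arbitrary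 constants with $\varepsilon_4\varepsilon_5\varepsilon_6\varepsilon_7\varepsilon_8\neq0$, $\int h=\int h(x)\,dx$ is any antiderivative of $h$ (the same one in all formulas), and the left-hand sides of the second line are taken at $\tilde x$ (for $\tilde f,\tilde h$) and at $\tilde u$ (for $\tilde H,\tilde K$). That is: (i) for each such choice of constants, these formulas, with all choices of antiderivatives and all $t$-intervals, define an extended equivalence transformation of class (1); (ii) a triple $(\theta,\varphi,\tilde\theta)$ belongs to $\hat G_1^{\sim}$ if and only if it is given by these formulas for some such constants and some choice of antiderivatives; (iii) $\hat G_1^{\sim}$ contains the identity transformations and is closed under composition (whenever the new tuple and the image $t$-interval of the first transformation are the tuple and the $t$-interval of the second) and under inversion. -/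

import Mathlib

open Set Filter Topology
open scoped ContDiff

namespace TelegraphG1

/-- A nonempty open interval of the real line (bounded or not). -/
def IsOpenInterval (S : Set ℝ) : Prop :=
  IsOpen S ∧ S.Nonempty ∧ S.OrdConnected

/-- A tuple of arbitrary elements `(f, h, H, K)`, with the set `xdom` on which `f, h` are considered
and the set `udom` on which `H, K` are considered. Values outside these sets are irrelevant. -/
structure ArbElts where
  xdom : Set ℝ
  udom : Set ℝ
  f : ℝ → ℝ
  h : ℝ → ℝ
  H : ℝ → ℝ
  K : ℝ → ℝ

/-- The tuple determines an equation `f(x) u_tt = (H(u) u_x)_x + h(x) K(u) u_x` of the class: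
all functions are smooth, `f H ≠ 0`, and `(H_u, K_u)` is not identically `(0, 0)`. -/
structure ArbElts.InClass (θ : ArbElts) : Prop where
  xdom_interval : IsOpenInterval θ.xdom
  udom_interval : IsOpenInterval θ.udom
  smooth_f : ContDiffOn ℝ ∞ θ.f θ.xdom
  smooth_h : ContDiffOn ℝ ∞ θ.h θ.xdom
  smooth_H : ContDiffOn ℝ ∞ θ.H θ.udom
  smooth_K : ContDiffOn ℝ ∞ θ.K θ.udom
  f_ne_zero : ∀ x ∈ θ.xdom, θ.f x ≠ 0
  H_ne_zero : ∀ u ∈ θ.udom, θ.H u ≠ 0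
  nonlinear : ∃ u ∈ θ.udom, deriv θ.H u ≠ 0 ∨ deriv θ.K u ≠ 0

/-- Two tuples coincide for `x ∈ A` and `u ∈ B`. -/
def ArbElts.AgreeOn (θ θ' : ArbElts) (A B : Set ℝ) : Prop :=
  (∀ x ∈ A, θ'.f x = θ.f x ∧ θ'.h x = θ.h x) ∧
  (∀ u ∈ B, θ'.H u = θ.H u ∧ θ'.K u = θ.K u)

/-- Two tuples are the same tuple (they have the same domains and coincide there). -/
def ArbElts.Same (θ θ' : ArbElts) : Prop :=
  θ'.xdom = θ.xdom ∧ θ'.udom = θ.udom ∧ θ.AgreeOn θ' θ.xdom θ.udom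

/-- The function `u = u(t, x)` satisfies the equation
`f(x) u_tt = (H(u) u_x)_x + h(x) K(u) u_x` at the point `(t, x)`. -/
def ArbElts.SatisfiedAt (θ : ArbElts) (u : ℝ → ℝ → ℝ) (t x : ℝ) : Prop :=
  θ.f x * deriv (deriv (fun s => u s x)) t =
    deriv (fun y => θ.H (u t y) * deriv (fun z => u t z) y) x
      + θ.h x * θ.K (u t x) * deriv (fun z => u t z) x

/-- A map `φ : (t, x, u) ↦ (t̃, x̃, ũ)`, considered for `t ∈ tdom`, `x ∈ src.xdom`, `u ∈ src.udom`,
with an initial tuple `src` and a new tuple `tgt` of arbitrary elements. -/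
structure Transf where
  tdom : Set ℝ
  φ : ℝ × ℝ × ℝ → ℝ × ℝ × ℝ
  src : ArbElts
  tgt : ArbElts

/-- The domain of the point transformation in the space of `(t, x, u)`. -/
def Transf.dom (m : Transf) : Set (ℝ × ℝ × ℝ) :=
  m.tdom ×ˢ (m.src.xdom ×ˢ m.src.udom)

/-- `φ` is a nondegenerate point transformation: a smooth injective map with nonvanishing Jacobian
on a box; `x̃` and `ũ` run exactly through the domains of the new arbitrary elements. -/
structure Transf.IsPointTransf (m : Transf) : Prop where
  tdom_interval : IsOpenInterval m.tdom
  smooth : ContDiffOn ℝ ∞ m.φ m.dom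
  injOn : InjOn m.φ m.dom
  jacobian : ∀ p ∈ m.dom, (fderiv ℝ m.φ p).det ≠ 0
  image_x : (fun p => (m.φ p).2.1) '' m.dom = m.tgt.xdom
  image_u : (fun p => (m.φ p).2.2) '' m.dom = m.tgt.udom

/-- `φ` transforms the equation with the tuple `src` into the equation with the tuple `tgt`
(as subsets of the second-order jet space): whenever `φ` maps the graph of a function `u` near
`(t₀, x₀, u(t₀, x₀))` to the graph of a function `w`, the function `u` satisfies the initial equation
at `(t₀, x₀)` if and only if `w` satisfies the new equation at the image point. -/
def Transf.MapsEquation (m : Transf) : Prop :=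
  ∀ (u w : ℝ → ℝ → ℝ) (t₀ x₀ : ℝ),
    t₀ ∈ m.tdom → x₀ ∈ m.src.xdom → u t₀ x₀ ∈ m.src.udom →
    ContDiffAt ℝ ∞ (fun q : ℝ × ℝ => u q.1 q.2) (t₀, x₀) →
    ContDiffAt ℝ ∞ (fun q : ℝ × ℝ => w q.1 q.2)
      ((m.φ (t₀, x₀, u t₀ x₀)).1, (m.φ (t₀, x₀, u t₀ x₀)).2.1) →
    (fderiv ℝ (fun q : ℝ × ℝ =>
      ((m.φ (q.1, q.2, u q.1 q.2)).1, (m.φ (q.1, q.2, u q.1 q.2)).2.1)) (t₀, x₀)).det ≠ 0 →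
    (∀ᶠ q : ℝ × ℝ in 𝓝 (t₀, x₀),
      w (m.φ (q.1, q.2, u q.1 q.2)).1 (m.φ (q.1, q.2, u q.1 q.2)).2.1
        = (m.φ (q.1, q.2, u q.1 q.2)).2.2) →
    (m.src.SatisfiedAt u t₀ x₀ ↔
      m.tgt.SatisfiedAt w (m.φ (t₀, x₀, u t₀ x₀)).1 (m.φ (t₀, x₀, u t₀ x₀)).2.1)

/-- `m` is a nondegenerate point transformation of an equation of the class
to an equation of the class. -/
structure Transf.IsAdmissible (m : Transf) : Prop where
  src_inClass : m.src.InClass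
  tgt_inClass : m.tgt.InClass
  isPointTransf : m.IsPointTransf
  mapsEquation : m.MapsEquation

/-- `m` and `m'` have the same `t`-domain, and their actions on `(t, x, u)` and the new arbitrary
elements coincide over `x ∈ A`, `u ∈ B`. -/
def Transf.CoincideOver (m m' : Transf) (A B : Set ℝ) : Prop :=
  m'.tdom = m.tdom ∧
  ∀ p ∈ m.tdom ×ˢ (A ×ˢ B),
    m'.φ p = m.φ p ∧
    m'.tgt.f (m.φ p).2.1 = m.tgt.f (m.φ p).2.1 ∧
    m'.tgt.h (m.φ p).2.1 = m.tgt.h (m.φ p).2.1 ∧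
    m'.tgt.H (m.φ p).2.2 = m.tgt.H (m.φ p).2.2 ∧
    m'.tgt.K (m.φ p).2.2 = m.tgt.K (m.φ p).2.2

/-- An extended equivalence transformation of the class. It is point with respect to `(t, x, u)` and
transforms any equation of the class into an equation of the class. The transformation of
`(t, x, u)` and the new arbitrary elements depend on the arbitrary elements in a possibly nonlocal
way; since nonlocal expressions such as `∫ h dx` carry integration constants, the transformation is
a possibly multivalued assignment, represented by the set `𝒯` of all its values.
It is one and the same rule for all equations: if two tuples coincide over a box `A × B`, then each
value at the first tuple is continued, from that box, by some value at the second tuple. -/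
structure IsExtendedEquivalence (𝒯 : Set Transf) : Prop where
  admissible : ∀ m ∈ 𝒯, m.IsAdmissible
  total : ∀ θ : ArbElts, θ.InClass → ∃ m ∈ 𝒯, m.src = θ
  continuation : ∀ m ∈ 𝒯, ∀ θ' : ArbElts, θ'.InClass → ∀ A B : Set ℝ,
    IsOpenInterval A → IsOpenInterval B →
    A ⊆ m.src.xdom ∩ θ'.xdom → B ⊆ m.src.udom ∩ θ'.udom →
    m.src.AgreeOn θ' A B →
    ∃ m' ∈ 𝒯, m'.src = θ' ∧ m.CoincideOver m' A B

/-- The extended equivalence group `Ĝ₁^∼`: all values of extended equivalence transformations. -/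
def extendedEquivGroup : Set Transf :=
  {m | ∃ 𝒯 : Set Transf, IsExtendedEquivalence 𝒯 ∧ m ∈ 𝒯}

/-- The composition `m'` after `m`. -/
def Transf.comp (m' m : Transf) : Transf where
  tdom := m.tdom
  φ := m'.φ ∘ m.φ
  src := m.src
  tgt := m'.tgt

/-- `m'` can be applied after `m`. -/
def Transf.Composable (m' m : Transf) : Prop :=
  m.tgt.Same m'.src ∧ m'.tdom = (fun p => (m.φ p).1) '' m.dom

/-- `m` is an identity transformation of an equation of the class. -/
def Transf.IsIdentity (m : Transf) : Prop :=
  m.src.InClass ∧ IsOpenInterval m.tdom ∧ m.src.Same m.tgt ∧ ∀ p ∈ m.dom, m.φ p = p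

/-- `m'` is inverse to `m`. -/
def Transf.IsInverse (m' m : Transf) : Prop :=
  m'.Composable m ∧ m.src.Same m'.tgt ∧ ∀ p ∈ m.dom, m'.φ (m.φ p) = p

/-- The constants `ε₁, …, ε₉`. -/
structure Params where
  ε₁ : ℝ
  ε₂ : ℝ
  ε₃ : ℝ
  ε₄ : ℝ
  ε₅ : ℝ
  ε₆ : ℝ
  ε₇ : ℝ
  ε₈ : ℝ
  ε₉ : ℝ

/-- The nondegeneracy condition on the constants. -/
def Params.Nondegenerate (c : Params) : Prop :=
  c.ε₄ * c.ε₅ * c.ε₆ * c.ε₇ * c.ε₈ ≠ 0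

/-- The transformation with constants `c`; `η` and `ξ` are antiderivatives `∫ h dx` and
`∫ e^{ε₉ ∫ h} dx`, and the new arbitrary elements are defined exactly on the images of the
old domains. -/
def transformation (c : Params) : Set Transf :=
  {m | m.src.InClass ∧ IsOpenInterval m.tdom ∧ ∃ η ξ : ℝ → ℝ,
    (∀ x ∈ m.src.xdom, HasDerivAt η (m.src.h x) x) ∧
    (∀ x ∈ m.src.xdom, HasDerivAt ξ (Real.exp (c.ε₉ * η x)) x) ∧
    (∀ t ∈ m.tdom, ∀ x ∈ m.src.xdom, ∀ u ∈ m.src.udom,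
      m.φ (t, x, u) = (c.ε₄ * t + c.ε₁, c.ε₅ * ξ x + c.ε₂, c.ε₆ * u + c.ε₃)) ∧
    m.tgt.xdom = (fun x => c.ε₅ * ξ x + c.ε₂) '' m.src.xdom ∧
    m.tgt.udom = (fun u => c.ε₆ * u + c.ε₃) '' m.src.udom ∧
    (∀ x ∈ m.src.xdom,
      m.tgt.f (c.ε₅ * ξ x + c.ε₂)
        = c.ε₄ ^ 2 * c.ε₅⁻¹ * c.ε₇ * m.src.f x * Real.exp (-2 * c.ε₉ * η x) ∧
      m.tgt.h (c.ε₅ * ξ x + c.ε₂)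
        = c.ε₇ * c.ε₈⁻¹ * m.src.h x * Real.exp (-c.ε₉ * η x)) ∧
    (∀ u ∈ m.src.udom,
      m.tgt.H (c.ε₆ * u + c.ε₃) = c.ε₅ * c.ε₇ * m.src.H u ∧
      m.tgt.K (c.ε₆ * u + c.ε₃) = c.ε₈ * (m.src.K u + c.ε₉ * m.src.H u))}

end TelegraphG1

namespace TelegraphG1

/-! ### Calculus on open intervals -/

lemma IsOpenInterval.isPreconnected {S : Set ℝ} (hS : IsOpenInterval S) : IsPreconnected S :=
  hS.2.2.isPreconnected

lemma IsOpenInterval.mem_nhds {S : Set ℝ} (hS : IsOpenInterval S) {x : ℝ} (hx : x ∈ S) :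
    S ∈ 𝓝 x :=
  hS.1.mem_nhds hx

/-- A function with vanishing derivative on an open interval is constant there. -/
lemma IsOpenInterval.eq_of_hasDerivAt_zero {S : Set ℝ} (hS : IsOpenInterval S) {g : ℝ → ℝ}
    (hg : ∀ s ∈ S, HasDerivAt g 0 s) {a b : ℝ} (ha : a ∈ S) (hb : b ∈ S) : g a = g b :=
  hS.1.is_const_of_deriv_eq_zero hS.isPreconnected
    (fun s hs => (hg s hs).differentiableAt.differentiableWithinAt)
    (fun s hs => (hg s hs).deriv) ha hb

/-- A function with constant derivative `c` on an open interval is affine there. -/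
lemma IsOpenInterval.eq_add_of_hasDerivAt_const {S : Set ℝ} (hS : IsOpenInterval S) {g : ℝ → ℝ}
    {c : ℝ} (hg : ∀ s ∈ S, HasDerivAt g c s) {a b : ℝ} (ha : a ∈ S) (hb : b ∈ S) :
    g b = g a + c * (b - a) := by
  have h := hS.eq_of_hasDerivAt_zero (g := fun s => g s - c * s)
    (fun s hs => by simpa using (hg s hs).fun_sub ((hasDerivAt_id s).const_mul c)) ha hb
  linarith

/-- Functions with equal derivatives on an open interval differ by a constant. -/
lemma IsOpenInterval.sub_eq_sub_of_hasDerivAt {S : Set ℝ} (hS : IsOpenInterval S)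
    {g k d : ℝ → ℝ} (hg : ∀ s ∈ S, HasDerivAt g (d s) s) (hk : ∀ s ∈ S, HasDerivAt k (d s) s)
    {a b : ℝ} (ha : a ∈ S) (hb : b ∈ S) : g b - g a = k b - k a := by
  have h := hS.eq_of_hasDerivAt_zero (g := fun s => g s - k s)
    (fun s hs => by simpa using (hg s hs).fun_sub (hk s hs)) ha hb
  linarith

lemma IsOpenInterval.exists_gt_mem {S : Set ℝ} (hS : IsOpenInterval S) {a : ℝ} (ha : a ∈ S) :
    ∃ b ∈ S, a < b := by
  have h : ∀ᶠ b in 𝓝[>] a, b ∈ S ∧ a < b :=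
    (Filter.Eventually.filter_mono nhdsWithin_le_nhds (hS.mem_nhds ha)).and self_mem_nhdsWithin
  exact h.exists

lemma IsOpenInterval.exists_lt_mem {S : Set ℝ} (hS : IsOpenInterval S) {a : ℝ} (ha : a ∈ S) :
    ∃ b ∈ S, b < a := by
  have h : ∀ᶠ b in 𝓝[<] a, b ∈ S ∧ b < a :=
    (Filter.Eventually.filter_mono nhdsWithin_le_nhds (hS.mem_nhds ha)).and self_mem_nhdsWithin
  exact h.exists

/-- A continuous function on an open interval has an antiderivative with a prescribed value. -/
lemma IsOpenInterval.exists_antideriv {S : Set ℝ} (hS : IsOpenInterval S) {h : ℝ → ℝ}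
    (hh : ContinuousOn h S) {a : ℝ} (ha : a ∈ S) (c : ℝ) :
    ∃ η : ℝ → ℝ, η a = c ∧ ∀ x ∈ S, HasDerivAt η (h x) x := by
  refine ⟨fun x => c + ∫ s in a..x, h s, by simp, fun x hx => ?_⟩
  have hi : IntervalIntegrable h MeasureTheory.volume a x :=
    (hh.mono (hS.2.2.uIcc_subset ha hx)).intervalIntegrable
  exact (intervalIntegral.integral_hasDerivAt_right hi
    (hh.stronglyMeasurableAtFilter hS.1 x hx) (hh.continuousAt (hS.mem_nhds hx))).const_add c

lemma contDiffOn_of_hasDerivAt {S : Set ℝ} (hS : IsOpen S) {g d : ℝ → ℝ}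
    (hg : ∀ s ∈ S, HasDerivAt g (d s) s) (hd : ContDiffOn ℝ ∞ d S) : ContDiffOn ℝ ∞ g S :=
  (contDiffOn_infty_iff_deriv_of_isOpen hS).2
    ⟨fun s hs => (hg s hs).differentiableAt.differentiableWithinAt,
      hd.congr fun s hs => (hg s hs).deriv⟩

/-- A smooth function on an open interval with nonvanishing derivative. -/
structure IsCoordChange (S : Set ℝ) (X X' : ℝ → ℝ) : Prop where
  interval : IsOpenInterval S
  smooth : ContDiffOn ℝ ∞ X S
  hasDerivAt : ∀ x ∈ S, HasDerivAt X (X' x) x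
  ne_zero : ∀ x ∈ S, X' x ≠ 0

namespace IsCoordChange

variable {S : Set ℝ} {X X' : ℝ → ℝ}

/-- By Rolle's theorem, two distinct points with equal values would enclose a zero of X'. -/
lemma injOn (hX : IsCoordChange S X X') : InjOn X S := by
  have key : ∀ a ∈ S, ∀ b ∈ S, a < b → X a ≠ X b := by
    intro a ha b hb hab he
    have hsub : Icc a b ⊆ S := hX.interval.2.2.out ha hb
    obtain ⟨c, hc, hc0⟩ := exists_hasDerivAt_eq_zero hab
      (hX.smooth.continuousOn.mono hsub) he
      (fun x hx => hX.hasDerivAt x (hsub (Ioo_subset_Icc_self hx)))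
    exact hX.ne_zero c (hsub (Ioo_subset_Icc_self hc)) hc0
  intro a ha b hb he
  rcases lt_trichotomy a b with h | h | h
  · exact absurd he (key a ha b hb h)
  · exact h
  · exact absurd he.symm (key b hb a ha h)

lemma contDiffAt (hX : IsCoordChange S X X') {x : ℝ} (hx : x ∈ S) : ContDiffAt ℝ ∞ X x :=
  hX.smooth.contDiffAt (hX.interval.mem_nhds hx)

lemma image_interval (hX : IsCoordChange S X X') : IsOpenInterval (X '' S) := by
  refine ⟨isOpen_iff_mem_nhds.2 ?_, hX.interval.2.1.image X,
    (hX.interval.isPreconnected.image X hX.smooth.continuousOn).ordConnected⟩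
  rintro _ ⟨x, hx, rfl⟩
  have hs : HasStrictDerivAt X (X' x) x :=
    (hX.contDiffAt hx).hasStrictDerivAt' (hX.hasDerivAt x hx) (by simp)
  rw [← hs.map_nhds_eq (hX.ne_zero x hx)]
  exact image_mem_map (hX.interval.mem_nhds hx)

lemma invFunOn_apply (hX : IsCoordChange S X X') {x : ℝ} (hx : x ∈ S) :
    Function.invFunOn X S (X x) = x :=
  hX.injOn.leftInvOn_invFunOn hx

/-- Near X x the smooth local inverse takes its values in S, and injectivity on S leaves no other
choice for the global inverse. -/
lemma contDiffAt_invFunOn (hX : IsCoordChange S X X') {x : ℝ} (hx : x ∈ S) :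
    ContDiffAt ℝ ∞ (Function.invFunOn X S) (X x) := by
  have hc := hX.contDiffAt hx
  have hd := (hX.hasDerivAt x hx).hasFDerivAt_equiv (hX.ne_zero x hx)
  have hn : (∞ : ℕ∞ω) ≠ 0 := by simp
  refine (hc.to_localInverse hd hn).congr_of_eventuallyEq ?_
  have hval : hc.localInverse hd hn (X x) = x :=
    (hc.hasStrictFDerivAt' hd hn).localInverse_apply_image
  have h1 : ∀ᶠ y in 𝓝 (X x), X (hc.localInverse hd hn y) = y :=
    (hc.hasStrictFDerivAt' hd hn).eventually_right_inverse
  have h2 : ∀ᶠ y in 𝓝 (X x), hc.localInverse hd hn y ∈ S := by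
    refine (hc.to_localInverse hd hn).continuousAt.eventually ?_
    rw [hval]
    exact hX.interval.mem_nhds hx
  filter_upwards [h1, h2] with y hy1 hy2
  conv_lhs => rw [← hy1]
  exact hX.invFunOn_apply hy2

lemma contDiffOn_invFunOn (hX : IsCoordChange S X X') :
    ContDiffOn ℝ ∞ (Function.invFunOn X S) (X '' S) := by
  rintro _ ⟨x, hx, rfl⟩
  exact (hX.contDiffAt_invFunOn hx).contDiffWithinAt

/-- A left inverse of a change of coordinate is itself a change of coordinate. -/
lemma inverse (hX : IsCoordChange S X X') {Y : ℝ → ℝ} (hY : ∀ x ∈ S, Y (X x) = x) :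
    IsCoordChange (X '' S) Y (fun y => (X' (Y y))⁻¹) := by
  have heq : EqOn Y (Function.invFunOn X S) (X '' S) := by
    rintro _ ⟨x, hx, rfl⟩
    rw [hY x hx, hX.invFunOn_apply hx]
  have hc : ContDiffOn ℝ ∞ Y (X '' S) := hX.contDiffOn_invFunOn.congr heq
  refine ⟨hX.image_interval, hc, ?_, ?_⟩
  · rintro _ ⟨x, hx, rfl⟩
    have hn := hX.image_interval.mem_nhds (mem_image_of_mem X hx)
    refine HasDerivAt.of_local_left_inverse (f := X) (hc.continuousOn.continuousAt hn) ?_ ?_ ?_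
    · rw [hY x hx]
      exact hX.hasDerivAt x hx
    · rw [hY x hx]
      exact hX.ne_zero x hx
    · filter_upwards [hn]
      rintro _ ⟨z, hz, rfl⟩
      rw [hY z hz]
  · rintro _ ⟨x, hx, rfl⟩
    rw [hY x hx]
    exact inv_ne_zero (hX.ne_zero x hx)

lemma affine {a b : ℝ} (hS : IsOpenInterval S) (ha : a ≠ 0) :
    IsCoordChange S (fun u => a * u + b) (fun _ => a) where
  interval := hS
  smooth := by fun_prop
  hasDerivAt x _ := by simpa using ((hasDerivAt_id x).const_mul a).add_const b
  ne_zero _ _ := ha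

end IsCoordChange

/-! ### Tuples of arbitrary elements -/

namespace ArbElts

lemma Same.inClass {θ θ' : ArbElts} (h : θ.Same θ') (hθ : θ.InClass) : θ'.InClass := by
  obtain ⟨hx, hu, h1, h2⟩ := h
  refine ⟨hx ▸ hθ.xdom_interval, hu ▸ hθ.udom_interval, ?_, ?_, ?_, ?_, ?_, ?_, ?_⟩
  · rw [hx]; exact hθ.smooth_f.congr fun x hx => (h1 x hx).1
  · rw [hx]; exact hθ.smooth_h.congr fun x hx => (h1 x hx).2
  · rw [hu]; exact hθ.smooth_H.congr fun x hx => (h2 x hx).1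
  · rw [hu]; exact hθ.smooth_K.congr fun x hx => (h2 x hx).2
  · rw [hx]; intro x hx; rw [(h1 x hx).1]; exact hθ.f_ne_zero x hx
  · rw [hu]; intro x hx; rw [(h2 x hx).1]; exact hθ.H_ne_zero x hx
  · obtain ⟨u, hu', h⟩ := hθ.nonlinear
    have hn := hθ.udom_interval.mem_nhds hu'
    have e1 : deriv θ'.H u = deriv θ.H u :=
      EventuallyEq.deriv_eq (by filter_upwards [hn] with v hv using (h2 v hv).1)
    have e2 : deriv θ'.K u = deriv θ.K u :=
      EventuallyEq.deriv_eq (by filter_upwards [hn] with v hv using (h2 v hv).2)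
    exact ⟨u, hu ▸ hu', by rw [e1, e2]; exact h⟩

lemma Same.refl (θ : ArbElts) : θ.Same θ :=
  ⟨rfl, rfl, fun _ _ => ⟨rfl, rfl⟩, fun _ _ => ⟨rfl, rfl⟩⟩

lemma InClass.hasDerivAt_H {θ : ArbElts} (hθ : θ.InClass) {u : ℝ} (hu : u ∈ θ.udom) :
    HasDerivAt θ.H (deriv θ.H u) u :=
  ((hθ.smooth_H.contDiffAt (hθ.udom_interval.mem_nhds hu)).differentiableAt (by simp)).hasDerivAt

lemma InClass.exists_antideriv {θ : ArbElts} (hθ : θ.InClass) {a : ℝ} (ha : a ∈ θ.xdom) (c : ℝ) :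
    ∃ η : ℝ → ℝ, η a = c ∧ ∀ x ∈ θ.xdom, HasDerivAt η (θ.h x) x :=
  hθ.xdom_interval.exists_antideriv hθ.smooth_h.continuousOn ha c

/-- The equation in terms of the partial derivatives of `u`. -/
lemma InClass.satisfiedAt_iff {θ : ArbElts} (hθ : θ.InClass) {u : ℝ → ℝ → ℝ} {t x : ℝ}
    (hu : u t x ∈ θ.udom) (hc : ContDiffAt ℝ 2 (fun y => u t y) x) :
    θ.SatisfiedAt u t x ↔
      θ.f x * deriv (deriv (fun s => u s x)) t =
        θ.H (u t x) * deriv (deriv (fun y => u t y)) x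
          + deriv θ.H (u t x) * deriv (fun y => u t y) x ^ 2
          + θ.h x * θ.K (u t x) * deriv (fun y => u t y) x := by
  have h1 : HasDerivAt (fun y => u t y) (deriv (fun y => u t y) x) x :=
    (hc.differentiableAt (by simp)).hasDerivAt
  have h2 : HasDerivAt (deriv (fun y => u t y)) (deriv (deriv (fun y => u t y)) x) x := by
    have : ContDiffAt ℝ 1 (deriv (fun y => u t y)) x := hc.derivWithin (by norm_num)
    exact (this.differentiableAt (by simp)).hasDerivAt
  have h3 := ((hθ.hasDerivAt_H hu).comp x h1).mul h2
  have h4 : deriv (fun y => θ.H (u t y) * deriv (fun z => u t z) y) x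
      = deriv θ.H (u t x) * deriv (fun y => u t y) x * deriv (fun y => u t y) x
        + θ.H (u t x) * deriv (deriv (fun y => u t y)) x := h3.deriv
  unfold SatisfiedAt
  rw [h4]
  constructor <;> intro h <;> linarith

end ArbElts

end TelegraphG1

namespace TelegraphG1

/-! ### Derivatives of compositions, determinants -/

lemma two_le_infty : (2 : ℕ∞ω) ≤ ∞ :=
  WithTop.coe_le_coe.2 le_top

lemma deriv_deriv_comp {G γ : ℝ → ℝ} {s : ℝ} (hG : ContDiffAt ℝ 2 G (γ s))
    (hγ : ContDiffAt ℝ 2 γ s) :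
    deriv (fun r => G (γ r)) s = deriv G (γ s) * deriv γ s ∧
    deriv (deriv (fun r => G (γ r))) s
      = deriv (deriv G) (γ s) * deriv γ s ^ 2 + deriv G (γ s) * deriv (deriv γ) s := by
  have key : ∀ r, ContDiffAt ℝ 2 G (γ r) → ContDiffAt ℝ 2 γ r →
      deriv (fun r => G (γ r)) r = deriv G (γ r) * deriv γ r := fun r h1 h2 =>
    ((h1.differentiableAt (by simp)).hasDerivAt.comp r
      (h2.differentiableAt (by simp)).hasDerivAt).deriv
  refine ⟨key s hG hγ, ?_⟩
  have he : deriv (fun r => G (γ r)) =ᶠ[𝓝 s] fun r => deriv G (γ r) * deriv γ r := by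
    filter_upwards [hγ.continuousAt.eventually (hG.eventually (by simp)),
      hγ.eventually (by simp)] with r h1 h2 using key r h1 h2
  rw [he.deriv_eq]
  have hG1 : ContDiffAt ℝ 1 (deriv G) (γ s) := hG.derivWithin (by norm_num)
  have hγ1 : ContDiffAt ℝ 1 (deriv γ) s := hγ.derivWithin (by norm_num)
  have h := ((hG1.differentiableAt (by simp)).hasDerivAt.comp s
    (hγ.differentiableAt (by simp)).hasDerivAt).fun_mul (hγ1.differentiableAt (by simp)).hasDerivAt
  simp only [Function.comp_apply] at h
  rw [h.deriv]
  ring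

lemma det_ne_zero_of_forall {E : Type*} [NormedAddCommGroup E] [NormedSpace ℝ E]
    [FiniteDimensional ℝ E] {L : E →L[ℝ] E} (hL : ∀ v, L v = 0 → v = 0) : L.det ≠ 0 := by
  intro h
  exact (LinearMap.det_eq_zero_iff_ker_ne_bot.1 h) (LinearMap.ker_eq_bot'.2 hL)

lemma eq_zero_of_det_ne_zero {E : Type*} [NormedAddCommGroup E] [NormedSpace ℝ E]
    [FiniteDimensional ℝ E] {L : E →L[ℝ] E} (hL : L.det ≠ 0) {v : E} (hv : L v = 0) : v = 0 := by
  have h : LinearMap.ker (L : E →ₗ[ℝ] E) = ⊥ := by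
    by_contra hne
    exact hL (LinearMap.det_eq_zero_iff_ker_ne_bot.2 hne)
  exact LinearMap.ker_eq_bot'.1 h v hv

/-! ### The transformations of the family -/

/-- `m` is the transformation with constants `c` and antiderivatives `η`, `ξ`. -/
structure Transf.HasForm (m : Transf) (c : Params) (η ξ : ℝ → ℝ) : Prop where
  src_inClass : m.src.InClass
  tdom_interval : IsOpenInterval m.tdom
  deriv_η : ∀ x ∈ m.src.xdom, HasDerivAt η (m.src.h x) x
  deriv_ξ : ∀ x ∈ m.src.xdom, HasDerivAt ξ (Real.exp (c.ε₉ * η x)) x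
  φ_eq : ∀ t ∈ m.tdom, ∀ x ∈ m.src.xdom, ∀ u ∈ m.src.udom,
    m.φ (t, x, u) = (c.ε₄ * t + c.ε₁, c.ε₅ * ξ x + c.ε₂, c.ε₆ * u + c.ε₃)
  xdom_eq : m.tgt.xdom = (fun x => c.ε₅ * ξ x + c.ε₂) '' m.src.xdom
  udom_eq : m.tgt.udom = (fun u => c.ε₆ * u + c.ε₃) '' m.src.udom
  fh_eq : ∀ x ∈ m.src.xdom,
    m.tgt.f (c.ε₅ * ξ x + c.ε₂)
      = c.ε₄ ^ 2 * c.ε₅⁻¹ * c.ε₇ * m.src.f x * Real.exp (-2 * c.ε₉ * η x) ∧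
    m.tgt.h (c.ε₅ * ξ x + c.ε₂)
      = c.ε₇ * c.ε₈⁻¹ * m.src.h x * Real.exp (-c.ε₉ * η x)
  HK_eq : ∀ u ∈ m.src.udom,
    m.tgt.H (c.ε₆ * u + c.ε₃) = c.ε₅ * c.ε₇ * m.src.H u ∧
    m.tgt.K (c.ε₆ * u + c.ε₃) = c.ε₈ * (m.src.K u + c.ε₉ * m.src.H u)

lemma mem_transformation_iff {c : Params} {m : Transf} :
    m ∈ transformation c ↔ ∃ η ξ, m.HasForm c η ξ := by
  constructor
  · rintro ⟨h1, h2, η, ξ, h3, h4, h5, h6, h7, h8, h9⟩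
    exact ⟨η, ξ, h1, h2, h3, h4, h5, h6, h7, h8, h9⟩
  · rintro ⟨η, ξ, h⟩
    exact ⟨h.1, h.2, η, ξ, h.3, h.4, h.5, h.6, h.7, h.8, h.9⟩

lemma Params.Nondegenerate.ne {c : Params} (hc : c.Nondegenerate) :
    c.ε₄ ≠ 0 ∧ c.ε₅ ≠ 0 ∧ c.ε₆ ≠ 0 ∧ c.ε₇ ≠ 0 ∧ c.ε₈ ≠ 0 := by
  unfold Params.Nondegenerate at hc
  simp only [ne_eq, mul_eq_zero, not_or] at hc
  tauto

namespace ArbElts.InClass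

variable {θ : ArbElts} {η ξ : ℝ → ℝ} {a b k : ℝ}

lemma contDiffOn_antideriv (hθ : θ.InClass) (hη : ∀ x ∈ θ.xdom, HasDerivAt η (θ.h x) x) :
    ContDiffOn ℝ ∞ η θ.xdom :=
  contDiffOn_of_hasDerivAt hθ.xdom_interval.1 hη hθ.smooth_h

lemma isCoordChange (hθ : θ.InClass) (hη : ∀ x ∈ θ.xdom, HasDerivAt η (θ.h x) x)
    (hξ : ∀ x ∈ θ.xdom, HasDerivAt ξ (Real.exp (k * η x)) x) (ha : a ≠ 0) :
    IsCoordChange θ.xdom (fun x => a * ξ x + b) (fun x => a * Real.exp (k * η x)) where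
  interval := hθ.xdom_interval
  smooth := by
    have h := contDiffOn_of_hasDerivAt hθ.xdom_interval.1 hξ
      (Real.contDiff_exp.comp_contDiffOn (contDiffOn_const.mul (hθ.contDiffOn_antideriv hη)))
    exact (contDiffOn_const.mul h).add contDiffOn_const
  hasDerivAt x hx := ((hξ x hx).const_mul a).add_const b
  ne_zero x _ := mul_ne_zero ha (Real.exp_pos _).ne'

end ArbElts.InClass

lemma Transf.isOpen_dom {m : Transf} (h : m.src.InClass) (ht : IsOpenInterval m.tdom) :
    IsOpen m.dom :=
  ht.1.prod (h.xdom_interval.1.prod h.udom_interval.1)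

namespace Transf.HasForm

variable {m : Transf} {c : Params} {η ξ : ℝ → ℝ}

lemma coordChange_x (hm : m.HasForm c η ξ) (hc : c.Nondegenerate) :
    IsCoordChange m.src.xdom (fun x => c.ε₅ * ξ x + c.ε₂)
      (fun x => c.ε₅ * Real.exp (c.ε₉ * η x)) :=
  hm.src_inClass.isCoordChange hm.deriv_η hm.deriv_ξ hc.ne.2.1

lemma coordChange_u (hm : m.HasForm c η ξ) (hc : c.Nondegenerate) :
    IsCoordChange m.src.udom (fun u => c.ε₆ * u + c.ε₃) (fun _ => c.ε₆) :=
  IsCoordChange.affine hm.src_inClass.udom_interval hc.ne.2.2.1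

/-- The new H is known only through its values at ε₆u + ε₃, so it is first rewritten, near such a
point, through the inverse affine map. -/
lemma hasDerivAt_tgt_H (hm : m.HasForm c η ξ) (hc : c.Nondegenerate) {u : ℝ}
    (hu : u ∈ m.src.udom) :
    HasDerivAt m.tgt.H (c.ε₅ * c.ε₇ * deriv m.src.H u / c.ε₆) (c.ε₆ * u + c.ε₃) := by
  have hX := hm.coordChange_u hc
  have hY := (hX.inverse (fun x hx => hX.invFunOn_apply hx)).hasDerivAt _ (mem_image_of_mem _ hu)
  have hH := hm.src_inClass.hasDerivAt_H hu
  rw [← hX.invFunOn_apply hu] at hH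
  have h := (hH.comp _ hY).const_mul (c.ε₅ * c.ε₇)
  rw [hX.invFunOn_apply hu] at h
  have h' := h.congr_of_eventuallyEq (f₁ := m.tgt.H) (by
    filter_upwards [hX.image_interval.mem_nhds (mem_image_of_mem _ hu)]
    rintro _ ⟨v, hv, rfl⟩
    simp only [Function.comp_apply, hX.invFunOn_apply hv]
    exact (hm.HK_eq v hv).1)
  rwa [div_eq_mul_inv, mul_assoc (c.ε₅ * c.ε₇)]

lemma hasDerivAt_tgt_K (hm : m.HasForm c η ξ) (hc : c.Nondegenerate) {u : ℝ}
    (hu : u ∈ m.src.udom) :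
    HasDerivAt m.tgt.K (c.ε₈ * (deriv m.src.K u + c.ε₉ * deriv m.src.H u) / c.ε₆)
      (c.ε₆ * u + c.ε₃) := by
  have hX := hm.coordChange_u hc
  have hY := (hX.inverse (fun x hx => hX.invFunOn_apply hx)).hasDerivAt _ (mem_image_of_mem _ hu)
  have hH := hm.src_inClass.hasDerivAt_H hu
  have hK : HasDerivAt m.src.K (deriv m.src.K u) u :=
    ((hm.src_inClass.smooth_K.contDiffAt
      (hm.src_inClass.udom_interval.mem_nhds hu)).differentiableAt (by simp)).hasDerivAt
  have hKH := (hK.fun_add (hH.const_mul c.ε₉)).const_mul c.ε₈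
  rw [← hX.invFunOn_apply hu] at hKH
  have h := hKH.comp _ hY
  rw [hX.invFunOn_apply hu] at h
  have h' := h.congr_of_eventuallyEq (f₁ := m.tgt.K) (by
    filter_upwards [hX.image_interval.mem_nhds (mem_image_of_mem _ hu)]
    rintro _ ⟨v, hv, rfl⟩
    simp only [Function.comp_apply, hX.invFunOn_apply hv]
    exact (hm.HK_eq v hv).2)
  rwa [div_eq_mul_inv]

lemma tgt_inClass (hm : m.HasForm c η ξ) (hc : c.Nondegenerate) : m.tgt.InClass := by
  obtain ⟨h4, h5, h6, h7, h8⟩ := hc.ne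
  have hX := hm.coordChange_x hc
  have hU := hm.coordChange_u hc
  have hθ := hm.src_inClass
  have hη := hθ.contDiffOn_antideriv hm.deriv_η
  have pull : ∀ {S : Set ℝ} {X X' g F : ℝ → ℝ}, IsCoordChange S X X' → ContDiffOn ℝ ∞ F S →
      (∀ x ∈ S, g (X x) = F x) → ContDiffOn ℝ ∞ g (X '' S) := by
    intro S X X' g F hX hF hg
    have hmaps : MapsTo (Function.invFunOn X S) (X '' S) S := by
      rintro _ ⟨x, hx, rfl⟩
      rwa [hX.invFunOn_apply hx]
    refine (hF.comp hX.contDiffOn_invFunOn hmaps).congr ?_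
    rintro _ ⟨x, hx, rfl⟩
    simp only [Function.comp_apply, hX.invFunOn_apply hx, hg x hx]
  refine ⟨hm.xdom_eq ▸ hX.image_interval, hm.udom_eq ▸ hU.image_interval, ?_, ?_, ?_, ?_, ?_, ?_, ?_⟩
  · rw [hm.xdom_eq]
    exact pull hX ((contDiffOn_const.mul hθ.smooth_f).mul
      (Real.contDiff_exp.comp_contDiffOn (contDiffOn_const.mul hη))) fun x hx => (hm.fh_eq x hx).1
  · rw [hm.xdom_eq]
    exact pull hX ((contDiffOn_const.mul hθ.smooth_h).mul
      (Real.contDiff_exp.comp_contDiffOn (contDiffOn_const.mul hη))) fun x hx => (hm.fh_eq x hx).2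
  · rw [hm.udom_eq]
    exact pull hU (contDiffOn_const.mul hθ.smooth_H) fun u hu => (hm.HK_eq u hu).1
  · rw [hm.udom_eq]
    exact pull hU (contDiffOn_const.mul (hθ.smooth_K.add (contDiffOn_const.mul hθ.smooth_H)))
      fun u hu => (hm.HK_eq u hu).2
  · rw [hm.xdom_eq]
    rintro _ ⟨x, hx, rfl⟩
    have := hθ.f_ne_zero x hx
    simp only [(hm.fh_eq x hx).1]
    positivity
  · rw [hm.udom_eq]
    rintro _ ⟨u, hu, rfl⟩
    have := hθ.H_ne_zero u hu
    simp only [(hm.HK_eq u hu).1]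
    positivity
  · obtain ⟨u, hu, h⟩ := hθ.nonlinear
    refine ⟨c.ε₆ * u + c.ε₃, hm.udom_eq ▸ mem_image_of_mem _ hu, ?_⟩
    rw [(hm.hasDerivAt_tgt_H hc hu).deriv, (hm.hasDerivAt_tgt_K hc hu).deriv]
    -- The shift of K by ε₉H cannot hide the nonlinearity: where H_u = 0 it does not change K_u, and
    -- elsewhere the new H already has nonzero derivative.
    by_cases hH : deriv m.src.H u = 0
    · right
      have hK : deriv m.src.K u ≠ 0 := by tauto
      rw [hH, mul_zero, add_zero]
      positivity
    · left
      positivity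

lemma isPointTransf (hm : m.HasForm c η ξ) (hc : c.Nondegenerate) : m.IsPointTransf := by
  obtain ⟨h4, h5, h6, h7, h8⟩ := hc.ne
  have hX := hm.coordChange_x hc
  have hU := hm.coordChange_u hc
  have hopen := Transf.isOpen_dom hm.src_inClass hm.tdom_interval
  obtain ⟨t₁, ht₁⟩ := hm.tdom_interval.2.1
  obtain ⟨x₁, hx₁⟩ := hm.src_inClass.xdom_interval.2.1
  obtain ⟨u₁, hu₁⟩ := hm.src_inClass.udom_interval.2.1
  have heq : EqOn m.φ (fun q => (c.ε₄ * q.1 + c.ε₁, c.ε₅ * ξ q.2.1 + c.ε₂, c.ε₆ * q.2.2 + c.ε₃))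
      m.dom := fun q hq => hm.φ_eq q.1 hq.1 q.2.1 hq.2.1 q.2.2 hq.2.2
  refine ⟨hm.tdom_interval, ?_, ?_, ?_, ?_, ?_⟩
  · refine ContDiffOn.congr ?_ heq
    refine ContDiffOn.prodMk (by fun_prop) (ContDiffOn.prodMk ?_ (by fun_prop))
    exact hX.smooth.comp (s := m.dom) (g := fun x => c.ε₅ * ξ x + c.ε₂)
      (f := fun q : ℝ × ℝ × ℝ => q.2.1) (by fun_prop) fun q hq => hq.2.1
  · rintro ⟨t, x, u⟩ hp ⟨t', x', u'⟩ hp' he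
    rw [heq hp, heq hp'] at he
    simp only [Prod.mk.injEq] at he
    have e1 : t = t' := by
      have := he.1
      exact mul_left_cancel₀ h4 (by linarith)
    have e2 : x = x' := hX.injOn hp.2.1 hp'.2.1 he.2.1
    have e3 : u = u' := hU.injOn hp.2.2 hp'.2.2 he.2.2
    rw [e1, e2, e3]
  · intro p hp
    have h1 : HasFDerivAt (fun q : ℝ × ℝ × ℝ => c.ε₄ * q.1 + c.ε₁)
        (c.ε₄ • ContinuousLinearMap.fst ℝ ℝ (ℝ × ℝ)) p :=
      (hasFDerivAt_fst.const_mul c.ε₄).add_const _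
    have h2 : HasFDerivAt (fun q : ℝ × ℝ × ℝ => c.ε₅ * ξ q.2.1 + c.ε₂)
        ((c.ε₅ * Real.exp (c.ε₉ * η p.2.1)) • (ContinuousLinearMap.fst ℝ ℝ ℝ).comp
          (ContinuousLinearMap.snd ℝ ℝ (ℝ × ℝ))) p :=
      (hX.hasDerivAt p.2.1 hp.2.1).comp_hasFDerivAt (f := fun q : ℝ × ℝ × ℝ => q.2.1) p
        (((ContinuousLinearMap.fst ℝ ℝ ℝ).comp
          (ContinuousLinearMap.snd ℝ ℝ (ℝ × ℝ))).hasFDerivAt)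
    have h3 : HasFDerivAt (fun q : ℝ × ℝ × ℝ => c.ε₆ * q.2.2 + c.ε₃)
        (c.ε₆ • (ContinuousLinearMap.snd ℝ ℝ ℝ).comp
          (ContinuousLinearMap.snd ℝ ℝ (ℝ × ℝ))) p :=
      (((ContinuousLinearMap.snd ℝ ℝ ℝ).comp
          (ContinuousLinearMap.snd ℝ ℝ (ℝ × ℝ))).hasFDerivAt.const_mul c.ε₆).add_const _
    have h := (h1.prodMk (h2.prodMk h3)).congr_of_eventuallyEq (f₁ := m.φ)
      (by filter_upwards [hopen.mem_nhds hp] with q hq using heq hq)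
    rw [h.fderiv]
    refine det_ne_zero_of_forall ?_
    rintro ⟨a, b, d⟩ hv
    have hne := hX.ne_zero p.2.1 hp.2.1
    simp only [ContinuousLinearMap.prod_apply, smul_apply,
      ContinuousLinearMap.comp_apply, ContinuousLinearMap.coe_fst', ContinuousLinearMap.coe_snd',
      smul_eq_mul, Prod.mk_eq_zero, mul_eq_zero, h4, h6, false_or] at hv
    obtain ⟨rfl, hb, rfl⟩ := hv
    have : b = 0 := by
      rcases hb with hb | hb
      · exact absurd (mul_eq_zero.2 hb) hne
      · exact hb
    simp [this]
  · rw [hm.xdom_eq]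
    ext y
    constructor
    · rintro ⟨q, hq, rfl⟩
      exact ⟨q.2.1, hq.2.1, by simp only [heq hq]⟩
    · rintro ⟨x, hx, rfl⟩
      exact ⟨(t₁, x, u₁), ⟨ht₁, hx, hu₁⟩, by simp only [heq (x := (t₁, x, u₁)) ⟨ht₁, hx, hu₁⟩]⟩
  · rw [hm.udom_eq]
    ext y
    constructor
    · rintro ⟨q, hq, rfl⟩
      exact ⟨q.2.2, hq.2.2, by simp only [heq hq]⟩
    · rintro ⟨u, hu, rfl⟩
      exact ⟨(t₁, x₁, u), ⟨ht₁, hx₁, hu⟩, by simp only [heq (x := (t₁, x₁, u)) ⟨ht₁, hx₁, hu⟩]⟩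

/-- The chain rule gives ε₆u_xx = X'²w_xx + X''w_x with X'' = ε₉hX'. The second term, multiplied by
H, turns hK into h(K + ε₉H). -/
lemma mapsEquation (hm : m.HasForm c η ξ) (hc : c.Nondegenerate) : m.MapsEquation := by
  obtain ⟨h4, h5, h6, h7, h8⟩ := hc.ne
  intro u w t x ht hx hux hu hw _ hgraph
  have hX := hm.coordChange_x hc
  have hθ := hm.src_inClass
  have htgt := hm.tgt_inClass hc
  rw [hm.φ_eq t ht x hx _ hux] at hw ⊢
  simp only at hw ⊢
  have hev : ∀ᶠ q : ℝ × ℝ in 𝓝 (t, x),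
      w (c.ε₄ * q.1 + c.ε₁) (c.ε₅ * ξ q.2 + c.ε₂) = c.ε₆ * u q.1 q.2 + c.ε₃ := by
    filter_upwards [hgraph, prod_mem_nhds (hm.tdom_interval.mem_nhds ht)
      (hθ.xdom_interval.mem_nhds hx), hu.continuousAt.eventually (hθ.udom_interval.mem_nhds hux)]
      with q h1 h2 h3
    rwa [hm.φ_eq q.1 h2.1 q.2 h2.2 _ h3] at h1
  have hval : w (c.ε₄ * t + c.ε₁) (c.ε₅ * ξ x + c.ε₂) = c.ε₆ * u t x + c.ε₃ := hev.self_of_nhds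
  have hut : ContDiffAt ℝ 2 (fun s => u s x) t :=
    (hu.comp t (f := fun s => (s, x)) (by fun_prop)).of_le two_le_infty
  have hux' : ContDiffAt ℝ 2 (fun y => u t y) x :=
    (hu.comp x (f := fun y => (t, y)) (by fun_prop)).of_le two_le_infty
  have hwt : ContDiffAt ℝ 2 (fun s => w s (c.ε₅ * ξ x + c.ε₂)) (c.ε₄ * t + c.ε₁) :=
    (hw.comp (c.ε₄ * t + c.ε₁) (f := fun s => (s, c.ε₅ * ξ x + c.ε₂)) (by fun_prop)).of_le
      two_le_infty
  have hwx : ContDiffAt ℝ 2 (fun y => w (c.ε₄ * t + c.ε₁) y) (c.ε₅ * ξ x + c.ε₂) :=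
    (hw.comp (c.ε₅ * ξ x + c.ε₂) (f := fun y => (c.ε₄ * t + c.ε₁, y)) (by fun_prop)).of_le
      two_le_infty
  have hevt : (fun s => w (c.ε₄ * s + c.ε₁) (c.ε₅ * ξ x + c.ε₂))
      =ᶠ[𝓝 t] fun s => c.ε₆ * u s x + c.ε₃ :=
    (Continuous.tendsto' (by fun_prop : Continuous fun s : ℝ => (s, x)) t (t, x) rfl).eventually hev
  have hevx : (fun y => w (c.ε₄ * t + c.ε₁) (c.ε₅ * ξ y + c.ε₂))
      =ᶠ[𝓝 x] fun y => c.ε₆ * u t y + c.ε₃ :=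
    (Continuous.tendsto' (by fun_prop : Continuous fun y : ℝ => (t, y)) x (t, x) rfl).eventually hev
  have hT1 : deriv (fun s => c.ε₄ * s + c.ε₁) = fun _ => c.ε₄ := by
    ext s
    simp
  have hX1 : deriv (fun y => c.ε₅ * ξ y + c.ε₂) x = c.ε₅ * Real.exp (c.ε₉ * η x) :=
    (hX.hasDerivAt x hx).deriv
  have hX2 : deriv (deriv (fun y => c.ε₅ * ξ y + c.ε₂)) x
      = c.ε₅ * (Real.exp (c.ε₉ * η x) * (c.ε₉ * m.src.h x)) := by
    have he : deriv (fun y => c.ε₅ * ξ y + c.ε₂) =ᶠ[𝓝 x]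
        fun y => c.ε₅ * Real.exp (c.ε₉ * η y) := by
      filter_upwards [hθ.xdom_interval.mem_nhds hx] with y hy using (hX.hasDerivAt y hy).deriv
    rw [he.deriv_eq]
    exact (((hm.deriv_η x hx).const_mul c.ε₉).exp.const_mul c.ε₅).deriv
  have hU1 : ∀ (g : ℝ → ℝ), deriv (fun s => c.ε₆ * g s + c.ε₃) = fun s => c.ε₆ * deriv g s := by
    intro g
    ext s
    simp
  have hU2 : ∀ (g : ℝ → ℝ) (s : ℝ),
      deriv (deriv (fun s => c.ε₆ * g s + c.ε₃)) s = c.ε₆ * deriv (deriv g) s := by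
    intro g s
    rw [hU1]
    simp
  have et := (deriv_deriv_comp (G := fun s => w s (c.ε₅ * ξ x + c.ε₂))
    (γ := fun s => c.ε₄ * s + c.ε₁) (s := t) hwt (by fun_prop)).2
  have ex := deriv_deriv_comp (G := fun y => w (c.ε₄ * t + c.ε₁) y)
    (γ := fun y => c.ε₅ * ξ y + c.ε₂) (s := x) hwx
    ((hX.contDiffAt hx).of_le two_le_infty)
  rw [hevt.deriv.deriv_eq, hU2, hT1] at et
  rw [hevx.deriv.deriv_eq, hevx.deriv_eq, hU2, hU1, hX1, hX2] at ex
  beta_reduce at ex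
  obtain ⟨ex1, ex2⟩ := ex
  rw [hθ.satisfiedAt_iff hux hux', htgt.satisfiedAt_iff
    (by rw [hval, hm.udom_eq]; exact mem_image_of_mem _ hux) hwx, hval, (hm.fh_eq x hx).1,
    (hm.fh_eq x hx).2, (hm.HK_eq _ hux).1, (hm.HK_eq _ hux).2,
    (hm.hasDerivAt_tgt_H hc hux).deriv]
  have hE : Real.exp (c.ε₉ * η x) ≠ 0 := (Real.exp_pos _).ne'
  have hE1 : Real.exp (-c.ε₉ * η x) = (Real.exp (c.ε₉ * η x))⁻¹ := by
    rw [← Real.exp_neg, neg_mul]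
  have hE2 : Real.exp (-2 * c.ε₉ * η x) = (Real.exp (c.ε₉ * η x))⁻¹ ^ 2 := by
    rw [← Real.exp_neg, ← Real.exp_nat_mul]
    congr 1
    push_cast
    ring
  rw [hE1, hE2]
  simp only [deriv_const', mul_zero, add_zero] at et
  generalize deriv (deriv (fun s => u s x)) t = utt at *
  generalize deriv (deriv (fun y => u t y)) x = uxx at *
  generalize deriv (fun y => u t y) x = ux at *
  generalize deriv (deriv (fun s => w s (c.ε₅ * ξ x + c.ε₂))) (c.ε₄ * t + c.ε₁) = wtt at *
  generalize deriv (deriv (fun y => w (c.ε₄ * t + c.ε₁) y)) (c.ε₅ * ξ x + c.ε₂) = wxx at *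
  generalize deriv (fun y => w (c.ε₄ * t + c.ε₁) y) (c.ε₅ * ξ x + c.ε₂) = wx at *
  generalize Real.exp (c.ε₉ * η x) = E at *
  -- With the derivatives of u eliminated, the two equations differ by a nonzero factor only.
  have f1 : utt = wtt * c.ε₄ ^ 2 / c.ε₆ := by
    field_simp
    linarith
  have f2 : ux = wx * (c.ε₅ * E) / c.ε₆ := by
    field_simp
    linarith
  have f3 : uxx = (wxx * (c.ε₅ * E) ^ 2 + wx * (c.ε₅ * (E * (c.ε₉ * m.src.h x)))) / c.ε₆ := by
    field_simp
    linarith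
  subst f1 f2 f3
  constructor
  · intro h
    field_simp at h ⊢
    linear_combination h
  · intro h
    field_simp at h ⊢
    linear_combination h

lemma isAdmissible (hm : m.HasForm c η ξ) (hc : c.Nondegenerate) : m.IsAdmissible :=
  ⟨hm.src_inClass, hm.tgt_inClass hc, hm.isPointTransf hc, hm.mapsEquation hc⟩

end Transf.HasForm

lemma exists_hasForm {θ : ArbElts} (hθ : θ.InClass) {c : Params} (hc : c.Nondegenerate)
    {S : Set ℝ} (hS : IsOpenInterval S) {η ξ : ℝ → ℝ}
    (hη : ∀ x ∈ θ.xdom, HasDerivAt η (θ.h x) x)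
    (hξ : ∀ x ∈ θ.xdom, HasDerivAt ξ (Real.exp (c.ε₉ * η x)) x) :
    ∃ m : Transf, m.HasForm c η ξ ∧ m.src = θ ∧ m.tdom = S := by
  have hX := hθ.isCoordChange (b := c.ε₂) hη hξ hc.ne.2.1
  have hU := IsCoordChange.affine (b := c.ε₃) hθ.udom_interval hc.ne.2.2.1
  let X : ℝ → ℝ := fun x => c.ε₅ * ξ x + c.ε₂
  let U : ℝ → ℝ := fun u => c.ε₆ * u + c.ε₃
  let Y := Function.invFunOn X θ.xdom
  let V := Function.invFunOn U θ.udom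
  have hY : ∀ x ∈ θ.xdom, Y (c.ε₅ * ξ x + c.ε₂) = x := fun x hx => hX.invFunOn_apply hx
  have hV : ∀ u ∈ θ.udom, V (c.ε₆ * u + c.ε₃) = u := fun u hu => hU.invFunOn_apply hu
  refine ⟨⟨S, fun p => (c.ε₄ * p.1 + c.ε₁, X p.2.1, U p.2.2), θ,
    ⟨X '' θ.xdom, U '' θ.udom,
      fun y => c.ε₄ ^ 2 * c.ε₅⁻¹ * c.ε₇ * θ.f (Y y) * Real.exp (-2 * c.ε₉ * η (Y y)),
      fun y => c.ε₇ * c.ε₈⁻¹ * θ.h (Y y) * Real.exp (-c.ε₉ * η (Y y)),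
      fun v => c.ε₅ * c.ε₇ * θ.H (V v),
      fun v => c.ε₈ * (θ.K (V v) + c.ε₉ * θ.H (V v))⟩⟩,
    ⟨hθ, hS, hη, hξ, fun _ _ _ _ _ _ => rfl, rfl, rfl, fun x hx => ?_, fun u hu => ?_⟩, rfl, rfl⟩
  · simp only [hY x hx, and_self]
  · simp only [hV u hu, and_self]

lemma exists_antiderivs {θ : ArbElts} (hθ : θ.InClass) {a : ℝ} (ha : a ∈ θ.xdom) (k b d : ℝ) :
    ∃ η ξ : ℝ → ℝ, η a = b ∧ ξ a = d ∧ (∀ x ∈ θ.xdom, HasDerivAt η (θ.h x) x) ∧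
      (∀ x ∈ θ.xdom, HasDerivAt ξ (Real.exp (k * η x)) x) := by
  obtain ⟨η, hηa, hη⟩ := hθ.exists_antideriv ha b
  have hη' := (hθ.contDiffOn_antideriv hη).continuousOn
  obtain ⟨ξ, hξa, hξ⟩ := hθ.xdom_interval.exists_antideriv (h := fun x => Real.exp (k * η x))
    (Real.continuous_exp.comp_continuousOn (continuousOn_const.mul hη')) ha d
  exact ⟨η, ξ, hηa, hξa, hη, hξ⟩

theorem isExtendedEquivalence_transformation {c : Params} (hc : c.Nondegenerate) :
    IsExtendedEquivalence (transformation c) := by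
  refine ⟨?_, ?_, ?_⟩
  · intro m hm
    obtain ⟨η, ξ, h⟩ := mem_transformation_iff.1 hm
    exact h.isAdmissible hc
  · intro θ hθ
    obtain ⟨a, ha⟩ := hθ.xdom_interval.2.1
    obtain ⟨η, ξ, -, -, hη, hξ⟩ := exists_antiderivs hθ ha c.ε₉ 0 0
    obtain ⟨m, hm, hsrc, -⟩ := exists_hasForm hθ hc
      (S := univ) ⟨isOpen_univ, univ_nonempty, ordConnected_univ⟩ hη hξ
    exact ⟨m, mem_transformation_iff.2 ⟨η, ξ, hm⟩, hsrc⟩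
  · intro m hm θ' hθ' A B hA hB hAs hBs hag
    obtain ⟨η, ξ, h⟩ := mem_transformation_iff.1 hm
    obtain ⟨a, ha⟩ := hA.2.1
    -- The integration constants at θ' are fixed by matching the given antiderivatives at one point
    -- of A; since h is the same on A, they then agree on all of A.
    obtain ⟨η', ξ', hηa, hξa, hη', hξ'⟩ := exists_antiderivs hθ' (hAs ha).2 c.ε₉ (η a) (ξ a)
    obtain ⟨m', hm', hsrc, htd⟩ := exists_hasForm hθ' hc h.tdom_interval hη' hξ'
    refine ⟨m', mem_transformation_iff.2 ⟨η', ξ', hm'⟩, hsrc, htd, ?_⟩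
    have e1 : ∀ x ∈ A, η' x = η x := by
      intro x hx
      have := hA.sub_eq_sub_of_hasDerivAt (g := η) (k := η') (d := m.src.h)
        (fun s hs => h.deriv_η s (hAs hs).1)
        (fun s hs => by rw [← (hag.1 s hs).2]; exact hη' s (hAs hs).2) ha hx
      linarith
    have e2 : ∀ x ∈ A, ξ' x = ξ x := by
      intro x hx
      have := hA.sub_eq_sub_of_hasDerivAt (g := ξ) (k := ξ') (d := fun x => Real.exp (c.ε₉ * η x))
        (fun s hs => h.deriv_ξ s (hAs hs).1)
        (fun s hs => by rw [← e1 s hs]; exact hξ' s (hAs hs).2) ha hx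
      linarith
    rintro ⟨t, x, u⟩ ⟨ht, hx, hu⟩
    simp only at ht hx hu
    subst hsrc
    rw [h.φ_eq t ht x (hAs hx).1 u (hBs hu).1,
      hm'.φ_eq t (htd ▸ ht) x (hAs hx).2 u (hBs hu).2, e2 x hx]
    simp only
    have hf := hm'.fh_eq x (hAs hx).2
    have hH := hm'.HK_eq u (hBs hu).2
    rw [e2 x hx, e1 x hx, (hag.1 x hx).1, (hag.1 x hx).2] at hf
    rw [(hag.2 u hu).1, (hag.2 u hu).2] at hH
    rw [hf.1, hf.2, hH.1, hH.2, (h.fh_eq x (hAs hx).1).1, (h.fh_eq x (hAs hx).1).2,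
      (h.HK_eq u (hBs hu).1).1, (h.HK_eq u (hBs hu).1).2]
    simp only [and_self]

end TelegraphG1

namespace TelegraphG1

/-! ### Identity, compositions and inverses -/

lemma Transf.IsIdentity.exists_mem {m : Transf} (hm : m.IsIdentity) :
    ∃ c : Params, c.Nondegenerate ∧ m ∈ transformation c := by
  obtain ⟨hsrc, ht, ⟨hxd, hud, hfh, hHK⟩, hφ⟩ := hm
  obtain ⟨a, ha⟩ := hsrc.xdom_interval.2.1
  obtain ⟨η, -, hη⟩ := hsrc.exists_antideriv ha 0
  -- With ε₉ = 0 the integrand of ξ is 1, so the identity function serves as ξ.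
  refine ⟨⟨0, 0, 0, 1, 1, 1, 1, 1, 0⟩, by simp [Params.Nondegenerate],
    mem_transformation_iff.2 ⟨η, id, hsrc, ht, hη, fun x _ => ?_, fun t ht x hx u hu => ?_, ?_, ?_,
      fun x hx => ?_, fun u hu => ?_⟩⟩
  · simpa using hasDerivAt_id x
  · simpa using hφ (t, x, u) ⟨ht, hx, hu⟩
  · simp [hxd]
  · simp [hud]
  · simpa using hfh x hx
  · simpa using hHK u hu

namespace Transf.HasForm

variable {m m' : Transf} {c c' : Params} {η ξ η' ξ' : ℝ → ℝ}

lemma apply_x_mem (hm : m.HasForm c η ξ) {x : ℝ} (hx : x ∈ m.src.xdom) :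
    c.ε₅ * ξ x + c.ε₂ ∈ m.tgt.xdom :=
  hm.xdom_eq ▸ mem_image_of_mem (fun x => c.ε₅ * ξ x + c.ε₂) hx

lemma apply_u_mem (hm : m.HasForm c η ξ) {u : ℝ} (hu : u ∈ m.src.udom) :
    c.ε₆ * u + c.ε₃ ∈ m.tgt.udom :=
  hm.udom_eq ▸ mem_image_of_mem (fun u => c.ε₆ * u + c.ε₃) hu

lemma image_t (hm : m.HasForm c η ξ) :
    (fun p => (m.φ p).1) '' m.dom = (fun t => c.ε₄ * t + c.ε₁) '' m.tdom := by
  obtain ⟨x, hx⟩ := hm.src_inClass.xdom_interval.2.1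
  obtain ⟨u, hu⟩ := hm.src_inClass.udom_interval.2.1
  ext s
  constructor
  · rintro ⟨⟨t, x, u⟩, ⟨ht, hx, hu⟩, rfl⟩
    exact ⟨t, ht, by simp only [hm.φ_eq t ht x hx u hu]⟩
  · rintro ⟨t, ht, rfl⟩
    exact ⟨(t, x, u), ⟨ht, hx, hu⟩, by simp only [hm.φ_eq t ht x hx u hu]⟩

/-- As h̃ dx̃ = k h dx with k = ε₅ε₇/ε₈, an antiderivative of h̃ pulls back to kη + C. The exponents
therefore combine to ε₉ + kε₉', and the factor e^{ε₉'C} coming from the integration constant goes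
into ε₅, its inverse into ε₇. -/
lemma comp_mem (hm : m.HasForm c η ξ) (hm' : m'.HasForm c' η' ξ') (hc : c.Nondegenerate)
    (hc' : c'.Nondegenerate) (h : m'.Composable m) :
    ∃ d : Params, d.Nondegenerate ∧ m'.comp m ∈ transformation d := by
  obtain ⟨h4, h5, h6, h7, h8⟩ := hc.ne
  obtain ⟨h4', h5', h6', h7', h8'⟩ := hc'.ne
  obtain ⟨⟨hxd, hud, hfh, hHK⟩, htd⟩ := h
  rw [hm.image_t] at htd
  have hθ := hm.src_inClass
  obtain ⟨a, ha⟩ := hθ.xdom_interval.2.1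
  have hX := hm.coordChange_x hc
  have hxm : ∀ x ∈ m.src.xdom, c.ε₅ * ξ x + c.ε₂ ∈ m'.src.xdom := fun x hx =>
    hxd ▸ hm.apply_x_mem hx
  have hum : ∀ u ∈ m.src.udom, c.ε₆ * u + c.ε₃ ∈ m'.src.udom := fun u hu =>
    hud ▸ hm.apply_u_mem hu
  have htm : ∀ t ∈ m.tdom, c.ε₄ * t + c.ε₁ ∈ m'.tdom := fun t ht =>
    htd ▸ mem_image_of_mem (fun t => c.ε₄ * t + c.ε₁) ht
  set k := c.ε₅ * c.ε₇ * c.ε₈⁻¹ with hk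
  obtain ⟨C, hC⟩ : ∃ C, ∀ x ∈ m.src.xdom, η' (c.ε₅ * ξ x + c.ε₂) = k * η x + C := by
    refine ⟨η' (c.ε₅ * ξ a + c.ε₂) - k * η a, fun x hx => ?_⟩
    have := hθ.xdom_interval.sub_eq_sub_of_hasDerivAt
      (g := fun x => η' (c.ε₅ * ξ x + c.ε₂)) (k := fun x => k * η x) (d := fun x => k * m.src.h x)
      (fun s hs => ?_) (fun s hs => (hm.deriv_η s hs).const_mul k) ha hx
    · linarith
    · have h1 := (hm'.deriv_η _ (hxm s hs)).comp s (hX.hasDerivAt s hs)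
      rw [(hfh _ (hm.apply_x_mem hs)).2, (hm.fh_eq s hs).2] at h1
      refine h1.congr_deriv ?_
      rw [neg_mul, Real.exp_neg, hk]
      field_simp
  have hE := (Real.exp_pos (c'.ε₉ * C)).ne'
  refine ⟨⟨c'.ε₄ * c.ε₁ + c'.ε₁, c'.ε₂, c'.ε₆ * c.ε₃ + c'.ε₃, c'.ε₄ * c.ε₄,
    c'.ε₅ * c.ε₅ * Real.exp (c'.ε₉ * C), c'.ε₆ * c.ε₆,
    c'.ε₇ * c.ε₇ * (Real.exp (c'.ε₉ * C))⁻¹, c'.ε₈ * c.ε₈, c.ε₉ + k * c'.ε₉⟩, ?_,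
    mem_transformation_iff.2 ⟨η,
      fun x => (Real.exp (c'.ε₉ * C))⁻¹ * c.ε₅⁻¹ * ξ' (c.ε₅ * ξ x + c.ε₂),
      hθ, hm.tdom_interval, hm.deriv_η, fun x hx => ?_, fun t ht x hx u hu => ?_, ?_, ?_,
      fun x hx => ?_, fun u hu => ?_⟩⟩
  · simp only [Params.Nondegenerate]
    positivity
  · have h1 := ((hm'.deriv_ξ _ (hxm x hx)).comp x (hX.hasDerivAt x hx)).const_mul
      ((Real.exp (c'.ε₉ * C))⁻¹ * c.ε₅⁻¹)
    rw [hC x hx] at h1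
    refine h1.congr_deriv ?_
    rw [show (c.ε₉ + k * c'.ε₉) * η x = c.ε₉ * η x + c'.ε₉ * (k * η x) by ring,
      show c'.ε₉ * (k * η x + C) = c'.ε₉ * (k * η x) + c'.ε₉ * C by ring,
      Real.exp_add, Real.exp_add]
    field_simp
  · change m'.φ (m.φ (t, x, u)) = _
    rw [hm.φ_eq t ht x hx u hu, hm'.φ_eq _ (htm t ht) _ (hxm x hx) _ (hum u hu)]
    refine Prod.ext ?_ (Prod.ext ?_ ?_)
    · simp only
      ring
    · simp only
      field_simp
    · simp only
      ring
  · change m'.tgt.xdom = _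
    rw [hm'.xdom_eq, hxd, hm.xdom_eq, image_image]
    refine image_congr fun x hx => ?_
    simp only
    field_simp
  · change m'.tgt.udom = _
    rw [hm'.udom_eq, hud, hm.udom_eq, image_image]
    refine image_congr fun x hx => ?_
    simp only
    ring
  · have e : c'.ε₅ * c.ε₅ * Real.exp (c'.ε₉ * C) *
        ((Real.exp (c'.ε₉ * C))⁻¹ * c.ε₅⁻¹ * ξ' (c.ε₅ * ξ x + c.ε₂)) + c'.ε₂
        = c'.ε₅ * ξ' (c.ε₅ * ξ x + c.ε₂) + c'.ε₂ := by field_simp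
    simp only [Transf.comp, e]
    rw [(hm'.fh_eq _ (hxm x hx)).1, (hm'.fh_eq _ (hxm x hx)).2,
      (hfh _ (hm.apply_x_mem hx)).1, (hfh _ (hm.apply_x_mem hx)).2, (hm.fh_eq x hx).1,
      (hm.fh_eq x hx).2, hC x hx]
    constructor
    · rw [show -2 * c'.ε₉ * (k * η x + C) =
          -(c'.ε₉ * (k * η x)) + -(c'.ε₉ * (k * η x)) + (-(c'.ε₉ * C) + -(c'.ε₉ * C)) by ring,
        show -2 * (c.ε₉ + k * c'.ε₉) * η x =
          -(c'.ε₉ * (k * η x)) + -(c'.ε₉ * (k * η x)) + -2 * c.ε₉ * η x by ring]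
      simp only [Real.exp_add, Real.exp_neg (c'.ε₉ * C)]
      field_simp
    · rw [show -c'.ε₉ * (k * η x + C) = -(c'.ε₉ * (k * η x)) + -(c'.ε₉ * C) by ring,
        show -(c.ε₉ + k * c'.ε₉) * η x = -(c'.ε₉ * (k * η x)) + -c.ε₉ * η x by ring]
      simp only [Real.exp_add, Real.exp_neg (c'.ε₉ * C)]
      field_simp
  · have e : c'.ε₆ * c.ε₆ * u + (c'.ε₆ * c.ε₃ + c'.ε₃) = c'.ε₆ * (c.ε₆ * u + c.ε₃) + c'.ε₃ := by
      ring
    simp only [Transf.comp, e]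
    rw [(hm'.HK_eq _ (hum u hu)).1, (hm'.HK_eq _ (hum u hu)).2,
      (hHK _ (hm.apply_u_mem hu)).1, (hHK _ (hm.apply_u_mem hu)).2, (hm.HK_eq u hu).1,
      (hm.HK_eq u hu).2, hk]
    constructor
    · field_simp
    · field_simp
      ring

/-- With Y the inverse of the x-component and k = ε₅ε₇/ε₈, kη∘Y is an antiderivative of h̃. Hence ε₉
becomes -ε₉/k, and ε₅Y, whose derivative is e^{-ε₉η∘Y}, serves as ξ. -/
lemma inverse_mem (hm : m.HasForm c η ξ) (hc : c.Nondegenerate) (h : m'.IsInverse m) :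
    ∃ d : Params, d.Nondegenerate ∧ m' ∈ transformation d := by
  obtain ⟨h4, h5, h6, h7, h8⟩ := hc.ne
  obtain ⟨⟨hsame, htd⟩, ⟨hxd', hud', hfh', hHK'⟩, hinv⟩ := h
  have hsrc' : m'.src.InClass := hsame.inClass (hm.tgt_inClass hc)
  obtain ⟨hxd, hud, hfh, hHK⟩ := hsame
  rw [hm.image_t] at htd
  have hθ := hm.src_inClass
  have hX := hm.coordChange_x hc
  have hxim := hxd.trans hm.xdom_eq
  have huim := hud.trans hm.udom_eq
  set Y := Function.invFunOn (fun x => c.ε₅ * ξ x + c.ε₂) m.src.xdom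
  have hYX : ∀ x ∈ m.src.xdom, Y (c.ε₅ * ξ x + c.ε₂) = x := fun x hx => hX.invFunOn_apply hx
  have hY := hX.inverse hYX
  set k := c.ε₅ * c.ε₇ * c.ε₈⁻¹ with hk
  have hkne : k ≠ 0 := by positivity
  refine ⟨⟨-c.ε₁ / c.ε₄, 0, -c.ε₃ / c.ε₆, c.ε₄⁻¹, c.ε₅⁻¹, c.ε₆⁻¹, c.ε₇⁻¹, c.ε₈⁻¹, -c.ε₉ / k⟩, ?_,
    mem_transformation_iff.2 ⟨fun y => k * η (Y y), fun y => c.ε₅ * Y y,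
      hsrc', ?_, ?_, ?_, ?_, ?_, ?_, ?_, ?_⟩⟩
  · simp only [Params.Nondegenerate]
    positivity
  · rw [htd]
    exact (IsCoordChange.affine hm.tdom_interval h4).image_interval
  · rw [hxim]
    rintro _ ⟨x, hx, rfl⟩
    have h1 := hm.deriv_η x hx
    rw [← hYX x hx] at h1
    have h2 := (h1.comp _ (hY.hasDerivAt _ (mem_image_of_mem _ hx))).const_mul k
    rw [hYX x hx] at h2
    refine h2.congr_deriv ?_
    rw [(hfh _ (hm.apply_x_mem hx)).2, (hm.fh_eq x hx).2, neg_mul, Real.exp_neg, hk]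
    field_simp
  · rw [hxim]
    rintro _ ⟨x, hx, rfl⟩
    have h2 := (hY.hasDerivAt _ (mem_image_of_mem _ hx)).const_mul c.ε₅
    rw [hYX x hx] at h2
    refine h2.congr_deriv ?_
    simp only [hYX x hx]
    rw [show -c.ε₉ / k * (k * η x) = -(c.ε₉ * η x) by field_simp, Real.exp_neg]
    field_simp
  · rw [htd, hxim, huim]
    rintro _ ⟨t, ht, rfl⟩ _ ⟨x, hx, rfl⟩ _ ⟨u, hu, rfl⟩
    have h1 := hinv (t, x, u) ⟨ht, hx, hu⟩
    rw [hm.φ_eq t ht x hx u hu] at h1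
    rw [h1, hYX x hx]
    refine Prod.ext ?_ (Prod.ext ?_ ?_)
    · simp only
      field_simp
      ring
    · simp only
      field_simp
      ring
    · simp only
      field_simp
      ring
  · rw [hxd', hxim, image_image]
    rw [image_congr (g := id), image_id]
    intro x hx
    simp only [hYX x hx, id]
    field_simp
    ring
  · rw [hud', huim, image_image]
    rw [image_congr (g := id), image_id]
    intro x hx
    simp only [id]
    field_simp
    ring
  · rw [hxim]
    rintro _ ⟨x, hx, rfl⟩
    have e : c.ε₅⁻¹ * (c.ε₅ * x) + 0 = x := by
      field_simp
      ring
    simp only [hYX x hx, e]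
    rw [(hfh' x hx).1, (hfh' x hx).2, (hfh _ (hm.apply_x_mem hx)).1,
      (hfh _ (hm.apply_x_mem hx)).2, (hm.fh_eq x hx).1, (hm.fh_eq x hx).2]
    constructor
    · rw [show -2 * (-c.ε₉ / k) * (k * η x) = -(-2 * c.ε₉ * η x) by field_simp, Real.exp_neg]
      field_simp
    · rw [show -(-c.ε₉ / k) * (k * η x) = -(-c.ε₉ * η x) by field_simp, Real.exp_neg]
      field_simp
  · rw [huim]
    rintro _ ⟨u, hu, rfl⟩
    have e : c.ε₆⁻¹ * (c.ε₆ * u + c.ε₃) + -c.ε₃ / c.ε₆ = u := by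
      field_simp
      ring
    simp only [e]
    rw [(hHK' u hu).1, (hHK' u hu).2, (hHK _ (hm.apply_u_mem hu)).1,
      (hHK _ (hm.apply_u_mem hu)).2, (hm.HK_eq u hu).1, (hm.HK_eq u hu).2, hk]
    constructor
    · field_simp
    · field_simp
      ring

end Transf.HasForm

lemma Transf.IsPointTransf.exists_isInverse {m : Transf} (hm : m.IsPointTransf) :
    ∃ m' : Transf, m'.IsInverse m := by
  refine ⟨⟨(fun p => (m.φ p).1) '' m.dom, Function.invFunOn m.φ m.dom, m.tgt, m.src⟩,
    ⟨ArbElts.Same.refl _, rfl⟩, ArbElts.Same.refl _, fun p hp => ?_⟩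
  exact hm.injOn.leftInvOn_invFunOn hp

end TelegraphG1

namespace TelegraphG1

/-! ### Second-order jets -/

section Curves

variable {E : Type*} [NormedAddCommGroup E] [NormedSpace ℝ E]

lemma hasDerivAt_comp_curve {G : E → ℝ} {γ γ' : ℝ → E} {γ'' : E} {s : ℝ}
    (hG : ContDiffAt ℝ 2 G (γ s)) (hγ : ∀ᶠ r in 𝓝 s, HasDerivAt γ (γ' r) r)
    (hγ' : HasDerivAt γ' γ'' s) :
    (∀ᶠ r in 𝓝 s, HasDerivAt (fun r => G (γ r)) (fderiv ℝ G (γ r) (γ' r)) r) ∧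
    HasDerivAt (fun r => fderiv ℝ G (γ r) (γ' r))
      (fderiv ℝ (fderiv ℝ G) (γ s) (γ' s) (γ' s) + fderiv ℝ G (γ s) γ'') s := by
  have hs := hγ.self_of_nhds
  refine ⟨?_, ?_⟩
  · filter_upwards [hs.continuousAt.eventually (hG.eventually (by simp)), hγ] with r h1 h2
    exact (h1.differentiableAt (by simp)).hasFDerivAt.comp_hasDerivAt r h2
  · have h1 : ContDiffAt ℝ 1 (fderiv ℝ G) (γ s) := hG.fderiv_right (by norm_num)
    have h2 := (h1.differentiableAt (by simp)).hasFDerivAt.comp_hasDerivAt s hs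
    exact h2.clm_apply hγ'

lemma deriv_comp_curve {G : E → ℝ} {γ γ' : ℝ → E} {γ'' : E} {s : ℝ}
    (hG : ContDiffAt ℝ 2 G (γ s)) (hγ : ∀ᶠ r in 𝓝 s, HasDerivAt γ (γ' r) r)
    (hγ' : HasDerivAt γ' γ'' s) :
    deriv (fun r => G (γ r)) s = fderiv ℝ G (γ s) (γ' s) ∧
    deriv (deriv (fun r => G (γ r))) s
      = fderiv ℝ (fderiv ℝ G) (γ s) (γ' s) (γ' s) + fderiv ℝ G (γ s) γ'' := by
  obtain ⟨h1, h2⟩ := hasDerivAt_comp_curve hG hγ hγ'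
  refine ⟨h1.self_of_nhds.deriv, ?_⟩
  have he : deriv (fun r => G (γ r)) =ᶠ[𝓝 s] fun r => fderiv ℝ G (γ r) (γ' r) :=
    h1.mono fun r hr => hr.deriv
  rw [he.deriv_eq, h2.deriv]

end Curves

/-- The function with value `u` and the second-order jet `(p, q, r, s, v)` at `(t, x)`. -/
noncomputable def jetFun (t x u p q r s v : ℝ) (y z : ℝ) : ℝ :=
  u + p * (y - t) + q * (z - x) + r / 2 * (y - t) ^ 2 + s * ((y - t) * (z - x))
    + v / 2 * (z - x) ^ 2

lemma contDiff_jetFun (t x u p q r s v : ℝ) :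
    ContDiff ℝ ∞ fun z : ℝ × ℝ => jetFun t x u p q r s v z.1 z.2 := by
  unfold jetFun
  fun_prop

lemma jetFun_self (t x u p q r s v : ℝ) : jetFun t x u p q r s v t x = u := by
  simp [jetFun]

lemma deriv_quadratic (A B C t : ℝ) :
    deriv (fun y => A + B * (y - t) + C / 2 * (y - t) ^ 2) = fun y => B + C * (y - t) := by
  ext y
  have h := ((((hasDerivAt_id y).sub_const t).const_mul B).const_add A).add
    ((((hasDerivAt_id y).sub_const t).pow 2).const_mul (C / 2))
  refine HasDerivAt.deriv (h.congr_deriv ?_)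
  simp
  ring

lemma jetFun_derivs (t x u p q r s v : ℝ) :
    deriv (deriv (fun y => jetFun t x u p q r s v y x)) t = r ∧
    deriv (fun z => jetFun t x u p q r s v t z) x = q ∧
    deriv (deriv (fun z => jetFun t x u p q r s v t z)) x = v := by
  have e1 : (fun y => jetFun t x u p q r s v y x)
      = fun y => u + p * (y - t) + r / 2 * (y - t) ^ 2 := by
    ext y
    simp [jetFun]
  have e2 : (fun z => jetFun t x u p q r s v t z)
      = fun z => u + q * (z - x) + v / 2 * (z - x) ^ 2 := by
    ext y
    simp [jetFun]
  rw [e1, e2, deriv_quadratic, deriv_quadratic]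
  refine ⟨?_, by simp, ?_⟩ <;> simp

/-- The lift of the direction `(a, b)` to the tangent plane of a graph with slopes `p`, `q`. -/
noncomputable def tlift (p q a b : ℝ) : ℝ × ℝ × ℝ := (a, b, p * a + q * b)

/-- Coefficient of the second derivative of the transformed function along the direction `(a, b)`,
with `l = dT`, `wT`, `wX` the first derivatives of the transformed function. -/
noncomputable def secondAlong (T X U : ℝ × ℝ × ℝ → ℝ) (P : ℝ × ℝ × ℝ) (wT wX p q r s v a b : ℝ) : ℝ :=
  fderiv ℝ (fderiv ℝ U) P (tlift p q a b) (tlift p q a b)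
    - wT * fderiv ℝ (fderiv ℝ T) P (tlift p q a b) (tlift p q a b)
    - wX * fderiv ℝ (fderiv ℝ X) P (tlift p q a b) (tlift p q a b)
    + (r * a ^ 2 + 2 * s * (a * b) + v * b ^ 2) *
      (fderiv ℝ U P (0, 0, 1) - wT * fderiv ℝ T P (0, 0, 1) - wX * fderiv ℝ X P (0, 0, 1))

namespace Transf

/-- The `t̃`-component. -/
def T (m : Transf) (p : ℝ × ℝ × ℝ) : ℝ := (m.φ p).1
/-- The `x̃`-component. -/
def X (m : Transf) (p : ℝ × ℝ × ℝ) : ℝ := (m.φ p).2.1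
/-- The `ũ`-component. -/
def U (m : Transf) (p : ℝ × ℝ × ℝ) : ℝ := (m.φ p).2.2

namespace IsAdmissible

variable {m : Transf}

lemma isOpen_dom (hm : m.IsAdmissible) : IsOpen m.dom :=
  Transf.isOpen_dom hm.src_inClass hm.isPointTransf.tdom_interval

lemma contDiffAt_φ (hm : m.IsAdmissible) {P : ℝ × ℝ × ℝ} (hP : P ∈ m.dom) :
    ContDiffAt ℝ ∞ m.φ P :=
  hm.isPointTransf.smooth.contDiffAt (hm.isOpen_dom.mem_nhds hP)

lemma contDiffAt_T (hm : m.IsAdmissible) {P : ℝ × ℝ × ℝ} (hP : P ∈ m.dom) :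
    ContDiffAt ℝ ∞ m.T P :=
  (hm.contDiffAt_φ hP).fst

lemma contDiffAt_X (hm : m.IsAdmissible) {P : ℝ × ℝ × ℝ} (hP : P ∈ m.dom) :
    ContDiffAt ℝ ∞ m.X P :=
  (hm.contDiffAt_φ hP).snd.fst

lemma contDiffAt_U (hm : m.IsAdmissible) {P : ℝ × ℝ × ℝ} (hP : P ∈ m.dom) :
    ContDiffAt ℝ ∞ m.U P :=
  (hm.contDiffAt_φ hP).snd.snd

lemma X_mem (hm : m.IsAdmissible) {P : ℝ × ℝ × ℝ} (hP : P ∈ m.dom) : m.X P ∈ m.tgt.xdom :=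
  hm.isPointTransf.image_x ▸ mem_image_of_mem _ hP

lemma U_mem (hm : m.IsAdmissible) {P : ℝ × ℝ × ℝ} (hP : P ∈ m.dom) : m.U P ∈ m.tgt.udom :=
  hm.isPointTransf.image_u ▸ mem_image_of_mem _ hP

/-- If a second-order jet satisfies the initial equation, its image satisfies the new equation. -/
lemma jet_identity (hm : m.IsAdmissible) {t x u : ℝ} (hP : (t, x, u) ∈ m.dom)
    {p q r s v a₁ a₂ b₁ b₂ wT wX : ℝ}
    (hTa : fderiv ℝ m.T (t, x, u) (tlift p q a₁ a₂) = 1)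
    (hXa : fderiv ℝ m.X (t, x, u) (tlift p q a₁ a₂) = 0)
    (hTb : fderiv ℝ m.T (t, x, u) (tlift p q b₁ b₂) = 0)
    (hXb : fderiv ℝ m.X (t, x, u) (tlift p q b₁ b₂) = 1)
    (hwT : fderiv ℝ m.U (t, x, u) (tlift p q a₁ a₂) = wT)
    (hwX : fderiv ℝ m.U (t, x, u) (tlift p q b₁ b₂) = wX)
    (hsat : m.src.f x * r = m.src.H u * v + deriv m.src.H u * q ^ 2 + m.src.h x * m.src.K u * q) :
    m.tgt.f (m.X (t, x, u)) * secondAlong m.T m.X m.U (t, x, u) wT wX p q r s v a₁ a₂ =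
      m.tgt.H (m.U (t, x, u)) * secondAlong m.T m.X m.U (t, x, u) wT wX p q r s v b₁ b₂
        + deriv m.tgt.H (m.U (t, x, u)) * wX ^ 2
        + m.tgt.h (m.X (t, x, u)) * m.tgt.K (m.U (t, x, u)) * wX := by
  set P : ℝ × ℝ × ℝ := (t, x, u) with hPdef
  set g := jetFun t x u p q r s v with hg
  have hgc : ContDiff ℝ ∞ fun z : ℝ × ℝ => g z.1 z.2 := contDiff_jetFun t x u p q r s v
  have hg0 : g t x = u := jetFun_self t x u p q r s v
  let j : ℝ × ℝ → ℝ × ℝ × ℝ := fun z => (z.1, z.2, g z.1 z.2)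
  have hj : ContDiff ℝ ∞ j := contDiff_fst.prodMk (contDiff_snd.prodMk hgc)
  have hj0 : j (t, x) = P := by simp only [j, hg0, hPdef]
  let Φ : ℝ × ℝ → ℝ × ℝ := fun z => (m.T (j z), m.X (j z))
  have hT := hm.contDiffAt_T hP
  have hX := hm.contDiffAt_X hP
  have hU := hm.contDiffAt_U hP
  have hΦ : ContDiffAt ℝ ∞ Φ (t, x) :=
    ContDiffAt.prodMk ((hj0 ▸ hT : ContDiffAt ℝ ∞ m.T (j (t, x))).comp _ hj.contDiffAt)
      ((hj0 ▸ hX : ContDiffAt ℝ ∞ m.X (j (t, x))).comp _ hj.contDiffAt)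
  let ρ : ℝ → ℝ → ℝ := fun a b => r * a ^ 2 + 2 * s * (a * b) + v * b ^ 2
  -- The curve in the graph of `g` over the line through (t, x) with direction (a, b). As `g` is
  -- quadratic, its acceleration is the constant (0, 0, ρ a b).
  let γ : ℝ → ℝ → ℝ → ℝ × ℝ × ℝ := fun a b y => j (t + y * a, x + y * b)
  have hγ0 : ∀ a b, γ a b 0 = P := fun a b => by simp only [γ, zero_mul, add_zero, hj0]
  let γ' : ℝ → ℝ → ℝ → ℝ × ℝ × ℝ := fun a b y => (a, b, p * a + q * b + ρ a b * y)
  have hγ : ∀ a b y, HasDerivAt (γ a b) (γ' a b y) y := by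
    intro a b y
    refine HasDerivAt.prodMk ?_ (HasDerivAt.prodMk ?_ ?_)
    · simpa using ((hasDerivAt_id y).mul_const a).const_add t
    · simpa using ((hasDerivAt_id y).mul_const b).const_add x
    · have h := (((hasDerivAt_id y).const_mul (p * a + q * b)).const_add u).fun_add
        (((hasDerivAt_id y).fun_pow 2).const_mul (ρ a b / 2))
      have h' := h.congr_of_eventuallyEq (f₁ := fun y => g (t + y * a) (x + y * b))
        (Eventually.of_forall fun y => by
          simp only [hg, jetFun, ρ, id]
          ring)
      refine h'.congr_deriv ?_
      simp
      ring
  have hγ' : ∀ a b, HasDerivAt (γ' a b) (0, 0, ρ a b) 0 := by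
    intro a b
    refine (hasDerivAt_const _ _).prodMk ((hasDerivAt_const _ _).prodMk ?_)
    simpa using ((hasDerivAt_id (0 : ℝ)).const_mul (ρ a b)).const_add (p * a + q * b)
  have hγ'0 : ∀ a b, γ' a b 0 = tlift p q a b := fun a b => by simp [γ', tlift]
  have comp : ∀ {G : ℝ × ℝ × ℝ → ℝ}, ContDiffAt ℝ ∞ G P → ∀ a b,
      (∀ᶠ y in 𝓝 0, HasDerivAt (fun y => G (γ a b y)) (fderiv ℝ G (γ a b y) (γ' a b y)) y) ∧
      HasDerivAt (fun y => fderiv ℝ G (γ a b y) (γ' a b y))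
        (fderiv ℝ (fderiv ℝ G) P (tlift p q a b) (tlift p q a b)
          + ρ a b * fderiv ℝ G P (0, 0, 1)) 0 := by
    intro G hG a b
    have h := hasDerivAt_comp_curve (G := G) (γ := γ a b) (s := 0)
      (by rw [hγ0]; exact hG.of_le two_le_infty) (Eventually.of_forall (hγ a b)) (hγ' a b)
    refine ⟨h.1, h.2.congr_deriv ?_⟩
    rw [hγ0, hγ'0, show ((0, 0, ρ a b) : ℝ × ℝ × ℝ) = ρ a b • (0, 0, 1) by simp, map_smul,
      smul_eq_mul]
  -- the derivative of `Φ`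
  have hL : ∀ a b, fderiv ℝ Φ (t, x) (a, b)
      = (fderiv ℝ m.T P (tlift p q a b), fderiv ℝ m.X P (tlift p q a b)) := by
    intro a b
    have hline : HasDerivAt (fun y : ℝ => (t + y * a, x + y * b)) (a, b) 0 :=
      HasDerivAt.prodMk (by simpa using ((hasDerivAt_id (0 : ℝ)).mul_const a).const_add t)
        (by simpa using ((hasDerivAt_id (0 : ℝ)).mul_const b).const_add x)
    have h0 : ((t + 0 * a, x + 0 * b) : ℝ × ℝ) = (t, x) := by simp
    have h1 : HasFDerivAt Φ (fderiv ℝ Φ (t, x)) (t + 0 * a, x + 0 * b) := by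
      rw [h0]
      exact (hΦ.differentiableAt (by simp)).hasFDerivAt
    have h2 := h1.comp_hasDerivAt (0 : ℝ) hline
    have h3 := (comp hT a b).1.self_of_nhds.prodMk (comp hX a b).1.self_of_nhds
    rw [hγ0, hγ'0] at h3
    exact h2.unique h3
  have hdet : (fderiv ℝ Φ (t, x)).det ≠ 0 := by
    refine det_ne_zero_of_forall ?_
    -- The hypotheses on (a₁, a₂) and (b₁, b₂) say that dΦ sends them to the standard basis.
    have hsurj : Function.Surjective (fderiv ℝ Φ (t, x) : ℝ × ℝ →ₗ[ℝ] ℝ × ℝ) := by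
      rintro ⟨y, z⟩
      refine ⟨y • (a₁, a₂) + z • (b₁, b₂), ?_⟩
      rw [map_add, map_smul, map_smul]
      change y • (fderiv ℝ Φ (t, x) (a₁, a₂)) + z • (fderiv ℝ Φ (t, x) (b₁, b₂)) = _
      rw [hL, hL, hTa, hXa, hTb, hXb]
      simp
    exact LinearMap.ker_eq_bot'.1 (LinearMap.ker_eq_bot.2
      (LinearMap.injective_iff_surjective.2 hsurj))
  set L := (fderiv ℝ Φ (t, x)).toContinuousLinearEquivOfDetNeZero hdet with hLdef
  have hΦ' : HasFDerivAt Φ (L : ℝ × ℝ →L[ℝ] ℝ × ℝ) (t, x) := by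
    rw [hLdef, ContinuousLinearMap.coe_toContinuousLinearEquivOfDetNeZero]
    exact (hΦ.differentiableAt (by simp)).hasFDerivAt
  have hn : (∞ : ℕ∞ω) ≠ 0 := by simp
  let Ψ := hΦ.localInverse hΦ' hn
  have hΨ : ContDiffAt ℝ ∞ Ψ (Φ (t, x)) := hΦ.to_localInverse hΦ' hn
  have hΨ0 : Ψ (Φ (t, x)) = (t, x) := (hΦ.hasStrictFDerivAt' hΦ' hn).localInverse_apply_image
  have hΨl : ∀ᶠ z in 𝓝 (t, x), Ψ (Φ z) = z :=
    (hΦ.hasStrictFDerivAt' hΦ' hn).eventually_left_inverse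
  -- The function whose graph is, locally, the image of the graph of `g`.
  let W : ℝ × ℝ → ℝ := fun y => m.U (j (Ψ y))
  have hW : ContDiffAt ℝ ∞ W (Φ (t, x)) := by
    have h1 : ContDiffAt ℝ ∞ (fun z => m.U (j z)) (Ψ (Φ (t, x))) := by
      rw [hΨ0]
      exact (hj0 ▸ hU : ContDiffAt ℝ ∞ m.U (j (t, x))).comp _ hj.contDiffAt
    exact h1.comp _ hΨ
  have hWΦ : ∀ᶠ z in 𝓝 (t, x), W (Φ z) = m.U (j z) := by
    filter_upwards [hΨl] with z hz
    simp only [W, hz]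
  have hΦ0 : Φ (t, x) = (m.T P, m.X P) := by simp only [Φ, hj0]
  have key := hm.mapsEquation g (fun y z => W (y, z)) t x hP.1 hP.2.1 (hg0 ▸ hP.2.2)
    hgc.contDiffAt hW hdet hWΦ
  rw [hg0] at key
  change _ ↔ m.tgt.SatisfiedAt _ (m.T P) (m.X P) at key
  have hWP : W (m.T P, m.X P) = m.U P := by
    rw [← hΦ0, hWΦ.self_of_nhds, hj0]
  rw [hΦ0] at hW
  have hW2 := hW.of_le two_le_infty
  rw [hm.src_inClass.satisfiedAt_iff (hg0 ▸ hP.2.2)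
      ((hgc.contDiffAt.comp x (f := fun y => (t, y)) (by fun_prop)).of_le two_le_infty),
    hm.tgt_inClass.satisfiedAt_iff (hWP.symm ▸ hm.U_mem hP)
      (hW2.comp (m.X P) (f := fun y => (m.T P, y)) (by fun_prop)), hWP, hg0,
      (jetFun_derivs t x u p q r s v).1, (jetFun_derivs t x u p q r s v).2.1,
      (jetFun_derivs t x u p q r s v).2.2] at key
  have hres := key.1 hsat
  -- derivatives of `W` along curves
  have hcurve : ∀ a b,
      fderiv ℝ W (m.T P, m.X P) (fderiv ℝ m.T P (tlift p q a b), fderiv ℝ m.X P (tlift p q a b))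
        = fderiv ℝ m.U P (tlift p q a b) ∧
      fderiv ℝ (fderiv ℝ W) (m.T P, m.X P)
          (fderiv ℝ m.T P (tlift p q a b), fderiv ℝ m.X P (tlift p q a b))
          (fderiv ℝ m.T P (tlift p q a b), fderiv ℝ m.X P (tlift p q a b))
        + fderiv ℝ W (m.T P, m.X P)
          (fderiv ℝ (fderiv ℝ m.T) P (tlift p q a b) (tlift p q a b)
            + ρ a b * fderiv ℝ m.T P (0, 0, 1),
          fderiv ℝ (fderiv ℝ m.X) P (tlift p q a b) (tlift p q a b)
            + ρ a b * fderiv ℝ m.X P (0, 0, 1))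
        = fderiv ℝ (fderiv ℝ m.U) P (tlift p q a b) (tlift p q a b)
            + ρ a b * fderiv ℝ m.U P (0, 0, 1) := by
    intro a b
    have cT := comp hT a b
    have cX := comp hX a b
    have cU := comp hU a b
    have hd := deriv_comp_curve (G := W) (γ := fun y => (m.T (γ a b y), m.X (γ a b y)))
      (γ' := fun y => (fderiv ℝ m.T (γ a b y) (γ' a b y), fderiv ℝ m.X (γ a b y) (γ' a b y)))
      (s := 0) (by simp only [hγ0]; exact hW2)
      (by filter_upwards [cT.1, cX.1] with y h1 h2 using h1.prodMk h2) (cT.2.prodMk cX.2)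
    have hcont : Tendsto (fun y : ℝ => ((t + y * a, x + y * b) : ℝ × ℝ)) (𝓝 0) (𝓝 (t, x)) :=
      Continuous.tendsto' (by fun_prop) _ _ (by simp)
    have heq : (fun y => W (m.T (γ a b y), m.X (γ a b y))) =ᶠ[𝓝 0] fun y => m.U (γ a b y) :=
      hcont.eventually hWΦ
    have hdU : deriv (fun y => m.U (γ a b y)) =ᶠ[𝓝 0]
        fun y => fderiv ℝ m.U (γ a b y) (γ' a b y) := cU.1.mono fun y hy => hy.deriv
    rw [heq.deriv_eq, heq.deriv.deriv_eq, hdU.eq_of_nhds, hdU.deriv_eq, cU.2.deriv] at hd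
    simp only [hγ0, hγ'0] at hd
    exact ⟨hd.1.symm, hd.2.symm⟩
  obtain ⟨ha1, ha2⟩ := hcurve a₁ a₂
  obtain ⟨hb1, hb2⟩ := hcurve b₁ b₂
  rw [hTa, hXa, hwT] at ha1
  rw [hTb, hXb, hwX] at hb1
  rw [hTa, hXa] at ha2
  rw [hTb, hXb] at hb2
  -- The first-order relations identify `wT`, `wX` as the partial derivatives of `W`; the
  -- second-order ones can then be solved for its pure second derivatives.
  have hdW : ∀ y z : ℝ, fderiv ℝ W (m.T P, m.X P) (y, z) = y * wT + z * wX := by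
    intro y z
    rw [show ((y, z) : ℝ × ℝ) = y • (1, 0) + z • (0, 1) by simp, map_add, map_smul, map_smul,
      ha1, hb1, smul_eq_mul, smul_eq_mul]
  have hWt := deriv_comp_curve (G := W) (γ := fun y => (y, m.X P)) (γ' := fun _ => (1, 0))
    (γ'' := 0) (s := m.T P) hW2
    (Eventually.of_forall fun y => (hasDerivAt_id y).prodMk (hasDerivAt_const _ _))
    (hasDerivAt_const _ _)
  have hWx := deriv_comp_curve (G := W) (γ := fun y => (m.T P, y)) (γ' := fun _ => (0, 1))
    (γ'' := 0) (s := m.X P) hW2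
    (Eventually.of_forall fun y => (hasDerivAt_const _ _).prodMk (hasDerivAt_id y))
    (hasDerivAt_const _ _)
  rw [hWt.2, hWx.2, hWx.1, hb1, map_zero, add_zero, add_zero] at hres
  rw [hdW] at ha2 hb2
  have eA : fderiv ℝ (fderiv ℝ W) (m.T P, m.X P) (1, 0) (1, 0)
      = secondAlong m.T m.X m.U P wT wX p q r s v a₁ a₂ := by
    simp only [secondAlong]
    linarith
  have eB : fderiv ℝ (fderiv ℝ W) (m.T P, m.X P) (0, 1) (0, 1)
      = secondAlong m.T m.X m.U P wT wX p q r s v b₁ b₂ := by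
    simp only [secondAlong]
    linarith
  rw [eA, eB] at hres
  exact hres

end IsAdmissible

end Transf

end TelegraphG1

namespace TelegraphG1

/-! ### The new variables `t̃` and `x̃` do not depend on `u` -/

/-- The identity is polynomial in (p, q), so it extends from the set where the minor is nonzero to
the whole plane. Its coefficients at p, q and pq then make the rows (Tt, Tx, Tu) and (Xt, Xx, Xu)
proportional if Xu ≠ 0, against the rank condition; and Xu = 0 gives Tu = 0. -/
lemma eq_zero_of_forall_minor {Tt Tx Tu Xt Xx Xu f H : ℝ} (hf : f ≠ 0) (hH : H ≠ 0)
    (hrank : ¬(Tt * Xx - Tx * Xt = 0 ∧ Tu * Xx - Tx * Xu = 0 ∧ Tt * Xu - Tu * Xt = 0))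
    (h : ∀ p q : ℝ, (Tt + p * Tu) * (Xx + q * Xu) - (Tx + q * Tu) * (Xt + p * Xu) ≠ 0 →
      f * ((Xt + p * Xu) * (Xx + q * Xu)) = H * ((Tt + p * Tu) * (Tx + q * Tu))) :
    Tu = 0 ∧ Xu = 0 := by
  have hall : ∀ p q : ℝ,
      f * ((Xt + p * Xu) * (Xx + q * Xu)) = H * ((Tt + p * Tu) * (Tx + q * Tu)) := by
    intro p q
    -- The minor is affine in (p, q), its coefficients being the three minors of `hrank` up to sign;
    -- three non-collinear zeros would annihilate them all.
    obtain ⟨p', q', h'⟩ : ∃ p' q' : ℝ,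
        (Tt + p' * Tu) * (Xx + q' * Xu) - (Tx + q' * Tu) * (Xt + p' * Xu) ≠ 0 := by
      by_contra! hne
      have h0 := hne 0 0
      have h1 := hne 1 0
      have h2 := hne 0 1
      exact hrank ⟨by linarith, by linarith, by linarith⟩
    by_cases hd : (Tt + p * Tu) * (Xx + q * Xu) - (Tx + q * Tu) * (Xt + p * Xu) = 0
    · have key : ∀ l : ℝ, l ≠ 0 →
          f * ((Xt + (p + l * (p' - p)) * Xu) * (Xx + (q + l * (q' - q)) * Xu))
            = H * ((Tt + (p + l * (p' - p)) * Tu) * (Tx + (q + l * (q' - q)) * Tu)) := by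
        intro l hl
        refine h _ _ fun he => h' ?_
        refine (mul_eq_zero.1 (?_ : l * _ = 0)).resolve_left hl
        linear_combination he + (l - 1) * hd
      have k1 := key 1 (by norm_num)
      have k2 := key (-1) (by norm_num)
      have k3 := key 2 (by norm_num)
      -- On the line through (p, q) and (p', q') the identity is quadratic in `l`; these are the
      -- Lagrange weights for the value at 0 from the nodes 1, -1, 2.
      linear_combination k1 + k2 / 3 - k3 / 3
    · exact h p q hd
  have c0 := hall 0 0
  have c1 := hall 1 0
  have c2 := hall 0 1
  have c3 := hall 1 1
  have e1 : f * (Xu * Xx) = H * (Tu * Tx) := by linarith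
  have e2 : f * (Xt * Xu) = H * (Tt * Tu) := by linarith
  have e3 : f * (Xu * Xu) = H * (Tu * Tu) := by linarith
  have hXu : Xu = 0 := by
    by_contra hne
    have hfX : f * Xu ≠ 0 := mul_ne_zero hf hne
    refine hrank ⟨?_, ?_, ?_⟩
    · refine (mul_eq_zero.1 (?_ : f * Xu * Xu * _ = 0)).resolve_left (mul_ne_zero hfX hne)
      linear_combination Tt * Xu * e1 - Tx * Xu * e2
    · refine (mul_eq_zero.1 (?_ : f * Xu * _ = 0)).resolve_left hfX
      linear_combination Tu * e1 - Tx * e3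
    · refine (mul_eq_zero.1 (?_ : f * Xu * _ = 0)).resolve_left hfX
      linear_combination Tt * e3 - Tu * e2
  refine ⟨?_, hXu⟩
  rw [hXu] at e3
  have : H * (Tu * Tu) = 0 := by linarith
  simpa [hH] using this

/-- For nonzero coefficients the hypotheses say that f'dx̃² - H'dt̃² pulls back to a multiple of f
dx² - H dt². The dual forms are then proportional too, and the conclusion is the orthogonality of
dt̃ and dx̃ with respect to f∂_t² - H∂_x². -/
lemma dual_conformal {a b c d f H f' H' : ℝ} (hH' : H' ≠ 0) (hD : a * d - b * c ≠ 0)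
    (h1 : f' * (c * d) = H' * (a * b))
    (h2 : H * (f' * d ^ 2 - H' * b ^ 2) + f * (f' * c ^ 2 - H' * a ^ 2) = 0) :
    f * (a * c) = H * (b * d) := by
  by_cases ha : a = 0
  · subst ha
    have hbc : b ≠ 0 ∧ c ≠ 0 := by
      constructor <;> rintro rfl <;> simp at hD
    by_cases hf' : f' = 0
    · have hHb : H = 0 := by
        have : H * (H' * b ^ 2) = 0 := by
          rw [hf'] at h2
          linarith
        simpa [hH', hbc.1] using this
      rw [hHb]
      ring
    · have hd : d = 0 := by
        have : f' * (c * d) = 0 := by linarith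
        simpa [hf', hbc.2] using this
      rw [hd]
      ring
  · have hne : H' * a ^ 2 - f' * c ^ 2 ≠ 0 := by
      intro he
      have h3 : H' * a * c * (a * d - b * c) = 0 := by
        linear_combination c * d * he + c ^ 2 * h1
      have hc : c = 0 := by simpa [hH', ha, hD] using h3
      rw [hc] at he
      have : H' * a ^ 2 = 0 := by linarith
      simp [hH', ha] at this
    have h4 : H * f' * d ^ 2 = f * H' * a ^ 2 := by
      have : (H' * a ^ 2 - f' * c ^ 2) * (H * f' * d ^ 2 - f * H' * a ^ 2) = 0 := by
        linear_combination H' * a ^ 2 * h2 - H * (f' * c * d + H' * a * b) * h1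
      have := (mul_eq_zero.1 this).resolve_left hne
      linarith
    have h5 : H' * a * (f * (a * c) - H * (b * d)) = 0 := by
      linear_combination (-c) * h4 + H * d * h1
    have := (mul_eq_zero.1 h5).resolve_left (mul_ne_zero hH' ha)
    linarith

lemma tlift_eq (p q a b : ℝ) :
    tlift p q a b = a • ((1, 0, 0) : ℝ × ℝ × ℝ) + b • ((0, 1, 0) : ℝ × ℝ × ℝ)
      + (p * a + q * b) • ((0, 0, 1) : ℝ × ℝ × ℝ) := by
  simp [tlift]

lemma map_tlift (l : ℝ × ℝ × ℝ →L[ℝ] ℝ) (p q a b : ℝ) :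
    l (tlift p q a b) = a * l (1, 0, 0) + b * l (0, 1, 0) + (p * a + q * b) * l (0, 0, 1) := by
  simp only [tlift_eq, map_add, map_smul, smul_eq_mul]

lemma map_triple (l : ℝ × ℝ × ℝ →L[ℝ] ℝ) (a b c : ℝ) :
    l (a, b, c) = a * l (1, 0, 0) + b * l (0, 1, 0) + c * l (0, 0, 1) := by
  rw [show ((a, b, c) : ℝ × ℝ × ℝ) = a • ((1, 0, 0) : ℝ × ℝ × ℝ) + b • ((0, 1, 0) : ℝ × ℝ × ℝ)
    + c • ((0, 0, 1) : ℝ × ℝ × ℝ) by simp]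
  simp only [map_add, map_smul, smul_eq_mul]

namespace Transf.IsAdmissible

variable {m : Transf}

lemma fderiv_φ (hm : m.IsAdmissible) {P : ℝ × ℝ × ℝ} (hP : P ∈ m.dom) (v : ℝ × ℝ × ℝ) :
    fderiv ℝ m.φ P v = (fderiv ℝ m.T P v, fderiv ℝ m.X P v, fderiv ℝ m.U P v) := by
  have h : HasFDerivAt m.φ ((fderiv ℝ m.T P).prod ((fderiv ℝ m.X P).prod (fderiv ℝ m.U P))) P :=
    ((hm.contDiffAt_T hP).differentiableAt (by simp)).hasFDerivAt.prodMk
      (((hm.contDiffAt_X hP).differentiableAt (by simp)).hasFDerivAt.prodMk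
        ((hm.contDiffAt_U hP).differentiableAt (by simp)).hasFDerivAt)
  rw [h.fderiv]
  rfl

lemma eq_zero_of_fderiv (hm : m.IsAdmissible) {P : ℝ × ℝ × ℝ} (hP : P ∈ m.dom) {v : ℝ × ℝ × ℝ}
    (hT : fderiv ℝ m.T P v = 0) (hX : fderiv ℝ m.X P v = 0) (hU : fderiv ℝ m.U P v = 0) :
    v = 0 := by
  refine eq_zero_of_det_ne_zero (hm.isPointTransf.jacobian P hP) ?_
  rw [hm.fderiv_φ hP, hT, hX, hU]
  rfl

lemma exists_fderiv_eq (hm : m.IsAdmissible) {P : ℝ × ℝ × ℝ} (hP : P ∈ m.dom) (a b c : ℝ) :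
    ∃ v, fderiv ℝ m.T P v = a ∧ fderiv ℝ m.X P v = b ∧ fderiv ℝ m.U P v = c := by
  have hinj : Function.Injective (fderiv ℝ m.φ P : ℝ × ℝ × ℝ →ₗ[ℝ] ℝ × ℝ × ℝ) :=
    LinearMap.ker_eq_bot.1 (LinearMap.ker_eq_bot'.2 fun v hv =>
      eq_zero_of_det_ne_zero (hm.isPointTransf.jacobian P hP) hv)
  obtain ⟨v, hv⟩ := LinearMap.injective_iff_surjective.1 hinj (a, b, c)
  change fderiv ℝ m.φ P v = _ at hv
  rw [hm.fderiv_φ hP, Prod.mk.injEq, Prod.mk.injEq] at hv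
  exact ⟨v, hv⟩

/-- Since φ has nonzero Jacobian, dt̃ and dx̃ are independent. Explicitly, on vectors mapped to the
basis the Cauchy–Binet formula writes 1 as a combination of the three minors. -/
lemma minors (hm : m.IsAdmissible) {P : ℝ × ℝ × ℝ} (hP : P ∈ m.dom) :
    ¬(fderiv ℝ m.T P (1, 0, 0) * fderiv ℝ m.X P (0, 1, 0)
        - fderiv ℝ m.T P (0, 1, 0) * fderiv ℝ m.X P (1, 0, 0) = 0 ∧
      fderiv ℝ m.T P (0, 0, 1) * fderiv ℝ m.X P (0, 1, 0)
        - fderiv ℝ m.T P (0, 1, 0) * fderiv ℝ m.X P (0, 0, 1) = 0 ∧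
      fderiv ℝ m.T P (1, 0, 0) * fderiv ℝ m.X P (0, 0, 1)
        - fderiv ℝ m.T P (0, 0, 1) * fderiv ℝ m.X P (1, 0, 0) = 0) := by
  rintro ⟨h1, h2, h3⟩
  obtain ⟨⟨a, b, c⟩, hT, hX, -⟩ := hm.exists_fderiv_eq hP 1 0 0
  obtain ⟨⟨a', b', c'⟩, hT', hX', -⟩ := hm.exists_fderiv_eq hP 0 1 0
  rw [map_triple] at hT hX hT' hX'
  have : (1 : ℝ) = 0 := by
    linear_combination (a * b' - a' * b) * h1 + (b' * c - b * c') * h2 + (a * c' - a' * c) * h3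
      - (a' * fderiv ℝ m.X P (1, 0, 0) + b' * fderiv ℝ m.X P (0, 1, 0)
        + c' * fderiv ℝ m.X P (0, 0, 1)) * hT - hX'
      + (a * fderiv ℝ m.X P (1, 0, 0) + b * fderiv ℝ m.X P (0, 1, 0)
        + c * fderiv ℝ m.X P (0, 0, 1)) * hT'
  norm_num at this

lemma tgt_f_ne_zero (hm : m.IsAdmissible) {P : ℝ × ℝ × ℝ} (hP : P ∈ m.dom) :
    m.tgt.f (m.X P) ≠ 0 :=
  hm.tgt_inClass.f_ne_zero _ (hm.X_mem hP)

lemma tgt_H_ne_zero (hm : m.IsAdmissible) {P : ℝ × ℝ × ℝ} (hP : P ∈ m.dom) :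
    m.tgt.H (m.U P) ≠ 0 :=
  hm.tgt_inClass.H_ne_zero _ (hm.U_mem hP)

/-- The principal parts of the equations correspond to each other. -/
lemma principal (hm : m.IsAdmissible) {t x u : ℝ} (hP : (t, x, u) ∈ m.dom) {p q T₁ T₂ X₁ X₂ : ℝ}
    (hT₁ : fderiv ℝ m.T (t, x, u) (tlift p q 1 0) = T₁)
    (hT₂ : fderiv ℝ m.T (t, x, u) (tlift p q 0 1) = T₂)
    (hX₁ : fderiv ℝ m.X (t, x, u) (tlift p q 1 0) = X₁)
    (hX₂ : fderiv ℝ m.X (t, x, u) (tlift p q 0 1) = X₂)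
    (hD : T₁ * X₂ - T₂ * X₁ ≠ 0) :
    m.tgt.f (m.X (t, x, u)) * (X₁ * X₂) = m.tgt.H (m.U (t, x, u)) * (T₁ * T₂) ∧
    m.src.H u * (m.tgt.f (m.X (t, x, u)) * X₂ ^ 2 - m.tgt.H (m.U (t, x, u)) * T₂ ^ 2)
      + m.src.f x * (m.tgt.f (m.X (t, x, u)) * X₁ ^ 2 - m.tgt.H (m.U (t, x, u)) * T₁ ^ 2) = 0 := by
  set P : ℝ × ℝ × ℝ := (t, x, u) with hPdef
  set D := T₁ * X₂ - T₂ * X₁ with hDdef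
  have hf := hm.src_inClass.f_ne_zero x hP.2.1
  have lin : ∀ a b, tlift p q a b = a • tlift p q 1 0 + b • tlift p q 0 1 := by
    intro a b
    simp [tlift]
    ring
  have hTl : ∀ a b, fderiv ℝ m.T P (tlift p q a b) = a * T₁ + b * T₂ := by
    intro a b
    rw [lin, map_add, map_smul, map_smul, hT₁, hT₂, smul_eq_mul, smul_eq_mul]
  have hXl : ∀ a b, fderiv ℝ m.X P (tlift p q a b) = a * X₁ + b * X₂ := by
    intro a b
    rw [lin, map_add, map_smul, map_smul, hX₁, hX₂, smul_eq_mul, smul_eq_mul]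
  -- The vectors (a₁, a₂) and (b₁, b₂) are the columns of the inverse of the matrix with rows (T₁,
  -- T₂) and (X₁, X₂).
  obtain ⟨a₁, ha₁⟩ : ∃ a, a = X₂ / D := ⟨_, rfl⟩
  obtain ⟨a₂, ha₂⟩ : ∃ a, a = -X₁ / D := ⟨_, rfl⟩
  obtain ⟨b₁, hb₁⟩ : ∃ a, a = -T₂ / D := ⟨_, rfl⟩
  obtain ⟨b₂, hb₂⟩ : ∃ a, a = T₁ / D := ⟨_, rfl⟩
  have hTa : fderiv ℝ m.T P (tlift p q a₁ a₂) = 1 := by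
    rw [hTl, ha₁, ha₂]
    field_simp
    rw [hDdef]
    ring
  have hXa : fderiv ℝ m.X P (tlift p q a₁ a₂) = 0 := by
    rw [hXl, ha₁, ha₂]
    ring
  have hTb : fderiv ℝ m.T P (tlift p q b₁ b₂) = 0 := by
    rw [hTl, hb₁, hb₂]
    ring
  have hXb : fderiv ℝ m.X P (tlift p q b₁ b₂) = 1 := by
    rw [hXl, hb₁, hb₂]
    field_simp
    rw [hDdef]
    ring
  have jet := fun r s v => hm.jet_identity (r := r) (s := s) (v := v) hP hTa hXa hTb hXb rfl rfl
  set wT := fderiv ℝ m.U P (tlift p q a₁ a₂) with hwT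
  set wX := fderiv ℝ m.U P (tlift p q b₁ b₂) with hwX
  obtain ⟨σ, hσ⟩ : ∃ σ, σ = fderiv ℝ m.U P (0, 0, 1) - wT * fderiv ℝ m.T P (0, 0, 1)
    - wX * fderiv ℝ m.X P (0, 0, 1) := ⟨_, rfl⟩
  -- σ multiplies all second derivatives of u. If it vanished, the component of ∂_u transversal to
  -- the tangent plane of the graph would be annihilated by dφ.
  have hσ0 : σ ≠ 0 := by
    intro h0
    set α := fderiv ℝ m.T P (0, 0, 1) with hα
    set β := fderiv ℝ m.X P (0, 0, 1) with hβ
    have hz : ((0, 0, 1) : ℝ × ℝ × ℝ) - α • tlift p q a₁ a₂ - β • tlift p q b₁ b₂ = 0 := by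
      refine hm.eq_zero_of_fderiv hP ?_ ?_ ?_
      · rw [map_sub, map_sub, map_smul, map_smul, hTa, hTb, ← hα]
        simp
      · rw [map_sub, map_sub, map_smul, map_smul, hXa, hXb, ← hβ]
        simp
      · rw [map_sub, map_sub, map_smul, map_smul, ← hwT, ← hwX, smul_eq_mul, smul_eq_mul]
        linear_combination h0 - hσ
    simp only [tlift, Prod.smul_mk, smul_eq_mul, Prod.mk_sub_mk, Prod.mk_eq_zero] at hz
    obtain ⟨h1, h2, h3⟩ := hz
    have : (1 : ℝ) = 0 := by linear_combination h3 - p * h1 - q * h2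
    norm_num at this
  simp only [secondAlong, ← hPdef, ← hσ] at jet
  -- Three jets on the equation with the same first derivatives: changing `s` alone isolates the
  -- mixed coefficient, changing `v` with the matching change of `r` isolates the rest of the
  -- principal part.
  have j0 := jet ((deriv m.src.H u * q ^ 2 + m.src.h x * m.src.K u * q) / m.src.f x) 0 0
    (by field_simp; ring)
  have j1 := jet ((deriv m.src.H u * q ^ 2 + m.src.h x * m.src.K u * q) / m.src.f x) 1 0
    (by field_simp; ring)
  have j2 := jet ((m.src.H u + deriv m.src.H u * q ^ 2 + m.src.h x * m.src.K u * q)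
    / m.src.f x) 0 1 (by field_simp)
  generalize m.tgt.f (m.X P) = F at *
  generalize m.tgt.H (m.U P) = G at *
  constructor
  · have e : σ * (F * (a₁ * a₂) - G * (b₁ * b₂)) = 0 := by linear_combination (j1 - j0) / 2
    have e' := (mul_eq_zero.1 e).resolve_left hσ0
    rw [ha₁, ha₂, hb₁, hb₂] at e'
    field_simp at e'
    linarith
  · have e : σ * (F * (m.src.H u / m.src.f x * a₁ ^ 2 + a₂ ^ 2)
        - G * (m.src.H u / m.src.f x * b₁ ^ 2 + b₂ ^ 2)) = 0 := by
      linear_combination j2 - j0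
    have e' := (mul_eq_zero.1 e).resolve_left hσ0
    rw [ha₁, ha₂, hb₁, hb₂] at e'
    field_simp at e'
    linarith

/-- `t̃` and `x̃` do not depend on `u`. -/
lemma fderiv_u_eq_zero (hm : m.IsAdmissible) {P : ℝ × ℝ × ℝ} (hP : P ∈ m.dom) :
    fderiv ℝ m.T P (0, 0, 1) = 0 ∧ fderiv ℝ m.X P (0, 0, 1) = 0 := by
  obtain ⟨t, x, u⟩ := P
  refine eq_zero_of_forall_minor (hm.tgt_f_ne_zero hP) (hm.tgt_H_ne_zero hP) (hm.minors hP) ?_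
  intro p q hD
  refine (hm.principal (p := p) (q := q) hP ?_ ?_ ?_ ?_ hD).1 <;> rw [map_tlift] <;> ring

lemma minor_ne_zero (hm : m.IsAdmissible) {P : ℝ × ℝ × ℝ} (hP : P ∈ m.dom) :
    fderiv ℝ m.T P (1, 0, 0) * fderiv ℝ m.X P (0, 1, 0)
        - fderiv ℝ m.T P (0, 1, 0) * fderiv ℝ m.X P (1, 0, 0) ≠ 0 := by
  intro h
  refine hm.minors hP ⟨h, ?_, ?_⟩ <;>
  · rw [(hm.fderiv_u_eq_zero hP).1, (hm.fderiv_u_eq_zero hP).2]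
    ring

lemma fderiv_U_ne_zero (hm : m.IsAdmissible) {P : ℝ × ℝ × ℝ} (hP : P ∈ m.dom) :
    fderiv ℝ m.U P (0, 0, 1) ≠ 0 := by
  intro h
  have := hm.eq_zero_of_fderiv hP (hm.fderiv_u_eq_zero hP).1 (hm.fderiv_u_eq_zero hP).2 h
  simp at this

/-- The dual form of the second relation is the useful one: it contains H(u) instead of the unknown
H̃(ũ), so its only dependence on u is explicit. -/
lemma principal_zero (hm : m.IsAdmissible) {t x u : ℝ} (hP : (t, x, u) ∈ m.dom) :
    m.src.H u * (m.tgt.f (m.X (t, x, u)) * fderiv ℝ m.X (t, x, u) (0, 1, 0) ^ 2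
        - m.tgt.H (m.U (t, x, u)) * fderiv ℝ m.T (t, x, u) (0, 1, 0) ^ 2)
      + m.src.f x * (m.tgt.f (m.X (t, x, u)) * fderiv ℝ m.X (t, x, u) (1, 0, 0) ^ 2
        - m.tgt.H (m.U (t, x, u)) * fderiv ℝ m.T (t, x, u) (1, 0, 0) ^ 2) = 0 ∧
    m.src.f x * (fderiv ℝ m.T (t, x, u) (1, 0, 0) * fderiv ℝ m.X (t, x, u) (1, 0, 0))
      = m.src.H u * (fderiv ℝ m.T (t, x, u) (0, 1, 0) * fderiv ℝ m.X (t, x, u) (0, 1, 0)) := by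
  have h := hm.principal (p := 0) (q := 0) hP (by simp [tlift]) (by simp [tlift])
    (by simp [tlift]) (by simp [tlift]) (hm.minor_ne_zero hP)
  exact ⟨h.2, dual_conformal (hm.tgt_H_ne_zero hP) (hm.minor_ne_zero hP) h.1 h.2⟩

end Transf.IsAdmissible

/-! ### Slices -/

section Slices

variable {F : Type*} [NormedAddCommGroup F] [NormedSpace ℝ F] {G : ℝ × ℝ × ℝ → F} {t x u : ℝ}

lemma hasDerivAt_slice (hG : DifferentiableAt ℝ G (t, x, u)) (a b c : ℝ) :
    HasDerivAt (fun y => G (t + y * a, x + y * b, u + y * c)) (fderiv ℝ G (t, x, u) (a, b, c)) 0 := by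
  have h1 : HasDerivAt (fun y : ℝ => (t + y * a, x + y * b, u + y * c)) (a, b, c) 0 :=
    HasDerivAt.prodMk (by simpa using ((hasDerivAt_id (0 : ℝ)).mul_const a).const_add t)
      (HasDerivAt.prodMk (by simpa using ((hasDerivAt_id (0 : ℝ)).mul_const b).const_add x)
        (by simpa using ((hasDerivAt_id (0 : ℝ)).mul_const c).const_add u))
  have h2 : HasFDerivAt G (fderiv ℝ G (t, x, u)) (t + 0 * a, x + 0 * b, u + 0 * c) := by
    simpa using hG.hasFDerivAt
  exact h2.comp_hasDerivAt (0 : ℝ) h1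

lemma hasDerivAt_slice_t (hG : DifferentiableAt ℝ G (t, x, u)) :
    HasDerivAt (fun y => G (y, x, u)) (fderiv ℝ G (t, x, u) (1, 0, 0)) t :=
  hG.hasFDerivAt.comp_hasDerivAt t
    ((hasDerivAt_id t).prodMk ((hasDerivAt_const t x).prodMk (hasDerivAt_const t u)))

lemma hasDerivAt_slice_x (hG : DifferentiableAt ℝ G (t, x, u)) :
    HasDerivAt (fun y => G (t, y, u)) (fderiv ℝ G (t, x, u) (0, 1, 0)) x :=
  hG.hasFDerivAt.comp_hasDerivAt x
    ((hasDerivAt_const x t).prodMk ((hasDerivAt_id x).prodMk (hasDerivAt_const x u)))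

lemma hasDerivAt_slice_u (hG : DifferentiableAt ℝ G (t, x, u)) :
    HasDerivAt (fun y => G (t, x, y)) (fderiv ℝ G (t, x, u) (0, 0, 1)) u :=
  hG.hasFDerivAt.comp_hasDerivAt u
    ((hasDerivAt_const u t).prodMk ((hasDerivAt_const u x).prodMk (hasDerivAt_id u)))

end Slices

/-- If the derivative of `G` in the direction `w` vanishes on an open set, then so do the second
derivatives involving `w`. -/
lemma fderiv_fderiv_eq_zero {G : ℝ × ℝ × ℝ → ℝ} {s : Set (ℝ × ℝ × ℝ)} (hs : IsOpen s)
    {w P : ℝ × ℝ × ℝ} (hG : ContDiffAt ℝ 2 G P) (hw : ∀ p ∈ s, fderiv ℝ G p w = 0) (hP : P ∈ s)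
    (v : ℝ × ℝ × ℝ) :
    fderiv ℝ (fderiv ℝ G) P v w = 0 ∧ fderiv ℝ (fderiv ℝ G) P w v = 0 := by
  have h1 : ContDiffAt ℝ 1 (fderiv ℝ G) P := hG.fderiv_right (by norm_num)
  have h2 := (h1.differentiableAt (by simp)).hasFDerivAt.clm_apply (hasFDerivAt_const w P)
  have h3 : HasFDerivAt (fun p => fderiv ℝ G p w) (0 : ℝ × ℝ × ℝ →L[ℝ] ℝ) P := by
    refine (hasFDerivAt_const (0 : ℝ) P).congr_of_eventuallyEq ?_
    filter_upwards [hs.mem_nhds hP] with p hp using hw p hp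
  have h4 : fderiv ℝ (fderiv ℝ G) P v w = 0 := by
    have := congrArg (fun L : ℝ × ℝ × ℝ →L[ℝ] ℝ => L v) (h2.unique h3)
    simpa using this
  exact ⟨h4, (hG.isSymmSndFDerivAt (by simp)).eq w v ▸ h4⟩

end TelegraphG1

namespace TelegraphG1

/-! ### Admissible transformations of generic equations -/

/-- A tuple for which the admissible transformations are exactly those of the family. -/
def ArbElts.IsGeneric (θ : ArbElts) : Prop :=
  (∃ x ∈ θ.xdom, θ.h x ≠ 0) ∧ ∃ (V : Set ℝ) (s : ℝ), IsOpenInterval V ∧ V ⊆ θ.udom ∧ s ≠ 0 ∧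
    ∀ u ∈ V, θ.H u = s * Real.exp (u ^ 2) ∧ θ.K u = u * θ.H u

lemma IsOpenInterval.exists_three {V : Set ℝ} (hV : IsOpenInterval V) :
    ∃ u₁ ∈ V, ∃ u₂ ∈ V, ∃ u₃ ∈ V, u₁ < u₂ ∧ u₂ < u₃ := by
  obtain ⟨u₁, h1⟩ := hV.2.1
  obtain ⟨u₂, h2, h12⟩ := hV.exists_gt_mem h1
  obtain ⟨u₃, h3, h23⟩ := hV.exists_gt_mem h2
  exact ⟨u₁, h1, u₂, h2, u₃, h3, h12, h23⟩

lemma hasDerivAt_exp_sq {θ : ArbElts} {V : Set ℝ} {s : ℝ} (hV : IsOpenInterval V)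
    (hH : ∀ u ∈ V, θ.H u = s * Real.exp (u ^ 2)) {u : ℝ} (hu : u ∈ V) :
    deriv θ.H u = 2 * u * θ.H u := by
  have h : HasDerivAt (fun u => s * Real.exp (u ^ 2)) (2 * u * θ.H u) u := by
    refine (((hasDerivAt_id u).fun_pow 2).exp.const_mul s).congr_deriv ?_
    rw [hH u hu]
    simp
    ring
  refine (h.congr_of_eventuallyEq ?_).deriv
  filter_upwards [hV.mem_nhds hu] with v hv using hH v hv

/-! ### Second derivatives along lifted directions -/

section SecondDeriv

variable {G : ℝ × ℝ × ℝ → ℝ} {P : ℝ × ℝ × ℝ}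

lemma hasFDerivAt_fderiv_apply (hG : ContDiffAt ℝ 2 G P) (w : ℝ × ℝ × ℝ) :
    HasFDerivAt (fun p => fderiv ℝ G p w) ((fderiv ℝ (fderiv ℝ G) P).flip w) P := by
  have h1 : ContDiffAt ℝ 1 (fderiv ℝ G) P := hG.fderiv_right (by norm_num)
  have h2 := (h1.differentiableAt (by simp)).hasFDerivAt.clm_apply (hasFDerivAt_const w P)
  refine h2.congr_fderiv ?_
  ext <;> simp

lemma second_tlift_t (hG : ContDiffAt ℝ 2 G P) (p q a : ℝ) :
    fderiv ℝ (fderiv ℝ G) P (tlift p q a 0) (tlift p q a 0)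
      = a ^ 2 * (fderiv ℝ (fderiv ℝ G) P (1, 0, 0) (1, 0, 0)
        + 2 * p * fderiv ℝ (fderiv ℝ G) P (1, 0, 0) (0, 0, 1)
        + p ^ 2 * fderiv ℝ (fderiv ℝ G) P (0, 0, 1) (0, 0, 1)) := by
  have hs := (hG.isSymmSndFDerivAt (by simp)).eq (1, 0, 0) (0, 0, 1)
  simp only [tlift_eq, map_add, map_smul, add_apply, smul_apply, smul_eq_mul, hs]
  ring

lemma second_tlift_x (hG : ContDiffAt ℝ 2 G P) (p q b : ℝ) :
    fderiv ℝ (fderiv ℝ G) P (tlift p q 0 b) (tlift p q 0 b)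
      = b ^ 2 * (fderiv ℝ (fderiv ℝ G) P (0, 1, 0) (0, 1, 0)
        + 2 * q * fderiv ℝ (fderiv ℝ G) P (0, 1, 0) (0, 0, 1)
        + q ^ 2 * fderiv ℝ (fderiv ℝ G) P (0, 0, 1) (0, 0, 1)) := by
  have hs := (hG.isSymmSndFDerivAt (by simp)).eq (0, 1, 0) (0, 0, 1)
  simp only [tlift_eq, map_add, map_smul, add_apply, smul_apply, smul_eq_mul, hs]
  ring

end SecondDeriv

namespace Transf.IsAdmissible

variable {m : Transf}

lemma hasDerivAt_U_slice (hm : m.IsAdmissible) {t x u : ℝ} (hP : (t, x, u) ∈ m.dom) (a b : ℝ) :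
    HasDerivAt (fun y => m.U (t + y * a, x + y * b, u)) (fderiv ℝ m.U (t, x, u) (a, b, 0)) 0 := by
  simpa using hasDerivAt_slice ((hm.contDiffAt_U hP).differentiableAt (by simp)) a b 0

lemma hasDerivAt_Uu_slice (hm : m.IsAdmissible) {t x u : ℝ} (hP : (t, x, u) ∈ m.dom) (a b : ℝ) :
    HasDerivAt (fun y => fderiv ℝ m.U (t + y * a, x + y * b, u) (0, 0, 1))
      (fderiv ℝ (fderiv ℝ m.U) (t, x, u) (a, b, 0) (0, 0, 1)) 0 := by
  have h := hasFDerivAt_fderiv_apply ((hm.contDiffAt_U hP).of_le two_le_infty) (0, 0, 1)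
  have h' := hasDerivAt_slice h.differentiableAt a b 0
  rw [h.fderiv] at h'
  simpa using h'

lemma hasDerivAt_Uu_u (hm : m.IsAdmissible) {t x u : ℝ} (hP : (t, x, u) ∈ m.dom) :
    HasDerivAt (fun y => fderiv ℝ m.U (t, x, y) (0, 0, 1))
      (fderiv ℝ (fderiv ℝ m.U) (t, x, u) (0, 0, 1) (0, 0, 1)) u := by
  have h := hasFDerivAt_fderiv_apply ((hm.contDiffAt_U hP).of_le two_le_infty) (0, 0, 1)
  have h' := hasDerivAt_slice_u h.differentiableAt
  rwa [h.fderiv] at h'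

lemma eq_of_fderiv_u (hm : m.IsAdmissible) {G : ℝ × ℝ × ℝ → ℝ}
    (hG : ∀ p ∈ m.dom, DifferentiableAt ℝ G p) (h0 : ∀ p ∈ m.dom, fderiv ℝ G p (0, 0, 1) = 0)
    {t x u v : ℝ} (hu : (t, x, u) ∈ m.dom) (hv : (t, x, v) ∈ m.dom) :
    G (t, x, u) = G (t, x, v) :=
  hm.src_inClass.udom_interval.eq_of_hasDerivAt_zero (g := fun y => G (t, x, y))
    (fun s hs => by
      have hp : (t, x, s) ∈ m.dom := ⟨hu.1, hu.2.1, hs⟩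
      simpa [h0 _ hp] using hasDerivAt_slice_u (hG _ hp)) hu.2.2 hv.2.2

lemma eq_of_fderiv_x (hm : m.IsAdmissible) {G : ℝ × ℝ × ℝ → ℝ}
    (hG : ∀ p ∈ m.dom, DifferentiableAt ℝ G p) (h0 : ∀ p ∈ m.dom, fderiv ℝ G p (0, 1, 0) = 0)
    {t x y u : ℝ} (hx : (t, x, u) ∈ m.dom) (hy : (t, y, u) ∈ m.dom) :
    G (t, x, u) = G (t, y, u) :=
  hm.src_inClass.xdom_interval.eq_of_hasDerivAt_zero (g := fun y => G (t, y, u))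
    (fun s hs => by
      have hp : (t, s, u) ∈ m.dom := ⟨hx.1, hs, hx.2.2⟩
      simpa [h0 _ hp] using hasDerivAt_slice_x (hG _ hp)) hx.2.1 hy.2.1

lemma eq_of_fderiv_t (hm : m.IsAdmissible) {G : ℝ × ℝ × ℝ → ℝ}
    (hG : ∀ p ∈ m.dom, DifferentiableAt ℝ G p) (h0 : ∀ p ∈ m.dom, fderiv ℝ G p (1, 0, 0) = 0)
    {t s x u : ℝ} (ht : (t, x, u) ∈ m.dom) (hs : (s, x, u) ∈ m.dom) :
    G (t, x, u) = G (s, x, u) :=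
  hm.isPointTransf.tdom_interval.eq_of_hasDerivAt_zero (g := fun y => G (y, x, u))
    (fun s hs => by
      have hp : (s, x, u) ∈ m.dom := ⟨hs, ht.2.1, ht.2.2⟩
      simpa [h0 _ hp] using hasDerivAt_slice_t (hG _ hp)) ht.1 hs.1

/-- A function that does not depend on `u` has derivatives that do not depend on `u`. -/
lemma fderiv_eq_of_fderiv_u (hm : m.IsAdmissible) {G : ℝ × ℝ × ℝ → ℝ}
    (hG : ∀ p ∈ m.dom, DifferentiableAt ℝ G p) (h0 : ∀ p ∈ m.dom, fderiv ℝ G p (0, 0, 1) = 0)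
    {t x u v : ℝ} (hu : (t, x, u) ∈ m.dom) (hv : (t, x, v) ∈ m.dom) :
    fderiv ℝ G (t, x, u) = fderiv ℝ G (t, x, v) ∧
    fderiv ℝ (fderiv ℝ G) (t, x, u) = fderiv ℝ (fderiv ℝ G) (t, x, v) := by
  -- Near (t, x, u) the function coincides with its translate by `c`, hence so do its derivatives of
  -- all orders.
  set c : ℝ × ℝ × ℝ := (0, 0, v - u) with hc
  have hPc : ((t, x, u) : ℝ × ℝ × ℝ) + c = (t, x, v) := by simp [hc]
  have hev : G =ᶠ[𝓝 (t, x, u)] fun p => G (p + c) := by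
    have h2 : ∀ᶠ p in 𝓝 ((t, x, u) : ℝ × ℝ × ℝ), p + c ∈ m.dom :=
      (Continuous.tendsto' (f := fun p : ℝ × ℝ × ℝ => p + c) (by fun_prop) _ _ hPc).eventually
        (hm.isOpen_dom.mem_nhds hv)
    filter_upwards [hm.isOpen_dom.mem_nhds hu, h2]
    rintro ⟨a, b, d⟩ h3 h4
    have : ((a, b, d) : ℝ × ℝ × ℝ) + c = (a, b, d + (v - u)) := by simp [hc]
    rw [this] at h4 ⊢
    exact hm.eq_of_fderiv_u hG h0 h3 h4
  have h1 : fderiv ℝ G =ᶠ[𝓝 (t, x, u)] fun p => fderiv ℝ G (p + c) := by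
    refine hev.fderiv.trans (Eventually.of_forall fun p => ?_)
    exact fderiv_comp_add_right c
  refine ⟨?_, ?_⟩
  · rw [h1.eq_of_nhds, hPc]
  · rw [h1.fderiv_eq, fderiv_comp_add_right, hPc]

lemma differentiableAt_T (hm : m.IsAdmissible) {P : ℝ × ℝ × ℝ} (hP : P ∈ m.dom) :
    DifferentiableAt ℝ m.T P := (hm.contDiffAt_T hP).differentiableAt (by simp)

lemma differentiableAt_X (hm : m.IsAdmissible) {P : ℝ × ℝ × ℝ} (hP : P ∈ m.dom) :
    DifferentiableAt ℝ m.X P := (hm.contDiffAt_X hP).differentiableAt (by simp)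

lemma differentiableAt_U (hm : m.IsAdmissible) {P : ℝ × ℝ × ℝ} (hP : P ∈ m.dom) :
    DifferentiableAt ℝ m.U P := (hm.contDiffAt_U hP).differentiableAt (by simp)

lemma T_eq (hm : m.IsAdmissible) {t x u v : ℝ} (hu : (t, x, u) ∈ m.dom) (hv : (t, x, v) ∈ m.dom) :
    m.T (t, x, u) = m.T (t, x, v) ∧ fderiv ℝ m.T (t, x, u) = fderiv ℝ m.T (t, x, v) ∧
    fderiv ℝ (fderiv ℝ m.T) (t, x, u) = fderiv ℝ (fderiv ℝ m.T) (t, x, v) :=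
  ⟨hm.eq_of_fderiv_u (fun _ => hm.differentiableAt_T) (fun _ hp => (hm.fderiv_u_eq_zero hp).1) hu hv,
    hm.fderiv_eq_of_fderiv_u (fun _ => hm.differentiableAt_T)
      (fun _ hp => (hm.fderiv_u_eq_zero hp).1) hu hv⟩

lemma X_eq (hm : m.IsAdmissible) {t x u v : ℝ} (hu : (t, x, u) ∈ m.dom) (hv : (t, x, v) ∈ m.dom) :
    m.X (t, x, u) = m.X (t, x, v) ∧ fderiv ℝ m.X (t, x, u) = fderiv ℝ m.X (t, x, v) ∧
    fderiv ℝ (fderiv ℝ m.X) (t, x, u) = fderiv ℝ (fderiv ℝ m.X) (t, x, v) :=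
  ⟨hm.eq_of_fderiv_u (fun _ => hm.differentiableAt_X) (fun _ hp => (hm.fderiv_u_eq_zero hp).2) hu hv,
    hm.fderiv_eq_of_fderiv_u (fun _ => hm.differentiableAt_X)
      (fun _ hp => (hm.fderiv_u_eq_zero hp).2) hu hv⟩

/-- Either `t̃`, `x̃` are functions of `t`, `x` respectively, or they are functions of `x`, `t`. -/
lemma separated (hm : m.IsAdmissible) (hg : m.src.IsGeneric) :
    (∀ P ∈ m.dom, fderiv ℝ m.T P (0, 1, 0) = 0 ∧ fderiv ℝ m.X P (1, 0, 0) = 0) ∨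
    (∀ P ∈ m.dom, fderiv ℝ m.T P (1, 0, 0) = 0 ∧ fderiv ℝ m.X P (0, 1, 0) = 0) := by
  obtain ⟨-, V, s, hV, hVs, hs, hHK⟩ := hg
  obtain ⟨u₁, h1, u₂, h2, u₃, h3, h12, h23⟩ := hV.exists_three
  have hprod : ∀ P ∈ m.dom, fderiv ℝ m.T P (0, 1, 0) * fderiv ℝ m.X P (0, 1, 0) = 0 ∧
      fderiv ℝ m.T P (1, 0, 0) * fderiv ℝ m.X P (1, 0, 0) = 0 := by
    rintro ⟨t, x, u⟩ hP
    have hf := hm.src_inClass.f_ne_zero x hP.2.1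
    have key : ∀ v ∈ V, m.src.f x * (fderiv ℝ m.T (t, x, u) (1, 0, 0)
        * fderiv ℝ m.X (t, x, u) (1, 0, 0)) = s * Real.exp (v ^ 2)
          * (fderiv ℝ m.T (t, x, u) (0, 1, 0) * fderiv ℝ m.X (t, x, u) (0, 1, 0)) := by
      intro v hv
      have hQ : (t, x, v) ∈ m.dom := ⟨hP.1, hP.2.1, hVs hv⟩
      have := (hm.principal_zero hQ).2
      rwa [(hm.T_eq hQ hP).2.1, (hm.X_eq hQ hP).2.1, (hHK v hv).1] at this
    -- Only the factor e^{v²} varies with v, so a nonzero product would make v² constant on `V`; a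
    -- square takes each value at most twice, hence the three points.
    have hz : fderiv ℝ m.T (t, x, u) (0, 1, 0) * fderiv ℝ m.X (t, x, u) (0, 1, 0) = 0 := by
      by_contra hne
      have hsq : ∀ v ∈ V, ∀ w ∈ V, v ^ 2 = w ^ 2 := by
        intro v hv w hw
        have h := (key v hv).symm.trans (key w hw)
        have h' := mul_left_cancel₀ hs (mul_right_cancel₀ hne h)
        exact Real.exp_injective h'
      have e1 := hsq u₁ h1 u₂ h2
      have e2 := hsq u₂ h2 u₃ h3
      have e3 : (u₁ - u₂) * (u₁ + u₂) = 0 := by linarith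
      have e4 : (u₂ - u₃) * (u₂ + u₃) = 0 := by linarith
      have e5 := (mul_eq_zero.1 e3).resolve_left (by linarith)
      have e6 := (mul_eq_zero.1 e4).resolve_left (by linarith)
      linarith
    refine ⟨hz, ?_⟩
    have := key u₁ h1
    rw [hz, mul_zero] at this
    exact (mul_eq_zero.1 this).resolve_left hf
  have hpt : ∀ P ∈ m.dom, (fderiv ℝ m.T P (1, 0, 0) ≠ 0 → fderiv ℝ m.T P (0, 1, 0) = 0 ∧
      fderiv ℝ m.X P (1, 0, 0) = 0) ∧ (fderiv ℝ m.T P (0, 1, 0) ≠ 0 →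
      fderiv ℝ m.T P (1, 0, 0) = 0 ∧ fderiv ℝ m.X P (0, 1, 0) = 0) ∧
      (fderiv ℝ m.T P (1, 0, 0) ≠ 0 ∨ fderiv ℝ m.T P (0, 1, 0) ≠ 0) := by
    intro P hP
    have hD := hm.minor_ne_zero hP
    obtain ⟨e1, e2⟩ := hprod P hP
    generalize fderiv ℝ m.T P (1, 0, 0) = a at *
    generalize fderiv ℝ m.T P (0, 1, 0) = b at *
    generalize fderiv ℝ m.X P (1, 0, 0) = c at *
    generalize fderiv ℝ m.X P (0, 1, 0) = d at *
    refine ⟨fun ha => ?_, fun hb => ?_, ?_⟩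
    · have hc : c = 0 := by simpa [ha] using e2
      subst hc
      have hd : d ≠ 0 := by
        rintro rfl
        simp at hD
      exact ⟨by simpa [hd] using e1, rfl⟩
    · have hd : d = 0 := by simpa [hb] using e1
      subst hd
      have hc : c ≠ 0 := by
        rintro rfl
        simp at hD
      exact ⟨by simpa [hc] using e2, rfl⟩
    · by_contra! hab
      rw [hab.1, hab.2] at hD
      simp at hD
  -- The alternative is uniform because the connected domain is covered by the disjoint open sets
  -- T_t ≠ 0 and T_x ≠ 0.
  have hpre : IsPreconnected m.dom :=
    hm.isPointTransf.tdom_interval.isPreconnected.prod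
      (hm.src_inClass.xdom_interval.isPreconnected.prod
        hm.src_inClass.udom_interval.isPreconnected)
  have hcont : ∀ w : ℝ × ℝ × ℝ, ContinuousOn (fun P => fderiv ℝ m.T P w) m.dom := fun w P hP =>
    (hasFDerivAt_fderiv_apply ((hm.contDiffAt_T hP).of_le
      two_le_infty) w).continuousAt.continuousWithinAt
  have hopen : ∀ w : ℝ × ℝ × ℝ, IsOpen (m.dom ∩ (fun P => fderiv ℝ m.T P w) ⁻¹' {0}ᶜ) := fun w =>
    (hcont w).isOpen_inter_preimage hm.isOpen_dom isOpen_compl_singleton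
  have hdisj : Disjoint (m.dom ∩ (fun P => fderiv ℝ m.T P (1, 0, 0)) ⁻¹' {0}ᶜ)
      (m.dom ∩ (fun P => fderiv ℝ m.T P (0, 1, 0)) ⁻¹' {0}ᶜ) := by
    rw [Set.disjoint_left]
    rintro P ⟨hP, ha⟩ ⟨-, hb⟩
    exact hb ((hpt P hP).1 ha).1
  have hcov : m.dom ⊆ (m.dom ∩ (fun P => fderiv ℝ m.T P (1, 0, 0)) ⁻¹' {0}ᶜ) ∪
      (m.dom ∩ (fun P => fderiv ℝ m.T P (0, 1, 0)) ⁻¹' {0}ᶜ) := fun P hP =>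
    (hpt P hP).2.2.imp (fun h => ⟨hP, h⟩) (fun h => ⟨hP, h⟩)
  rcases (m.dom ∩ (m.dom ∩ (fun P => fderiv ℝ m.T P (1, 0, 0)) ⁻¹' {0}ᶜ)).eq_empty_or_nonempty
    with he | hne
  · right
    intro P hP
    refine (hpt P hP).2.1 ((hpt P hP).2.2.resolve_left fun h => ?_)
    exact (he ▸ (⟨hP, hP, h⟩ : P ∈ m.dom ∩ (m.dom ∩ _)) : P ∈ (∅ : Set (ℝ × ℝ × ℝ)))
  · left
    intro P hP
    exact (hpt P hP).1 (hpre.subset_left_of_subset_union (hopen _) (hopen _) hdisj hcov hne hP).2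

/-- The variables `t` and `x` cannot be interchanged. -/
lemma not_swapped (hm : m.IsAdmissible) (hg : m.src.IsGeneric)
    (hS : ∀ P ∈ m.dom, fderiv ℝ m.T P (1, 0, 0) = 0 ∧ fderiv ℝ m.X P (0, 1, 0) = 0) : False := by
  obtain ⟨⟨x, hx, hhx⟩, V, s, hV, hVs, hs, hHK⟩ := hg
  obtain ⟨t, ht⟩ := hm.isPointTransf.tdom_interval.2.1
  -- For t̃ = T(x), x̃ = X(t) the equation forces 2U_xu H = U_u(hK + H T''/T') and U_uu H = U_u H_u.
  have key : ∀ x ∈ m.src.xdom, ∀ u ∈ m.src.udom,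
      2 * fderiv ℝ (fderiv ℝ m.U) (t, x, u) (0, 1, 0) (0, 0, 1) * m.src.H u
        = fderiv ℝ m.U (t, x, u) (0, 0, 1) * (m.src.h x * m.src.K u
          + m.src.H u * (fderiv ℝ (fderiv ℝ m.T) (t, x, u) (0, 1, 0) (0, 1, 0)
            / fderiv ℝ m.T (t, x, u) (0, 1, 0))) ∧
      fderiv ℝ (fderiv ℝ m.U) (t, x, u) (0, 0, 1) (0, 0, 1) * m.src.H u
        = fderiv ℝ m.U (t, x, u) (0, 0, 1) * deriv m.src.H u := by
    intro x hx u hu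
    have hP : (t, x, u) ∈ m.dom := ⟨ht, hx, hu⟩
    have hD := hm.minor_ne_zero hP
    have hprin := (hm.principal_zero hP).1
    have hf := hm.src_inClass.f_ne_zero x hx
    have hH := hm.src_inClass.H_ne_zero u hu
    have hF := hm.tgt_f_ne_zero hP
    have hG := hm.tgt_H_ne_zero hP
    have hT2 := (hm.contDiffAt_T hP).of_le two_le_infty
    have hX2 := (hm.contDiffAt_X hP).of_le two_le_infty
    have hU2 := (hm.contDiffAt_U hP).of_le two_le_infty
    have zT := fun v => fderiv_fderiv_eq_zero hm.isOpen_dom hT2 (fun p hp => (hS p hp).1) hP v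
    have zX := fun v => fderiv_fderiv_eq_zero hm.isOpen_dom hX2 (fun p hp => (hS p hp).2) hP v
    have zTu := fun v => fderiv_fderiv_eq_zero hm.isOpen_dom hT2
      (fun p hp => (hm.fderiv_u_eq_zero hp).1) hP v
    have zXu := fun v => fderiv_fderiv_eq_zero hm.isOpen_dom hX2
      (fun p hp => (hm.fderiv_u_eq_zero hp).2) hP v
    have hTu := (hm.fderiv_u_eq_zero hP).1
    have hXu := (hm.fderiv_u_eq_zero hP).2
    obtain ⟨hTt, hXx⟩ := hS _ hP
    rw [hTt, hXx] at hD hprin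
    have hTx : fderiv ℝ m.T (t, x, u) (0, 1, 0) ≠ 0 := by
      intro h
      rw [h] at hD
      simp at hD
    have hXt : fderiv ℝ m.X (t, x, u) (1, 0, 0) ≠ 0 := by
      intro h
      rw [h] at hD
      simp at hD
    have jet := fun q => hm.jet_identity (p := 0) (q := q) (s := 0) (v := 0)
      (r := (deriv m.src.H u * q ^ 2 + m.src.h x * m.src.K u * q) / m.src.f x)
      (a₁ := 0) (a₂ := (fderiv ℝ m.T (t, x, u) (0, 1, 0))⁻¹)
      (b₁ := (fderiv ℝ m.X (t, x, u) (1, 0, 0))⁻¹) (b₂ := 0) hP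
      (by rw [map_tlift, hTu]; field_simp; ring) (by rw [map_tlift, hXu, hXx]; ring)
      (by rw [map_tlift, hTu, hTt]; ring) (by rw [map_tlift, hXu]; field_simp; ring) rfl rfl
      (by field_simp; ring)
    simp only [secondAlong, second_tlift_x hT2, second_tlift_x hX2, second_tlift_x hU2,
      second_tlift_t hT2, second_tlift_t hX2, second_tlift_t hU2, map_tlift,
      (zT _).1, (zT _).2, (zX _).1, (zX _).2, (zTu _).1, (zXu _).1, hTu, hXu] at jet
    -- The identity is quadratic in the slope q: its odd part yields `l1`, its coefficient at q²
    -- yields `l2`.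
    have j0 := jet 0
    have j1 := jet 1
    have j2 := jet (-1)
    clear jet zT zX zTu zXu hD hTt hXx
    generalize fderiv ℝ m.T (t, x, u) (0, 1, 0) = Tx at *
    generalize fderiv ℝ m.X (t, x, u) (1, 0, 0) = Xt at *
    generalize fderiv ℝ (fderiv ℝ m.U) (t, x, u) (0, 1, 0) (0, 0, 1) = Uxu at *
    generalize fderiv ℝ (fderiv ℝ m.U) (t, x, u) (0, 0, 1) (0, 0, 1) = Uuu at *
    generalize fderiv ℝ m.U (t, x, u) (0, 0, 1) = Uu at *
    generalize fderiv ℝ (fderiv ℝ m.T) (t, x, u) (0, 1, 0) (0, 1, 0) = Txx at *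
    generalize m.tgt.f (m.X (t, x, u)) = F at *
    generalize m.tgt.H (m.U (t, x, u)) = G at *
    have hpr : F * Xt ^ 2 * m.src.f x = m.src.H u * G * Tx ^ 2 := by linear_combination hprin
    have l1 : F * Tx⁻¹ ^ 2 * (2 * Uxu - Uu * Txx * Tx⁻¹)
        = G * Xt⁻¹ ^ 2 * (m.src.h x * m.src.K u) / m.src.f x * Uu := by
      linear_combination (j1 - j2) / 2
    have l2 : F * Tx⁻¹ ^ 2 * Uuu = G * Xt⁻¹ ^ 2 * deriv m.src.H u / m.src.f x * Uu := by
      linear_combination (j1 + j2) / 2 - j0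
    constructor
    · field_simp at l1 ⊢
      refine mul_left_cancel₀ (mul_ne_zero hG (pow_ne_zero 2 hTx)) ?_
      linear_combination l1 - (2 * Uxu * Tx - Uu * Txx) * hpr
    · field_simp at l2
      refine mul_left_cancel₀ (mul_ne_zero hG (pow_ne_zero 2 hTx)) ?_
      linear_combination l2 - Uuu * hpr
  obtain ⟨u₁, h1, u₂, h2, -, -, h12, -⟩ := hV.exists_three
  -- On `V`, U_uu = 2u U_u, so U_u e^{-u²} does not depend on u.
  have hconst : ∀ y ∈ m.src.xdom, fderiv ℝ m.U (t, y, u₁) (0, 0, 1) * Real.exp (-u₁ ^ 2)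
      = fderiv ℝ m.U (t, y, u₂) (0, 0, 1) * Real.exp (-u₂ ^ 2) := by
    intro y hy
    refine hV.eq_of_hasDerivAt_zero
      (g := fun u => fderiv ℝ m.U (t, y, u) (0, 0, 1) * Real.exp (-u ^ 2)) (fun u hu => ?_) h1 h2
    have hP : (t, y, u) ∈ m.dom := ⟨ht, hy, hVs hu⟩
    have hE := ((hasDerivAt_id u).fun_pow 2).fun_neg.exp
    refine ((hm.hasDerivAt_Uu_u hP).mul hE).congr_deriv ?_
    have h3 := (key y hy u (hVs hu)).2
    rw [hasDerivAt_exp_sq hV (fun v hv => (hHK v hv).1) hu] at h3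
    have h4 : fderiv ℝ (fderiv ℝ m.U) (t, y, u) (0, 0, 1) (0, 0, 1)
        = 2 * u * fderiv ℝ m.U (t, y, u) (0, 0, 1) :=
      mul_right_cancel₀ (hm.src_inClass.H_ne_zero u (hVs hu)) (by linarith)
    rw [h4]
    simp
    ring
  have hP1 : (t, x, u₁) ∈ m.dom := ⟨ht, hx, hVs h1⟩
  have hP2 : (t, x, u₂) ∈ m.dom := ⟨ht, hx, hVs h2⟩
  have d1 := (hm.hasDerivAt_Uu_slice hP1 0 1).mul_const (Real.exp (-u₁ ^ 2))
  have d2 := (hm.hasDerivAt_Uu_slice hP2 0 1).mul_const (Real.exp (-u₂ ^ 2))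
  have hev : ∀ᶠ y in 𝓝 (0 : ℝ), x + y * 1 ∈ m.src.xdom :=
    (Continuous.tendsto' (by fun_prop) _ _ (by simp)).eventually
      (hm.src_inClass.xdom_interval.mem_nhds hx)
  have hd := d1.unique (d2.congr_of_eventuallyEq (by
    filter_upwards [hev] with y hy
    simpa using hconst _ hy))
  have k1 := (key x hx u₁ (hVs h1)).1
  have k2 := (key x hx u₂ (hVs h2)).1
  rw [(hm.T_eq hP2 hP1).2.1, (hm.T_eq hP2 hP1).2.2, (hHK u₂ h2).2] at k2
  rw [(hHK u₁ h1).2] at k1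
  have hH1 := hm.src_inClass.H_ne_zero u₁ (hVs h1)
  have hH2 := hm.src_inClass.H_ne_zero u₂ (hVs h2)
  have hUu := hm.fderiv_U_ne_zero hP1
  have hc := hconst x hx
  have hE := (Real.exp_pos (-u₁ ^ 2)).ne'
  generalize fderiv ℝ (fderiv ℝ m.T) (t, x, u₁) (0, 1, 0) (0, 1, 0)
            / fderiv ℝ m.T (t, x, u₁) (0, 1, 0) = κ at *
  -- By `hconst`, U_xu/U_u is the same at `u₁` and `u₂`, whereas these relations make it half of hu
  -- + κ; this is impossible at a point with h ≠ 0.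
  have k1' : 2 * fderiv ℝ (fderiv ℝ m.U) (t, x, u₁) (0, 1, 0) (0, 0, 1)
      = fderiv ℝ m.U (t, x, u₁) (0, 0, 1) * (m.src.h x * u₁ + κ) :=
    mul_right_cancel₀ hH1 (by linarith)
  have k2' : 2 * fderiv ℝ (fderiv ℝ m.U) (t, x, u₂) (0, 1, 0) (0, 0, 1)
      = fderiv ℝ m.U (t, x, u₂) (0, 0, 1) * (m.src.h x * u₂ + κ) :=
    mul_right_cancel₀ hH2 (by linarith)
  have hfin : fderiv ℝ m.U (t, x, u₁) (0, 0, 1) * Real.exp (-u₁ ^ 2)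
      * (m.src.h x * (u₁ - u₂)) = 0 := by
    linear_combination 2 * hd - Real.exp (-u₁ ^ 2) * k1' + Real.exp (-u₂ ^ 2) * k2'
      - (m.src.h x * u₂ + κ) * hc
  have : u₁ - u₂ ≠ 0 := by linarith
  simp [hUu, hE, hhx, this] at hfin

end Transf.IsAdmissible

end TelegraphG1

/-! ### Determining equations and their solution for generic tuples -/

namespace TelegraphG1

namespace Transf.IsAdmissible

variable {m : Transf}

/-- The determining equations for transformations with `t̃ = T(t)`, `x̃ = X(x)`. -/
lemma determining (hm : m.IsAdmissible)
    (hN : ∀ P ∈ m.dom, fderiv ℝ m.T P (0, 1, 0) = 0 ∧ fderiv ℝ m.X P (1, 0, 0) = 0)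
    {t x u : ℝ} (hP : (t, x, u) ∈ m.dom) :
    fderiv ℝ m.T (t, x, u) (1, 0, 0) ≠ 0 ∧ fderiv ℝ m.X (t, x, u) (0, 1, 0) ≠ 0 ∧
    m.src.H u * m.tgt.f (m.X (t, x, u)) * fderiv ℝ m.X (t, x, u) (0, 1, 0) ^ 2
      = m.src.f x * m.tgt.H (m.U (t, x, u)) * fderiv ℝ m.T (t, x, u) (1, 0, 0) ^ 2 ∧
    fderiv ℝ (fderiv ℝ m.U) (t, x, u) (0, 0, 1) (0, 0, 1) = 0 ∧
    2 * fderiv ℝ (fderiv ℝ m.U) (t, x, u) (1, 0, 0) (0, 0, 1)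
        * fderiv ℝ m.T (t, x, u) (1, 0, 0)
      = fderiv ℝ m.U (t, x, u) (0, 0, 1)
        * fderiv ℝ (fderiv ℝ m.T) (t, x, u) (1, 0, 0) (1, 0, 0) ∧
    (fderiv ℝ m.U (t, x, u) (0, 1, 0) = 0 →
      fderiv ℝ (fderiv ℝ m.U) (t, x, u) (0, 1, 0) (0, 0, 1) = 0 →
      m.tgt.H (m.U (t, x, u)) * (m.src.h x * m.src.K u * fderiv ℝ m.X (t, x, u) (0, 1, 0)
        + m.src.H u * fderiv ℝ (fderiv ℝ m.X) (t, x, u) (0, 1, 0) (0, 1, 0))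
      = m.src.H u * (m.tgt.h (m.X (t, x, u)) * m.tgt.K (m.U (t, x, u)))
        * fderiv ℝ m.X (t, x, u) (0, 1, 0) ^ 2) := by
  have hD := hm.minor_ne_zero hP
  have hprin := (hm.principal_zero hP).1
  have hf := hm.src_inClass.f_ne_zero x hP.2.1
  have hF := hm.tgt_f_ne_zero hP
  have hUu := hm.fderiv_U_ne_zero hP
  have hT2 := (hm.contDiffAt_T hP).of_le two_le_infty
  have hX2 := (hm.contDiffAt_X hP).of_le two_le_infty
  have hU2 := (hm.contDiffAt_U hP).of_le two_le_infty
  have zT := fun v => fderiv_fderiv_eq_zero hm.isOpen_dom hT2 (fun p hp => (hN p hp).1) hP v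
  have zX := fun v => fderiv_fderiv_eq_zero hm.isOpen_dom hX2 (fun p hp => (hN p hp).2) hP v
  have zTu := fun v => fderiv_fderiv_eq_zero hm.isOpen_dom hT2
    (fun p hp => (hm.fderiv_u_eq_zero hp).1) hP v
  have zXu := fun v => fderiv_fderiv_eq_zero hm.isOpen_dom hX2
    (fun p hp => (hm.fderiv_u_eq_zero hp).2) hP v
  have hTu := (hm.fderiv_u_eq_zero hP).1
  have hXu := (hm.fderiv_u_eq_zero hP).2
  obtain ⟨hTx, hXt⟩ := hN _ hP
  rw [hTx, hXt] at hD hprin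
  have hTt : fderiv ℝ m.T (t, x, u) (1, 0, 0) ≠ 0 := by
    intro h
    rw [h] at hD
    simp at hD
  have hXx : fderiv ℝ m.X (t, x, u) (0, 1, 0) ≠ 0 := by
    intro h
    rw [h] at hD
    simp at hD
  have jet := fun p q => hm.jet_identity (p := p) (q := q) (s := 0) (v := 0)
    (r := (deriv m.src.H u * q ^ 2 + m.src.h x * m.src.K u * q) / m.src.f x)
    (a₁ := (fderiv ℝ m.T (t, x, u) (1, 0, 0))⁻¹) (a₂ := 0)
    (b₁ := 0) (b₂ := (fderiv ℝ m.X (t, x, u) (0, 1, 0))⁻¹) hP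
    (by rw [map_tlift, hTu]; field_simp; ring) (by rw [map_tlift, hXu, hXt]; ring)
    (by rw [map_tlift, hTu, hTx]; ring) (by rw [map_tlift, hXu]; field_simp; ring) rfl rfl
    (by field_simp; ring)
  simp only [secondAlong, second_tlift_x hT2, second_tlift_x hX2, second_tlift_x hU2,
    second_tlift_t hT2, second_tlift_t hX2, second_tlift_t hU2, map_tlift,
    (zT _).1, (zX _).1, (zTu _).1, (zXu _).1, hTu, hXu] at jet
  -- The second differences in p give U_uu = 0, the odd part in p relates U_tu to T_tt, and the odd
  -- part in q is the relation between the lower-order terms.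
  have j0 := jet 0 0
  have j1 := jet 1 0
  have j2 := jet (-1) 0
  have j3 := jet 0 1
  have j4 := jet 0 (-1)
  clear jet zT zX zTu zXu hD hTx hXt
  generalize fderiv ℝ m.T (t, x, u) (1, 0, 0) = Tt at *
  generalize fderiv ℝ m.X (t, x, u) (0, 1, 0) = Xx at *
  generalize fderiv ℝ (fderiv ℝ m.U) (t, x, u) (0, 1, 0) (0, 0, 1) = Uxu at *
  generalize fderiv ℝ (fderiv ℝ m.U) (t, x, u) (1, 0, 0) (0, 0, 1) = Utu at *
  generalize fderiv ℝ (fderiv ℝ m.U) (t, x, u) (0, 0, 1) (0, 0, 1) = Uuu at *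
  generalize fderiv ℝ m.U (t, x, u) (0, 0, 1) = Uu at *
  generalize fderiv ℝ m.U (t, x, u) (0, 1, 0) = Ux at *
  generalize fderiv ℝ (fderiv ℝ m.T) (t, x, u) (1, 0, 0) (1, 0, 0) = Ttt at *
  generalize fderiv ℝ (fderiv ℝ m.X) (t, x, u) (0, 1, 0) (0, 1, 0) = Xxx at *
  generalize m.tgt.f (m.X (t, x, u)) = F at *
  generalize m.tgt.H (m.U (t, x, u)) = G at *
  have hFT : F * Tt⁻¹ ^ 2 ≠ 0 := mul_ne_zero hF (pow_ne_zero 2 (inv_ne_zero hTt))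
  have hpr : m.src.H u * F * Xx ^ 2 = m.src.f x * G * Tt ^ 2 := by linear_combination hprin
  have hUuu : Uuu = 0 := by
    have : F * Tt⁻¹ ^ 2 * Uuu = 0 := by linear_combination (j1 + j2) / 2 - j0
    exact (mul_eq_zero.1 this).resolve_left hFT
  refine ⟨hTt, hXx, hpr, hUuu, ?_, fun hUx hUxu => ?_⟩
  · have : F * Tt⁻¹ ^ 2 * (2 * Utu - Uu * Ttt * Tt⁻¹) = 0 := by linear_combination (j1 - j2) / 2
    have := (mul_eq_zero.1 this).resolve_left hFT
    field_simp at this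
    linarith
  · subst hUx hUxu hUuu
    have : F * Tt⁻¹ ^ 2 * (m.src.h x * m.src.K u) / m.src.f x * Uu
        = - G * Xx⁻¹ ^ 2 * (Xx⁻¹ * Uu * Xxx)
          + m.tgt.h (m.X (t, x, u)) * m.tgt.K (m.U (t, x, u)) * (Xx⁻¹ * Uu) := by
      linear_combination (j3 - j4) / 2
    field_simp at this
    refine mul_left_cancel₀ (mul_ne_zero hf (pow_ne_zero 2 hTt)) ?_
    linear_combination m.src.H u * this - m.src.h x * m.src.K u * Xx * hpr

/-- `ũ` is a function of `u`. -/
lemma fderiv_U_eq_zero (hm : m.IsAdmissible) (hg : m.src.IsGeneric)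
    (hN : ∀ P ∈ m.dom, fderiv ℝ m.T P (0, 1, 0) = 0 ∧ fderiv ℝ m.X P (1, 0, 0) = 0)
    {t x u : ℝ} (hP : (t, x, u) ∈ m.dom) (a b : ℝ) :
    fderiv ℝ m.U (t, x, u) (a, b, 0) = 0 ∧
    fderiv ℝ (fderiv ℝ m.U) (t, x, u) (a, b, 0) (0, 0, 1) = 0 := by
  obtain ⟨-, V, s, hV, hVs, hs, hHK⟩ := hg
  obtain ⟨u₁, h1, u₂, h2, u₃, h3, h12, h23⟩ := hV.exists_three
  have hI := hm.src_inClass.udom_interval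
  have hUu : ∀ t x v w, (t, x, v) ∈ m.dom → (t, x, w) ∈ m.dom →
      fderiv ℝ m.U (t, x, w) (0, 0, 1) = fderiv ℝ m.U (t, x, v) (0, 0, 1) := by
    intro t x v w hv hw
    refine hI.eq_of_hasDerivAt_zero (g := fun u => fderiv ℝ m.U (t, x, u) (0, 0, 1))
      (fun u hu => ?_) hw.2.2 hv.2.2
    have hp : (t, x, u) ∈ m.dom := ⟨hv.1, hv.2.1, hu⟩
    simpa [(hm.determining hN hp).2.2.2.1] using hm.hasDerivAt_Uu_u hp
  have hU : ∀ t x v w, (t, x, v) ∈ m.dom → (t, x, w) ∈ m.dom →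
      m.U (t, x, w) = m.U (t, x, v) + fderiv ℝ m.U (t, x, v) (0, 0, 1) * (w - v) := by
    intro t x v w hv hw
    refine hI.eq_add_of_hasDerivAt_const (g := fun u => m.U (t, x, u)) (fun u hu => ?_)
      hv.2.2 hw.2.2
    have hp : (t, x, u) ∈ m.dom := ⟨hv.1, hv.2.1, hu⟩
    rw [← hUu t x v u hv hp]
    exact hasDerivAt_slice_u (hm.differentiableAt_U hp)
  -- In the principal relation f, f̃, T_t and X_x do not depend on u, so for fixed (t, x) the
  -- function H̃∘U is proportional to H.
  have hHU : ∀ t x v w, (t, x, v) ∈ m.dom → (t, x, w) ∈ m.dom →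
      m.tgt.H (m.U (t, x, w)) * m.src.H v = m.tgt.H (m.U (t, x, v)) * m.src.H w := by
    intro t x v w hv hw
    have e1 := (hm.determining hN hv).2.2.1
    have e2 := (hm.determining hN hw).2.2.1
    rw [(hm.X_eq hw hv).1, (hm.X_eq hw hv).2.1, (hm.T_eq hw hv).2.1] at e2
    have hf := hm.src_inClass.f_ne_zero x hv.2.1
    have hT := (hm.determining hN hv).1
    refine mul_left_cancel₀ (mul_ne_zero hf (pow_ne_zero 2 hT)) ?_
    linear_combination m.src.H w * e1 - m.src.H v * e2
  set A := fderiv ℝ m.U (t, x, u₁) (a, b, 0) with hA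
  set B := fderiv ℝ (fderiv ℝ m.U) (t, x, u₁) (a, b, 0) (0, 0, 1) with hB
  have hP1 : (t, x, u₁) ∈ m.dom := ⟨hP.1, hP.2.1, hVs h1⟩
  have hevt : ∀ᶠ y in 𝓝 (0 : ℝ), t + y * a ∈ m.tdom :=
    (Continuous.tendsto' (by fun_prop) _ _ (by simp)).eventually
      (hm.isPointTransf.tdom_interval.mem_nhds hP.1)
  have hevx : ∀ᶠ y in 𝓝 (0 : ℝ), x + y * b ∈ m.src.xdom :=
    (Continuous.tendsto' (by fun_prop) _ _ (by simp)).eventually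
      (hm.src_inClass.xdom_interval.mem_nhds hP.2.1)
  have hUe : ∀ w, (t, x, w) ∈ m.dom → fderiv ℝ m.U (t, x, w) (a, b, 0) = A + B * (w - u₁) := by
    intro w hw
    have d1 := (hm.hasDerivAt_U_slice hP1 a b).fun_add
      ((hm.hasDerivAt_Uu_slice hP1 a b).mul_const (w - u₁))
    have d2 := hm.hasDerivAt_U_slice hw a b
    refine d2.unique (d1.congr_of_eventuallyEq ?_)
    filter_upwards [hevt, hevx] with y hy1 hy2
    exact hU _ _ u₁ w ⟨hy1, hy2, hP1.2.2⟩ ⟨hy1, hy2, hw.2.2⟩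
  have hUue : ∀ w, (t, x, w) ∈ m.dom →
      fderiv ℝ (fderiv ℝ m.U) (t, x, w) (a, b, 0) (0, 0, 1) = B := by
    intro w hw
    refine (hm.hasDerivAt_Uu_slice hw a b).unique
      ((hm.hasDerivAt_Uu_slice hP1 a b).congr_of_eventuallyEq ?_)
    filter_upwards [hevt, hevx] with y hy1 hy2
    exact hUu _ _ u₁ w ⟨hy1, hy2, hP1.2.2⟩ ⟨hy1, hy2, hw.2.2⟩
  have hG1 := hm.tgt_H_ne_zero hP1
  -- Differentiating `hHU` along (a, b, 0) and along u and eliminating H̃'(U(w)) shows that (A + B(w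
  -- - u₁))H_u/H is constant in w, and H_u/H = 2w on `V`.
  obtain ⟨κ, hκ⟩ : ∃ κ, ∀ w ∈ V, w * (A + B * (w - u₁)) = κ := by
    refine ⟨deriv m.tgt.H (m.U (t, x, u₁)) * A * fderiv ℝ m.U (t, x, u₁) (0, 0, 1)
      / (2 * m.tgt.H (m.U (t, x, u₁))), fun w hw => ?_⟩
    have hQ : (t, x, w) ∈ m.dom := ⟨hP.1, hP.2.1, hVs hw⟩
    have hHw := hm.src_inClass.H_ne_zero w (hVs hw)
    have hH1 := hm.src_inClass.H_ne_zero u₁ (hVs h1)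
    -- derivative in the direction `(a, b, 0)`
    have e0 : ∀ v, (t, x, v) ∈ m.dom → HasDerivAt
        (fun y => m.tgt.H (m.U (t + y * a, x + y * b, v)))
        (deriv m.tgt.H (m.U (t, x, v)) * fderiv ℝ m.U (t, x, v) (a, b, 0)) 0 := by
      intro v hv
      refine HasDerivAt.comp (0 : ℝ) ?_ (hm.hasDerivAt_U_slice hv a b)
      simpa using hm.tgt_inClass.hasDerivAt_H (hm.U_mem hv)
    have e1 := ((e0 w hQ).mul_const (m.src.H u₁)).unique
      (((e0 u₁ hP1).mul_const (m.src.H w)).congr_of_eventuallyEq (by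
        filter_upwards [hevt, hevx] with y hy1 hy2
        exact hHU _ _ u₁ w ⟨hy1, hy2, hP1.2.2⟩ ⟨hy1, hy2, hQ.2.2⟩))
    -- derivative in the direction `u`
    have e2 := ((hm.tgt_inClass.hasDerivAt_H (hm.U_mem hQ)).comp w
      (hasDerivAt_slice_u (hm.differentiableAt_U hQ))).mul_const (m.src.H u₁)
    have e3 := e2.unique (((hm.src_inClass.hasDerivAt_H (hVs hw)).const_mul
      (m.tgt.H (m.U (t, x, u₁)))).congr_of_eventuallyEq (by
        filter_upwards [hI.mem_nhds (hVs hw)] with v hv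
        exact hHU t x u₁ v hP1 ⟨hP.1, hP.2.1, hv⟩))
    rw [hUe w hQ, ← hA] at e1
    rw [hUu t x u₁ w hP1 hQ, hasDerivAt_exp_sq hV (fun v hv => (hHK v hv).1) hw] at e3
    rw [eq_div_iff (mul_ne_zero two_ne_zero hG1)]
    refine mul_right_cancel₀ hHw ?_
    linear_combination fderiv ℝ m.U (t, x, u₁) (0, 0, 1) * e1 - (A + B * (w - u₁)) * e3
  have k1 := hκ u₁ h1
  have k2 := hκ u₂ h2
  have k3 := hκ u₃ h3
  -- A polynomial of degree at most two with equal values at three points is constant, so B = 0 and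
  -- then A = 0.
  have q1 : (u₂ - u₁) * (A + B * u₂) = 0 := by linear_combination k2 - k1
  have q2 : (u₃ - u₂) * (A + B * (u₃ + u₂ - u₁)) = 0 := by linear_combination k3 - k2
  have r1 := (mul_eq_zero.1 q1).resolve_left (by linarith)
  have r2 := (mul_eq_zero.1 q2).resolve_left (by linarith)
  have hB0 : B = 0 := by
    have : B * (u₃ - u₁) = 0 := by linear_combination r2 - r1
    exact (mul_eq_zero.1 this).resolve_right (by linarith)
  have hA0 : A = 0 := by
    rw [hB0] at r1
    linarith
  rw [hUe u hP, hUue u hP, hA0, hB0]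
  simp

/-- Admissible transformations of generic equations belong to the family. -/
theorem exists_hasForm (hm : m.IsAdmissible) (hg : m.src.IsGeneric) :
    ∃ (c : Params) (η ξ : ℝ → ℝ), c.Nondegenerate ∧ m.HasForm c η ξ := by
  have hN := (hm.separated hg).resolve_right (hm.not_swapped hg)
  have hU0 := fun {t x u} (hP : (t, x, u) ∈ m.dom) => hm.fderiv_U_eq_zero hg hN hP
  obtain ⟨⟨x₁, hx₁, hhx₁⟩, V, s, hV, hVs, hs, hHK⟩ := hg
  obtain ⟨u₁, h1, u₂, h2, -, -, h12, -⟩ := hV.exists_three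
  obtain ⟨t₁, ht₁⟩ := hm.isPointTransf.tdom_interval.2.1
  have hθ := hm.src_inClass
  have mem : ∀ {t x u}, t ∈ m.tdom → x ∈ m.src.xdom → u ∈ m.src.udom → (t, x, u) ∈ m.dom :=
    fun ht hx hu => ⟨ht, hx, hu⟩
  have hu₁ := hVs h1
  -- `T` is an affine function of `t`
  have hTt : ∀ t ∈ m.tdom, fderiv ℝ m.T (t, x₁, u₁) (1, 0, 0)
      = fderiv ℝ m.T (t₁, x₁, u₁) (1, 0, 0) := by
    intro t ht
    refine hm.isPointTransf.tdom_interval.eq_of_hasDerivAt_zero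
      (g := fun t => fderiv ℝ m.T (t, x₁, u₁) (1, 0, 0)) (fun s hs => ?_) ht ht₁
    have hp := mem hs hx₁ hu₁
    have hd := hm.determining hN hp
    have e := hd.2.2.2.2.1
    rw [(hU0 hp 1 0).2] at e
    have hz : fderiv ℝ (fderiv ℝ m.T) (s, x₁, u₁) (1, 0, 0) (1, 0, 0) = 0 := by
      simpa [hm.fderiv_U_ne_zero hp] using e.symm
    have h := hasFDerivAt_fderiv_apply ((hm.contDiffAt_T hp).of_le two_le_infty) (1, 0, 0)
    have h' := hasDerivAt_slice_t h.differentiableAt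
    rw [h.fderiv] at h'
    simpa [hz] using h'
  set e₄ := fderiv ℝ m.T (t₁, x₁, u₁) (1, 0, 0) with he₄
  have he₄0 : e₄ ≠ 0 := (hm.determining hN (mem ht₁ hx₁ hu₁)).1
  have hT : ∀ t ∈ m.tdom, ∀ x ∈ m.src.xdom, ∀ u ∈ m.src.udom,
      m.T (t, x, u) = e₄ * t + (m.T (t₁, x₁, u₁) - e₄ * t₁) := by
    intro t ht x hx u hu
    rw [(hm.T_eq (mem ht hx hu) (mem ht hx hu₁)).1,
      hm.eq_of_fderiv_x (fun _ => hm.differentiableAt_T) (fun p hp => (hN p hp).1)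
        (mem ht hx hu₁) (mem ht hx₁ hu₁),
      hm.isPointTransf.tdom_interval.eq_add_of_hasDerivAt_const (g := fun t => m.T (t, x₁, u₁))
        (c := e₄) (fun s hs => ?_) ht₁ ht]
    · ring
    · rw [← hTt s hs]
      exact hasDerivAt_slice_t (hm.differentiableAt_T (mem hs hx₁ hu₁))
  -- `U` is an affine function of `u`
  set e₆ := fderiv ℝ m.U (t₁, x₁, u₁) (0, 0, 1) with he₆
  have he₆0 : e₆ ≠ 0 := hm.fderiv_U_ne_zero (mem ht₁ hx₁ hu₁)
  have hU : ∀ t ∈ m.tdom, ∀ x ∈ m.src.xdom, ∀ u ∈ m.src.udom,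
      m.U (t, x, u) = e₆ * u + (m.U (t₁, x₁, u₁) - e₆ * u₁) := by
    intro t ht x hx u hu
    rw [hm.eq_of_fderiv_x (fun _ => hm.differentiableAt_U) (fun p hp => (hU0 hp 0 1).1)
        (mem ht hx hu) (mem ht hx₁ hu),
      hm.eq_of_fderiv_t (fun _ => hm.differentiableAt_U) (fun p hp => (hU0 hp 1 0).1)
        (mem ht hx₁ hu) (mem ht₁ hx₁ hu),
      hθ.udom_interval.eq_add_of_hasDerivAt_const (g := fun u => m.U (t₁, x₁, u))
        (c := e₆) (fun v hv => ?_) hu₁ hu]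
    · ring
    · have hc : fderiv ℝ m.U (t₁, x₁, v) (0, 0, 1) = e₆ := by
        refine hθ.udom_interval.eq_of_hasDerivAt_zero
          (g := fun v => fderiv ℝ m.U (t₁, x₁, v) (0, 0, 1)) (fun w hw => ?_) hv hu₁
        have hp := mem ht₁ hx₁ hw
        simpa [(hm.determining hN hp).2.2.2.1] using hm.hasDerivAt_Uu_u hp
      rw [← hc]
      exact hasDerivAt_slice_u (hm.differentiableAt_U (mem ht₁ hx₁ hv))
  set e₃ := m.U (t₁, x₁, u₁) - e₆ * u₁ with he₃
  -- `X` is a function of `x`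
  have hX : ∀ t ∈ m.tdom, ∀ x ∈ m.src.xdom, ∀ u ∈ m.src.udom,
      m.X (t, x, u) = m.X (t₁, x, u₁) := by
    intro t ht x hx u hu
    rw [(hm.X_eq (mem ht hx hu) (mem ht hx hu₁)).1]
    exact hm.eq_of_fderiv_t (fun _ => hm.differentiableAt_X) (fun p hp => (hN p hp).2)
      (mem ht hx hu₁) (mem ht₁ hx hu₁)
  set X : ℝ → ℝ := fun x => m.X (t₁, x, u₁) with hXdef
  set X' : ℝ → ℝ := fun x => fderiv ℝ m.X (t₁, x, u₁) (0, 1, 0) with hX'def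
  set X'' : ℝ → ℝ := fun x => fderiv ℝ (fderiv ℝ m.X) (t₁, x, u₁) (0, 1, 0) (0, 1, 0) with hX''def
  have dX : ∀ x ∈ m.src.xdom, HasDerivAt X (X' x) x := fun x hx =>
    hasDerivAt_slice_x (hm.differentiableAt_X (mem ht₁ hx hu₁))
  have dX' : ∀ x ∈ m.src.xdom, HasDerivAt X' (X'' x) x := by
    intro x hx
    have h := hasFDerivAt_fderiv_apply
      ((hm.contDiffAt_X (mem ht₁ hx hu₁)).of_le two_le_infty) (0, 1, 0)
    have h' := hasDerivAt_slice_x h.differentiableAt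
    rwa [h.fderiv] at h'
  have hX'0 : ∀ x ∈ m.src.xdom, X' x ≠ 0 := fun x hx =>
    (hm.determining hN (mem ht₁ hx hu₁)).2.1
  -- relations between the arbitrary elements
  have hprin : ∀ x ∈ m.src.xdom, ∀ u ∈ m.src.udom,
      m.src.H u * m.tgt.f (X x) * X' x ^ 2 = m.src.f x * m.tgt.H (e₆ * u + e₃) * e₄ ^ 2 := by
    intro x hx u hu
    have hp := mem ht₁ hx hu
    have h := (hm.determining hN hp).2.2.1
    have eT : fderiv ℝ m.T (t₁, x, u) (1, 0, 0) = e₄ := by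
      have hd := hasDerivAt_slice_t (hm.differentiableAt_T hp)
      have hd' : HasDerivAt (fun t => e₄ * t + (m.T (t₁, x₁, u₁) - e₄ * t₁)) e₄ t₁ := by
        simpa using ((hasDerivAt_id t₁).const_mul e₄).add_const (m.T (t₁, x₁, u₁) - e₄ * t₁)
      refine hd.unique (hd'.congr_of_eventuallyEq ?_)
      filter_upwards [hm.isPointTransf.tdom_interval.mem_nhds ht₁] with t ht using hT t ht x hx u hu
    rwa [eT, hX t₁ ht₁ x hx u hu, hU t₁ ht₁ x hx u hu,
      (hm.X_eq hp (mem ht₁ hx hu₁)).2.1] at h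
  have hlow : ∀ x ∈ m.src.xdom, ∀ u ∈ m.src.udom,
      m.tgt.H (e₆ * u + e₃) * (m.src.h x * m.src.K u * X' x + m.src.H u * X'' x)
      = m.src.H u * (m.tgt.h (X x) * m.tgt.K (e₆ * u + e₃)) * X' x ^ 2 := by
    intro x hx u hu
    have hp := mem ht₁ hx hu
    have h := (hm.determining hN hp).2.2.2.2.2 (hU0 hp 0 1).1 (hU0 hp 0 1).2
    rwa [hX t₁ ht₁ x hx u hu, hU t₁ ht₁ x hx u hu, (hm.X_eq hp (mem ht₁ hx hu₁)).2.1,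
      (hm.X_eq hp (mem ht₁ hx hu₁)).2.2] at h
  -- The constant ratio of the new H to the old one, which becomes ε₅ε₇.
  obtain ⟨g, hg⟩ : ∃ g, g = m.tgt.H (e₆ * u₁ + e₃) / m.src.H u₁ := ⟨_, rfl⟩
  have hH1 := hθ.H_ne_zero u₁ hu₁
  have hH2 := hθ.H_ne_zero u₂ (hVs h2)
  have hgH : ∀ u ∈ m.src.udom, m.tgt.H (e₆ * u + e₃) = g * m.src.H u := by
    intro u hu
    have a1 := hprin x₁ hx₁ u hu
    have a2 := hprin x₁ hx₁ u₁ hu₁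
    have hf := hθ.f_ne_zero x₁ hx₁
    rw [hg, div_mul_eq_mul_div, eq_div_iff hH1]
    refine mul_left_cancel₀ (mul_ne_zero hf (pow_ne_zero 2 he₄0)) ?_
    linear_combination m.src.H u * a2 - m.src.H u₁ * a1
  have hg0 : g ≠ 0 := by
    intro h
    have := hm.tgt_H_ne_zero (mem ht₁ hx₁ hu₁)
    rw [hU t₁ ht₁ x₁ hx₁ u₁ hu₁, hgH u₁ hu₁, h, zero_mul] at this
    exact this rfl
  have hgf : ∀ x ∈ m.src.xdom, m.tgt.f (X x) * X' x ^ 2 = g * m.src.f x * e₄ ^ 2 := by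
    intro x hx
    have a1 := hprin x hx u₁ hu₁
    rw [hgH u₁ hu₁] at a1
    refine mul_left_cancel₀ hH1 ?_
    linear_combination a1
  have hlow' : ∀ x ∈ m.src.xdom, ∀ u ∈ m.src.udom,
      g * (m.src.h x * m.src.K u * X' x + m.src.H u * X'' x)
        = m.tgt.h (X x) * m.tgt.K (e₆ * u + e₃) * X' x ^ 2 := by
    intro x hx u hu
    have a1 := hlow x hx u hu
    rw [hgH u hu] at a1
    refine mul_left_cancel₀ (hθ.H_ne_zero u hu) ?_
    linear_combination a1
  -- If the new h vanished here, h u X' + X'' would vanish at two values of u, contradicting h(x₁) ≠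
  -- 0.
  have hthx₁ : m.tgt.h (X x₁) ≠ 0 := by
    intro h
    have a1 := hlow' x₁ hx₁ u₁ hu₁
    have a2 := hlow' x₁ hx₁ u₂ (hVs h2)
    rw [h, (hHK u₁ h1).2] at a1
    rw [h, (hHK u₂ h2).2] at a2
    have b1 : m.src.h x₁ * u₁ * X' x₁ + X'' x₁ = 0 := by
      refine mul_left_cancel₀ (mul_ne_zero hg0 hH1) ?_
      linear_combination a1
    have b2 : m.src.h x₁ * u₂ * X' x₁ + X'' x₁ = 0 := by
      refine mul_left_cancel₀ (mul_ne_zero hg0 hH2) ?_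
      linear_combination a2
    have b3 : m.src.h x₁ * X' x₁ * (u₁ - u₂) = 0 := by linear_combination b1 - b2
    exact mul_ne_zero (mul_ne_zero hhx₁ (hX'0 x₁ hx₁)) (by linarith) b3
  have hX'1 := hX'0 x₁ hx₁
  -- The coefficients found by solving the lower-order relation at `x₁` for the new K.
  obtain ⟨A, hA⟩ : ∃ A, A = g * m.src.h x₁ / (m.tgt.h (X x₁) * X' x₁) := ⟨_, rfl⟩
  obtain ⟨B, hB⟩ : ∃ B, B = g * X'' x₁ / (m.tgt.h (X x₁) * X' x₁ ^ 2) := ⟨_, rfl⟩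
  have hA0 : A ≠ 0 := by
    rw [hA]
    positivity
  have hK : ∀ u ∈ m.src.udom, m.tgt.K (e₆ * u + e₃) = A * m.src.K u + B * m.src.H u := by
    intro u hu
    have a1 := hlow' x₁ hx₁ u hu
    rw [hA, hB]
    field_simp
    linear_combination -a1
  -- On `V`, K = uH, so after division by H the relation is affine in u; its values at two points
  -- separate the coefficients.
  have hAB : ∀ x ∈ m.src.xdom, g * m.src.h x = m.tgt.h (X x) * X' x * A ∧
      g * X'' x = m.tgt.h (X x) * X' x ^ 2 * B := by
    intro x hx
    have a1 := hlow' x hx u₁ hu₁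
    have a2 := hlow' x hx u₂ (hVs h2)
    rw [hK u₁ hu₁, (hHK u₁ h1).2] at a1
    rw [hK u₂ (hVs h2), (hHK u₂ h2).2] at a2
    have b1 : g * (m.src.h x * u₁ * X' x + X'' x) = m.tgt.h (X x) * (A * u₁ + B) * X' x ^ 2 := by
      refine mul_left_cancel₀ hH1 ?_
      linear_combination a1
    have b2 : g * (m.src.h x * u₂ * X' x + X'' x) = m.tgt.h (X x) * (A * u₂ + B) * X' x ^ 2 := by
      refine mul_left_cancel₀ hH2 ?_
      linear_combination a2
    have b3 : g * m.src.h x = m.tgt.h (X x) * X' x * A := by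
      refine mul_left_cancel₀ (mul_ne_zero (hX'0 x hx) (by linarith : u₁ - u₂ ≠ 0)) ?_
      linear_combination b1 - b2
    refine ⟨b3, ?_⟩
    linear_combination b1 - u₁ * X' x * b3
  -- Eliminating the new h gives a linear equation for X', whose solutions are multiples of e^{ε₉η}
  -- with ε₉ = B/A.
  have hX'' : ∀ x ∈ m.src.xdom, X'' x = B / A * m.src.h x * X' x := by
    intro x hx
    obtain ⟨a1, a2⟩ := hAB x hx
    have a3 : X'' x * A = B * m.src.h x * X' x := by
      refine mul_left_cancel₀ hg0 ?_
      linear_combination A * a2 - X' x * B * a1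
    field_simp
    linear_combination a3
  obtain ⟨η, -, hη⟩ := hθ.exists_antideriv hx₁ 0
  obtain ⟨e₅, he₅⟩ : ∃ e, e = X' x₁ * Real.exp (-(B / A * η x₁)) := ⟨_, rfl⟩
  have he₅0 : e₅ ≠ 0 := by
    rw [he₅]
    exact mul_ne_zero hX'1 (Real.exp_pos _).ne'
  have hX' : ∀ x ∈ m.src.xdom, X' x = e₅ * Real.exp (B / A * η x) := by
    intro x hx
    have h : X' x * Real.exp (-(B / A * η x)) = e₅ := by
      rw [he₅]
      refine hθ.xdom_interval.eq_of_hasDerivAt_zero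
        (g := fun x => X' x * Real.exp (-(B / A * η x))) (fun y hy => ?_) hx hx₁
      refine ((dX' y hy).mul ((hη y hy).const_mul (B / A)).fun_neg.exp).congr_deriv ?_
      rw [hX'' y hy]
      ring
    rw [← h, mul_assoc, ← Real.exp_add]
    simp
  refine ⟨⟨m.T (t₁, x₁, u₁) - e₄ * t₁, 0, e₃, e₄, e₅, e₆, g / e₅, A, B / A⟩, η, fun x => X x / e₅,
    ?_, hθ, hm.isPointTransf.tdom_interval, hη, ?_, ?_, ?_, ?_, ?_, ?_⟩
  · simp only [Params.Nondegenerate]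
    positivity
  · intro x hx
    refine ((dX x hx).div_const e₅).congr_deriv ?_
    simp only [hX' x hx]
    field_simp
  · intro t ht x hx u hu
    change (m.T (t, x, u), m.X (t, x, u), m.U (t, x, u)) = _
    rw [hT t ht x hx u hu, hX t ht x hx u hu, hU t ht x hx u hu]
    simp only [mul_div_cancel₀ _ he₅0, add_zero]
    rfl
  · rw [← hm.isPointTransf.image_x]
    ext y
    simp only [mul_div_cancel₀ _ he₅0, add_zero]
    constructor
    · rintro ⟨⟨t, x, u⟩, ⟨ht, hx, hu⟩, rfl⟩
      exact ⟨x, hx, (hX t ht x hx u hu).symm⟩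
    · rintro ⟨x, hx, rfl⟩
      exact ⟨(t₁, x, u₁), mem ht₁ hx hu₁, rfl⟩
  · rw [← hm.isPointTransf.image_u]
    ext y
    constructor
    · rintro ⟨⟨t, x, u⟩, ⟨ht, hx, hu⟩, rfl⟩
      exact ⟨u, hu, (hU t ht x hx u hu).symm⟩
    · rintro ⟨u, hu, rfl⟩
      exact ⟨(t₁, x₁, u), mem ht₁ hx₁ hu, hU t₁ ht₁ x₁ hx₁ u hu⟩
  · intro x hx
    simp only [mul_div_cancel₀ _ he₅0, add_zero]
    have hE := (Real.exp_pos (B / A * η x)).ne'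
    have a1 := hgf x hx
    have a2 := (hAB x hx).1
    rw [hX' x hx] at a1 a2
    constructor
    · rw [show -2 * (B / A) * η x = -(B / A * η x) + -(B / A * η x) by ring, Real.exp_add,
        Real.exp_neg]
      generalize Real.exp (B / A * η x) = E at *
      field_simp
      linear_combination a1
    · rw [show -(B / A) * η x = -(B / A * η x) by ring, Real.exp_neg]
      generalize Real.exp (B / A * η x) = E at *
      field_simp
      linear_combination -a2
  · intro u hu
    simp only [hgH u hu, hK u hu]
    constructor <;> field_simp

end Transf.IsAdmissible

end TelegraphG1

namespace TelegraphG1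

/-! ### Generic continuation of a tuple -/

namespace ArbElts.InClass

variable {θ : ArbElts}

/-- A nonvanishing continuous function on an interval keeps its sign. This permits interpolation
between H and a function of the same sign without creating zeros. -/
lemma H_mul_pos (hθ : θ.InClass) {u v : ℝ} (hu : u ∈ θ.udom) (hv : v ∈ θ.udom) :
    0 < θ.H u * θ.H v := by
  by_contra! hle
  have himg := hθ.udom_interval.isPreconnected.image _ hθ.smooth_H.continuousOn
  have h0 : (0 : ℝ) ∈ θ.H '' θ.udom := by
    rcases mul_nonpos_iff.1 hle with ⟨h1, h2⟩ | ⟨h1, h2⟩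
    · exact himg.ordConnected.out (mem_image_of_mem _ hv) (mem_image_of_mem _ hu) ⟨h2, h1⟩
    · exact himg.ordConnected.out (mem_image_of_mem _ hu) (mem_image_of_mem _ hv) ⟨h1, h2⟩
  obtain ⟨w, hw, hw0⟩ := h0
  exact hθ.H_ne_zero w hw hw0

/-- A tuple can be modified for `x > a` and `u > b` so that it becomes generic. -/
lemma exists_generic (hθ : θ.InClass) {a b : ℝ} (ha : a ∈ θ.xdom) (hb : b ∈ θ.udom) :
    ∃ θ' : ArbElts, θ'.InClass ∧ θ'.IsGeneric ∧ θ'.xdom = θ.xdom ∧ θ'.udom = θ.udom ∧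
      θ.AgreeOn θ' (θ.xdom ∩ Iio a) (θ.udom ∩ Iio b) := by
  obtain ⟨c, hc, hac⟩ := hθ.xdom_interval.exists_gt_mem ha
  obtain ⟨d, hd, hbd⟩ := hθ.udom_interval.exists_gt_mem hb
  obtain ⟨d', hd', hdd'⟩ := hθ.udom_interval.exists_gt_mem hd
  let ψ : ℝ → ℝ → ℝ → ℝ := fun a c x => Real.smoothTransition ((x - a) / (c - a))
  have hψ : ∀ a c, ContDiff ℝ ∞ (ψ a c) := fun a c =>
    Real.smoothTransition.contDiff.comp (by fun_prop)
  have hψ0 : ∀ {a c x}, a < c → x < a → ψ a c x = 0 := fun hac hx =>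
    Real.smoothTransition.zero_of_nonpos
      (div_nonpos_of_nonpos_of_nonneg (by linarith) (by linarith))
  have hψ1 : ∀ {a c x}, a < c → c ≤ x → ψ a c x = 1 := fun hac hx =>
    Real.smoothTransition.one_of_one_le ((one_le_div (by linarith)).2 (by linarith))
  -- The factor H(b) gives `G` the sign of H.
  let G : ℝ → ℝ := fun u => θ.H b * Real.exp (u ^ 2)
  have hG : ContDiff ℝ ∞ G := by fun_prop
  let θ' : ArbElts := ⟨θ.xdom, θ.udom, θ.f, fun x => (1 - ψ a c x) * θ.h x + ψ a c x,
    fun u => (1 - ψ b d u) * θ.H u + ψ b d u * G u,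
    fun u => (1 - ψ b d u) * θ.K u + ψ b d u * (u * G u)⟩
  have hV : IsOpenInterval (θ.udom ∩ Ioi d) :=
    ⟨hθ.udom_interval.1.inter isOpen_Ioi, ⟨d', hd', hdd'⟩,
      hθ.udom_interval.2.2.inter ordConnected_Ioi⟩
  have hVH : ∀ u ∈ θ.udom ∩ Ioi d, θ'.H u = θ.H b * Real.exp (u ^ 2) := by
    rintro u ⟨-, hu⟩
    simp only [θ', hψ1 hbd (le_of_lt hu), G]
    ring
  have hVK : ∀ u ∈ θ.udom ∩ Ioi d, θ'.K u = u * θ'.H u := by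
    rintro u hu
    rw [hVH u hu]
    simp only [θ', hψ1 hbd (le_of_lt hu.2), G]
    ring
  have hHne : ∀ u ∈ θ'.udom, θ'.H u ≠ 0 := by
    intro u hu h0
    have h1 : 0 < θ.H b * θ.H u := hθ.H_mul_pos hb hu
    have h2 : 0 < θ.H b * G u := by
      have := hθ.H_mul_pos hb hb
      have := Real.exp_pos (u ^ 2)
      simp only [G]
      rw [← mul_assoc]
      positivity
    have h3 : 0 ≤ ψ b d u := Real.smoothTransition.nonneg _
    have h4 : ψ b d u ≤ 1 := Real.smoothTransition.le_one _
    have h5 : (1 - ψ b d u) * (θ.H b * θ.H u) + ψ b d u * (θ.H b * G u) = 0 := by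
      linear_combination θ.H b * h0
    have h6 : 0 ≤ (1 - ψ b d u) * (θ.H b * θ.H u) := mul_nonneg (by linarith) h1.le
    have h7 : 0 ≤ ψ b d u * (θ.H b * G u) := mul_nonneg h3 h2.le
    have h8 : ψ b d u = 0 := by
      have : ψ b d u * (θ.H b * G u) = 0 := by linarith
      exact (mul_eq_zero.1 this).resolve_right h2.ne'
    rw [h8] at h5
    linarith
  refine ⟨θ', ⟨hθ.xdom_interval, hθ.udom_interval, hθ.smooth_f, ?_, ?_, ?_, hθ.f_ne_zero, hHne, ?_⟩,
    ⟨⟨c, hc, ?_⟩, θ.udom ∩ Ioi d, θ.H b, hV, inter_subset_left, hθ.H_ne_zero b hb,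
      fun u hu => ⟨hVH u hu, hVK u hu⟩⟩, rfl, rfl, ?_, ?_⟩
  · exact ((contDiff_const.sub (hψ a c)).contDiffOn.mul hθ.smooth_h).add (hψ a c).contDiffOn
  · exact ((contDiff_const.sub (hψ b d)).contDiffOn.mul hθ.smooth_H).add
      ((hψ b d).mul hG).contDiffOn
  · exact ((contDiff_const.sub (hψ b d)).contDiffOn.mul hθ.smooth_K).add
      ((hψ b d).mul (contDiff_id.mul hG)).contDiffOn
  -- The derivative of the new H beyond `d` is 2uH, so the point u = 0 has to be avoided.
  · obtain ⟨u, hu, hu0⟩ : ∃ u ∈ θ.udom ∩ Ioi d, u ≠ 0 := by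
      obtain ⟨u₁, h1, u₂, h2, -, -, h12, -⟩ := hV.exists_three
      by_cases h : u₁ = 0
      · exact ⟨u₂, h2, by linarith⟩
      · exact ⟨u₁, h1, h⟩
    refine ⟨u, hu.1, Or.inl ?_⟩
    rw [hasDerivAt_exp_sq hV hVH hu]
    exact mul_ne_zero (mul_ne_zero two_ne_zero hu0) (hHne u hu.1)
  · simp only [θ', hψ1 hac le_rfl]
    norm_num
  · rintro x ⟨-, hx⟩
    simp [θ', hψ0 hac hx]
  · rintro u ⟨-, hu⟩
    simp [θ', hψ0 hbd hu]

end ArbElts.InClass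

/-! ### Gluing the constants -/

/-- `m` has the form with constants `c` for `x < a` and `u < b`. -/
structure Transf.HasLocalForm (m : Transf) (c : Params) (η ξ : ℝ → ℝ) (a b : ℝ) : Prop where
  φ_eq : ∀ t ∈ m.tdom, ∀ x ∈ m.src.xdom, x < a → ∀ u ∈ m.src.udom, u < b →
    m.φ (t, x, u) = (c.ε₄ * t + c.ε₁, c.ε₅ * ξ x + c.ε₂, c.ε₆ * u + c.ε₃)
  fh_eq : ∀ x ∈ m.src.xdom, x < a →
    m.tgt.f (c.ε₅ * ξ x + c.ε₂)
      = c.ε₄ ^ 2 * c.ε₅⁻¹ * c.ε₇ * m.src.f x * Real.exp (-2 * c.ε₉ * η x) ∧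
    m.tgt.h (c.ε₅ * ξ x + c.ε₂)
      = c.ε₇ * c.ε₈⁻¹ * m.src.h x * Real.exp (-c.ε₉ * η x)
  HK_eq : ∀ u ∈ m.src.udom, u < b →
    m.tgt.H (c.ε₆ * u + c.ε₃) = c.ε₅ * c.ε₇ * m.src.H u ∧
    m.tgt.K (c.ε₆ * u + c.ε₃) = c.ε₈ * (m.src.K u + c.ε₉ * m.src.H u)

namespace Transf.HasLocalForm

variable {m : Transf} {c : Params} {η ξ : ℝ → ℝ} {a b a' b' : ℝ}

lemma mono (h : m.HasLocalForm c η ξ a b) (ha : a' ≤ a) (hb : b' ≤ b) :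
    m.HasLocalForm c η ξ a' b' :=
  ⟨fun t ht x hx hxa u hu hub => h.φ_eq t ht x hx (hxa.trans_le ha) u hu (hub.trans_le hb),
    fun x hx hxa => h.fh_eq x hx (hxa.trans_le ha), fun u hu hub => h.HK_eq u hu (hub.trans_le hb)⟩

/-- The boxes x < a, u < b with a, b in the open intervals exhaust the domain, so a form valid with
the same constants on all large boxes is global. -/
lemma hasForm (hm : m.IsAdmissible) (hη : ∀ x ∈ m.src.xdom, HasDerivAt η (m.src.h x) x)
    (hξ : ∀ x ∈ m.src.xdom, HasDerivAt ξ (Real.exp (c.ε₉ * η x)) x) {a₀ b₀ : ℝ}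
    (ha₀ : a₀ ∈ m.src.xdom) (hb₀ : b₀ ∈ m.src.udom)
    (h : ∀ a ∈ m.src.xdom, ∀ b ∈ m.src.udom, a₀ ≤ a → b₀ ≤ b → m.HasLocalForm c η ξ a b) :
    m.HasForm c η ξ := by
  have hθ := hm.src_inClass
  have hxa : ∀ x ∈ m.src.xdom, ∃ a ∈ m.src.xdom, a₀ ≤ a ∧ x < a := by
    intro x hx
    rcases lt_or_ge x a₀ with h | h
    · exact ⟨a₀, ha₀, le_rfl, h⟩
    · obtain ⟨a, ha, hxa⟩ := hθ.xdom_interval.exists_gt_mem hx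
      exact ⟨a, ha, h.trans hxa.le, hxa⟩
  have hub : ∀ u ∈ m.src.udom, ∃ b ∈ m.src.udom, b₀ ≤ b ∧ u < b := by
    intro u hu
    rcases lt_or_ge u b₀ with h | h
    · exact ⟨b₀, hb₀, le_rfl, h⟩
    · obtain ⟨b, hb, hub⟩ := hθ.udom_interval.exists_gt_mem hu
      exact ⟨b, hb, h.trans hub.le, hub⟩
  have hφ : ∀ t ∈ m.tdom, ∀ x ∈ m.src.xdom, ∀ u ∈ m.src.udom,
      m.φ (t, x, u) = (c.ε₄ * t + c.ε₁, c.ε₅ * ξ x + c.ε₂, c.ε₆ * u + c.ε₃) := by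
    intro t ht x hx u hu
    obtain ⟨a, ha, haa, hxa⟩ := hxa x hx
    obtain ⟨b, hb, hbb, hub⟩ := hub u hu
    exact (h a ha b hb haa hbb).φ_eq t ht x hx hxa u hu hub
  obtain ⟨t₁, ht₁⟩ := hm.isPointTransf.tdom_interval.2.1
  refine ⟨hθ, hm.isPointTransf.tdom_interval, hη, hξ, hφ, ?_, ?_, ?_, ?_⟩
  · rw [← hm.isPointTransf.image_x]
    ext y
    constructor
    · rintro ⟨⟨t, x, u⟩, ⟨ht, hx, hu⟩, rfl⟩
      exact ⟨x, hx, by simp only [hφ t ht x hx u hu]⟩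
    · rintro ⟨x, hx, rfl⟩
      exact ⟨(t₁, x, b₀), ⟨ht₁, hx, hb₀⟩, by simp only [hφ t₁ ht₁ x hx b₀ hb₀]⟩
  · rw [← hm.isPointTransf.image_u]
    ext y
    constructor
    · rintro ⟨⟨t, x, u⟩, ⟨ht, hx, hu⟩, rfl⟩
      exact ⟨u, hu, by simp only [hφ t ht x hx u hu]⟩
    · rintro ⟨u, hu, rfl⟩
      exact ⟨(t₁, a₀, u), ⟨ht₁, ha₀, hu⟩, by simp only [hφ t₁ ht₁ a₀ ha₀ u hu]⟩
  · intro x hx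
    obtain ⟨a, ha, haa, hxa⟩ := hxa x hx
    exact (h a ha b₀ hb₀ haa le_rfl).fh_eq x hx hxa
  · intro u hu
    obtain ⟨b, hb, hbb, hub⟩ := hub u hu
    exact (h a₀ ha₀ b hb le_rfl hbb).HK_eq u hu hub

end Transf.HasLocalForm

/-- Each value of an extended equivalence transformation has locally the required form, with
antiderivatives vanishing at a given point. -/
lemma IsExtendedEquivalence.exists_hasLocalForm {𝒯 : Set Transf} (h𝒯 : IsExtendedEquivalence 𝒯)
    {m : Transf} (hm : m ∈ 𝒯) {x₀ u₀ : ℝ} {η : ℝ → ℝ} {Ξ : ℝ → ℝ → ℝ} (hx₀ : x₀ ∈ m.src.xdom)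
    (hu₀ : u₀ ∈ m.src.udom) (hη₀ : η x₀ = 0)
    (hη : ∀ x ∈ m.src.xdom, HasDerivAt η (m.src.h x) x) (hΞ₀ : ∀ k, Ξ k x₀ = 0)
    (hΞ : ∀ k, ∀ x ∈ m.src.xdom, HasDerivAt (Ξ k) (Real.exp (k * η x)) x)
    {a b : ℝ} (ha : a ∈ m.src.xdom) (hb : b ∈ m.src.udom) (hxa : x₀ < a) (hub : u₀ < b) :
    ∃ c : Params, c.Nondegenerate ∧ m.HasLocalForm c η (Ξ c.ε₉) a b := by
  have hadm := h𝒯.admissible m hm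
  have hθ := hadm.src_inClass
  obtain ⟨θ', hθ', hgen, hxd, hud, hag⟩ := hθ.exists_generic ha hb
  have hA : IsOpenInterval (m.src.xdom ∩ Iio a) :=
    ⟨hθ.xdom_interval.1.inter isOpen_Iio, ⟨x₀, hx₀, hxa⟩,
      hθ.xdom_interval.2.2.inter ordConnected_Iio⟩
  have hB : IsOpenInterval (m.src.udom ∩ Iio b) :=
    ⟨hθ.udom_interval.1.inter isOpen_Iio, ⟨u₀, hu₀, hub⟩,
      hθ.udom_interval.2.2.inter ordConnected_Iio⟩
  -- The tuple is changed only outside the box, so the value `m'` at the generic tuple coincides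
  -- with `m` over the box.
  obtain ⟨m', hm', hsrc, htd, hco⟩ := h𝒯.continuation m hm θ' hθ' _ _ hA hB
    (by rw [hxd]; exact fun x hx => ⟨hx.1, hx.1⟩) (by rw [hud]; exact fun x hx => ⟨hx.1, hx.1⟩) hag
  obtain ⟨c, η', ξ', hc, hform⟩ := (h𝒯.admissible m' hm').exists_hasForm (hsrc ▸ hgen)
  subst hsrc
  obtain ⟨h4, h5, h6, h7, h8⟩ := hc.ne
  have hηA : ∀ x ∈ m.src.xdom ∩ Iio a, η' x = η x + η' x₀ := by
    intro x hx
    have := hA.sub_eq_sub_of_hasDerivAt (g := η') (k := η) (d := m.src.h)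
      (fun s hs => (hag.1 s hs).2 ▸ hform.deriv_η s (hxd ▸ hs.1)) (fun s hs => hη s hs.1)
      ⟨hx₀, hxa⟩ hx
    linarith
  set E := Real.exp (c.ε₉ * η' x₀) with hE
  have hE0 : E ≠ 0 := (Real.exp_pos _).ne'
  have hξA : ∀ x ∈ m.src.xdom ∩ Iio a, ξ' x = E * Ξ c.ε₉ x + ξ' x₀ := by
    intro x hx
    have := hA.sub_eq_sub_of_hasDerivAt (g := ξ') (k := fun x => E * Ξ c.ε₉ x)
      (d := fun x => E * Real.exp (c.ε₉ * η x))
      (fun s hs => (hform.deriv_ξ s (hxd ▸ hs.1)).congr_deriv (by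
        rw [hηA s hs, mul_add, Real.exp_add, hE]
        ring)) (fun s hs => (hΞ c.ε₉ s hs.1).const_mul E) ⟨hx₀, hxa⟩ hx
    rw [hΞ₀] at this
    linarith
  have eX : ∀ x ∈ m.src.xdom ∩ Iio a,
      c.ε₅ * E * Ξ c.ε₉ x + (c.ε₂ + c.ε₅ * ξ' x₀) = c.ε₅ * ξ' x + c.ε₂ := by
    intro x hx
    rw [hξA x hx]
    ring
  have hco' : ∀ t ∈ m.tdom, ∀ x ∈ m.src.xdom ∩ Iio a, ∀ u ∈ m.src.udom ∩ Iio b,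
      m.φ (t, x, u) = (c.ε₄ * t + c.ε₁, c.ε₅ * ξ' x + c.ε₂, c.ε₆ * u + c.ε₃) ∧
      m.tgt.f (c.ε₅ * ξ' x + c.ε₂) = m'.tgt.f (c.ε₅ * ξ' x + c.ε₂) ∧
      m.tgt.h (c.ε₅ * ξ' x + c.ε₂) = m'.tgt.h (c.ε₅ * ξ' x + c.ε₂) ∧
      m.tgt.H (c.ε₆ * u + c.ε₃) = m'.tgt.H (c.ε₆ * u + c.ε₃) ∧
      m.tgt.K (c.ε₆ * u + c.ε₃) = m'.tgt.K (c.ε₆ * u + c.ε₃) := by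
    intro t ht x hx u hu
    obtain ⟨e1, e2, e3, e4, e5⟩ := hco (t, x, u) ⟨ht, hx, hu⟩
    have e6 := hform.φ_eq t (htd ▸ ht) x (hxd ▸ hx.1) u (hud ▸ hu.1)
    rw [← e1, e6] at e2 e3 e4 e5
    exact ⟨e1.symm.trans e6, e2.symm, e3.symm, e4.symm, e5.symm⟩
  obtain ⟨t₁, ht₁⟩ := hadm.isPointTransf.tdom_interval.2.1
  -- Renormalising the antiderivatives at `x₀` scales ξ by E, shifts it, and divides e^{ε₉η} by E;
  -- the constants ε₂, ε₅ and ε₇ compensate for this.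
  refine ⟨⟨c.ε₁, c.ε₂ + c.ε₅ * ξ' x₀, c.ε₃, c.ε₄, c.ε₅ * E, c.ε₆, c.ε₇ * E⁻¹, c.ε₈, c.ε₉⟩, ?_,
    ?_, ?_, ?_⟩
  · simp only [Params.Nondegenerate]
    positivity
  · intro t ht x hx hxa u hu hub
    simp only [eX x ⟨hx, hxa⟩]
    exact (hco' t ht x ⟨hx, hxa⟩ u ⟨hu, hub⟩).1
  · intro x hx hxa
    have e := hco' t₁ ht₁ x ⟨hx, hxa⟩ u₀ ⟨hu₀, hub⟩
    have e' := hform.fh_eq x (hxd ▸ hx)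
    rw [(hag.1 x ⟨hx, hxa⟩).1, (hag.1 x ⟨hx, hxa⟩).2, hηA x ⟨hx, hxa⟩] at e'
    simp only [eX x ⟨hx, hxa⟩]
    rw [e.2.1, e.2.2.1, e'.1, e'.2]
    constructor
    · rw [show -2 * c.ε₉ * (η x + η' x₀) = -2 * c.ε₉ * η x + -(c.ε₉ * η' x₀) + -(c.ε₉ * η' x₀)
        by ring, Real.exp_add, Real.exp_add, Real.exp_neg, ← hE]
      field_simp
    · rw [show -c.ε₉ * (η x + η' x₀) = -c.ε₉ * η x + -(c.ε₉ * η' x₀) by ring, Real.exp_add,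
        Real.exp_neg, ← hE]
      field_simp
  · intro u hu hub
    have e := hco' t₁ ht₁ x₀ ⟨hx₀, hxa⟩ u ⟨hu, hub⟩
    have e' := hform.HK_eq u (hud ▸ hu)
    rw [(hag.2 u ⟨hu, hub⟩).1, (hag.2 u ⟨hu, hub⟩).2] at e'
    simp only
    rw [e.2.2.2.1, e.2.2.2.2, e'.1, e'.2]
    refine ⟨?_, rfl⟩
    field_simp

/-- The constants `ε₁, …, ε₇` of a local form are determined. -/
lemma Transf.HasLocalForm.params_eq {m : Transf} (hm : m.IsAdmissible) {c d : Params}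
    (hc : c.Nondegenerate) {x₀ u₀ : ℝ} {η : ℝ → ℝ} {Ξ : ℝ → ℝ → ℝ}
    (hx₀ : x₀ ∈ m.src.xdom) (hu₀ : u₀ ∈ m.src.udom) (hη₀ : η x₀ = 0) (hΞ₀ : ∀ k, Ξ k x₀ = 0)
    (hΞ : ∀ k, ∀ x ∈ m.src.xdom, HasDerivAt (Ξ k) (Real.exp (k * η x)) x)
    {a b : ℝ} (hxa : x₀ < a) (hub : u₀ < b)
    (h : m.HasLocalForm c η (Ξ c.ε₉) a b) (h' : m.HasLocalForm d η (Ξ d.ε₉) a b) :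
    (c.ε₁ = d.ε₁ ∧ c.ε₂ = d.ε₂ ∧ c.ε₃ = d.ε₃ ∧ c.ε₄ = d.ε₄ ∧ c.ε₅ = d.ε₅ ∧ c.ε₆ = d.ε₆ ∧
      c.ε₇ = d.ε₇) ∧
    (∀ x ∈ m.src.xdom, x < a → Real.exp (c.ε₉ * η x) = Real.exp (d.ε₉ * η x)) := by
  obtain ⟨h4, h5, h6, h7, h8⟩ := hc.ne
  have hθ := hm.src_inClass
  obtain ⟨t₁, ht₁⟩ := hm.isPointTransf.tdom_interval.2.1
  obtain ⟨t₂, ht₂, ht⟩ := hm.isPointTransf.tdom_interval.exists_gt_mem ht₁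
  -- The second value of u is taken below `u₀` so that it stays in the box; two values fix an affine
  -- function.
  obtain ⟨u₁, hu₁, hu⟩ := hθ.udom_interval.exists_lt_mem hu₀
  have eq := fun t ht x hx hxa u hu hub =>
    (h.φ_eq t ht x hx hxa u hu hub).symm.trans (h'.φ_eq t ht x hx hxa u hu hub)
  simp only [Prod.mk.injEq] at eq
  obtain ⟨p1, p2, p3⟩ := eq t₁ ht₁ x₀ hx₀ hxa u₀ hu₀ hub
  obtain ⟨q1, -, -⟩ := eq t₂ ht₂ x₀ hx₀ hxa u₀ hu₀ hub
  obtain ⟨-, -, r3⟩ := eq t₁ ht₁ x₀ hx₀ hxa u₁ hu₁ (hu.trans hub)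
  rw [hΞ₀, hΞ₀, mul_zero, mul_zero, zero_add, zero_add] at p2
  have e4 : c.ε₄ = d.ε₄ := by
    have : (c.ε₄ - d.ε₄) * (t₂ - t₁) = 0 := by linear_combination q1 - p1
    have := (mul_eq_zero.1 this).resolve_right (by linarith)
    linarith
  have e6 : c.ε₆ = d.ε₆ := by
    have : (c.ε₆ - d.ε₆) * (u₀ - u₁) = 0 := by linear_combination p3 - r3
    have := (mul_eq_zero.1 this).resolve_right (by linarith)
    linarith
  have e1 : c.ε₁ = d.ε₁ := by
    rw [e4] at p1
    linarith
  have e3 : c.ε₃ = d.ε₃ := by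
    rw [e6] at p3
    linarith
  have hd : ∀ x ∈ m.src.xdom, x < a →
      c.ε₅ * Real.exp (c.ε₉ * η x) = d.ε₅ * Real.exp (d.ε₉ * η x) := by
    intro x hx hxa
    refine ((hΞ c.ε₉ x hx).const_mul c.ε₅).unique
      (((hΞ d.ε₉ x hx).const_mul d.ε₅).congr_of_eventuallyEq ?_)
    filter_upwards [hθ.xdom_interval.mem_nhds hx, Iio_mem_nhds hxa] with y hy hya
    have := (eq t₁ ht₁ y hy hya u₀ hu₀ hub).2.1
    rw [p2] at this
    linarith
  -- At `x₀` both exponentials equal 1.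
  have e5 : c.ε₅ = d.ε₅ := by
    have := hd x₀ hx₀ hxa
    simpa [hη₀] using this
  have e7 : c.ε₇ = d.ε₇ := by
    have g1 := (h.HK_eq u₀ hu₀ hub).1
    rw [e6, e3, (h'.HK_eq u₀ hu₀ hub).1, e5] at g1
    exact (mul_left_cancel₀ (e5 ▸ h5) (mul_right_cancel₀ (hθ.H_ne_zero u₀ hu₀) g1)).symm
  refine ⟨⟨e1, p2, e3, e4, e5, e6, e7⟩, fun x hx hxa => ?_⟩
  have := hd x hx hxa
  rw [e5] at this
  exact mul_left_cancel₀ (e5 ▸ h5) this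

lemma Params.ext_of_eq {c d : Params} (h : c.ε₁ = d.ε₁ ∧ c.ε₂ = d.ε₂ ∧ c.ε₃ = d.ε₃ ∧
    c.ε₄ = d.ε₄ ∧ c.ε₅ = d.ε₅ ∧ c.ε₆ = d.ε₆ ∧ c.ε₇ = d.ε₇) (h8 : c.ε₈ = d.ε₈)
    (h9 : c.ε₉ = d.ε₉) : c = d := by
  obtain ⟨h1, h2, h3, h4, h5, h6, h7⟩ := h
  cases c
  cases d
  simp_all

/-- Each value of an extended equivalence transformation belongs to the family. -/
theorem IsExtendedEquivalence.exists_mem_transformation {𝒯 : Set Transf}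
    (h𝒯 : IsExtendedEquivalence 𝒯) {m : Transf} (hm : m ∈ 𝒯) :
    ∃ c : Params, c.Nondegenerate ∧ m ∈ transformation c := by
  have hadm := h𝒯.admissible m hm
  have hθ := hadm.src_inClass
  obtain ⟨x₀, hx₀⟩ := hθ.xdom_interval.2.1
  obtain ⟨u₀, hu₀⟩ := hθ.udom_interval.2.1
  obtain ⟨η, hη₀, hη⟩ := hθ.exists_antideriv hx₀ 0
  have hηc := (hθ.contDiffOn_antideriv hη).continuousOn
  have hex : ∀ k : ℝ, ∃ ξ : ℝ → ℝ, ξ x₀ = 0 ∧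
      ∀ x ∈ m.src.xdom, HasDerivAt ξ (Real.exp (k * η x)) x := fun k =>
    hθ.xdom_interval.exists_antideriv (h := fun x => Real.exp (k * η x))
      (Real.continuous_exp.comp_continuousOn (continuousOn_const.mul hηc)) hx₀ 0
  choose Ξ hΞ₀ hΞ using hex
  have loc : ∀ a ∈ m.src.xdom, ∀ b ∈ m.src.udom, x₀ < a → u₀ < b →
      ∃ c : Params, c.Nondegenerate ∧ m.HasLocalForm c η (Ξ c.ε₉) a b := fun a ha b hb hxa hub =>
    h𝒯.exists_hasLocalForm hm hx₀ hu₀ hη₀ hη hΞ₀ hΞ ha hb hxa hub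
  obtain ⟨a₁, ha₁, hxa₁⟩ := hθ.xdom_interval.exists_gt_mem hx₀
  obtain ⟨b₁, hb₁, hub₁⟩ := hθ.udom_interval.exists_gt_mem hu₀
  -- it suffices to show that the constants are determined on large boxes
  have finish : ∀ a₀ ∈ m.src.xdom, ∀ b₀ ∈ m.src.udom, x₀ < a₀ → u₀ < b₀ →
      (∀ c d : Params, c.Nondegenerate → d.Nondegenerate → m.HasLocalForm c η (Ξ c.ε₉) a₀ b₀ →
        m.HasLocalForm d η (Ξ d.ε₉) a₀ b₀ → c = d) →
      ∃ c : Params, c.Nondegenerate ∧ m ∈ transformation c := by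
    intro a₀ ha₀ b₀ hb₀ hxa hub huniq
    obtain ⟨c, hc, hloc⟩ := loc a₀ ha₀ b₀ hb₀ hxa hub
    refine ⟨c, hc, mem_transformation_iff.2 ⟨η, Ξ c.ε₉,
      Transf.HasLocalForm.hasForm hadm hη (hΞ _) ha₀ hb₀ fun a ha b hb haa hbb => ?_⟩⟩
    obtain ⟨d, hd, hloc'⟩ := loc a ha b hb (hxa.trans_le haa) (hub.trans_le hbb)
    rwa [huniq c d hc hd hloc (hloc'.mono haa hbb)]
  have above : ∀ {S : Set ℝ}, IsOpenInterval S → ∀ x ∈ S, ∀ y ∈ S, ∃ z ∈ S, x < z ∧ y < z := by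
    intro S hS x hx y hy
    obtain ⟨z, hz, hxz⟩ := hS.exists_gt_mem hx
    obtain ⟨w, hw, hyw⟩ := hS.exists_gt_mem hy
    rcases le_total z w with h | h
    · exact ⟨w, hw, hxz.trans_le h, hyw⟩
    · exact ⟨z, hz, hxz, hyw.trans_le h⟩
  -- If η is not identically zero, the value of e^{ε₉η} at a point with η ≠ 0 fixes ε₉, and the
  -- formula for the new h at a point with h ≠ 0 fixes ε₈; the box must contain both points.
  by_cases hcase : ∃ x ∈ m.src.xdom, η x ≠ 0
  · obtain ⟨x₂, hx₂, hηx₂⟩ := hcase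
    obtain ⟨x₁, hx₁, hhx₁⟩ : ∃ x ∈ m.src.xdom, m.src.h x ≠ 0 := by
      by_contra! hz
      refine hηx₂ (hη₀ ▸ hθ.xdom_interval.eq_of_hasDerivAt_zero (fun s hs => ?_) hx₂ hx₀)
      simpa [hz s hs] using hη s hs
    obtain ⟨a₂, ha₂, hxa₂, hx₂a₂⟩ := above hθ.xdom_interval _ ha₁ _ hx₂
    obtain ⟨a₀, ha₀, haa₀, hx₁a₀⟩ := above hθ.xdom_interval _ ha₂ _ hx₁
    have hxa₀ : x₀ < a₀ := by linarith
    refine finish a₀ ha₀ b₁ hb₁ hxa₀ hub₁ fun c d hc hd h h' => ?_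
    obtain ⟨he, hexp⟩ := h.params_eq hadm hc hx₀ hu₀ hη₀ hΞ₀ hΞ hxa₀ hub₁ h'
    have e9 : c.ε₉ = d.ε₉ :=
      mul_right_cancel₀ hηx₂ (Real.exp_injective (hexp x₂ hx₂ (by linarith)))
    refine Params.ext_of_eq he ?_ e9
    have g1 := (h.fh_eq x₁ hx₁ hx₁a₀).2
    have g2 := (h'.fh_eq x₁ hx₁ hx₁a₀).2
    obtain ⟨-, e2, -, -, e5, -, e7⟩ := he
    rw [e2, e5, e7, e9, g2] at g1
    have g3 := mul_right_cancel₀ hhx₁ (mul_right_cancel₀ (Real.exp_pos _).ne' g1)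
    exact (inv_injective (mul_left_cancel₀ hd.ne.2.2.2.1 g3)).symm
  · have hη0 : ∀ x ∈ m.src.xdom, η x = 0 := by
      intro x hx
      by_contra h
      exact hcase ⟨x, hx, h⟩
    have hh0 : ∀ x ∈ m.src.xdom, m.src.h x = 0 := by
      intro x hx
      refine (hη x hx).unique ((hasDerivAt_const x (0 : ℝ)).congr_of_eventuallyEq ?_)
      filter_upwards [hθ.xdom_interval.mem_nhds hx] with y hy using hη0 y hy
    by_cases hcase' : ∃ u ∈ m.src.udom, m.src.K u * m.src.H u₀ ≠ m.src.K u₀ * m.src.H u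
    · obtain ⟨u₁, hu₁, hKH⟩ := hcase'
      obtain ⟨b₀, hb₀, hbb₀, hu₁b₀⟩ := above hθ.udom_interval _ hb₁ _ hu₁
      have hub₀ : u₀ < b₀ := by linarith
      refine finish a₁ ha₁ b₀ hb₀ hxa₁ hub₀ fun c d hc hd h h' => ?_
      have he := (h.params_eq hadm hc hx₀ hu₀ hη₀ hΞ₀ hΞ hxa₁ hub₀ h').1
      have g1 := (h.HK_eq u₀ hu₀ hub₀).2
      have g2 := (h.HK_eq u₁ hu₁ hu₁b₀).2
      rw [he.2.2.1, he.2.2.2.2.2.1, (h'.HK_eq u₀ hu₀ hub₀).2] at g1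
      rw [he.2.2.1, he.2.2.2.2.2.1, (h'.HK_eq u₁ hu₁ hu₁b₀).2] at g2
      have e8 : c.ε₈ = d.ε₈ := by
        have : (c.ε₈ - d.ε₈) * (m.src.K u₁ * m.src.H u₀ - m.src.K u₀ * m.src.H u₁) = 0 := by
          linear_combination m.src.H u₁ * g1 - m.src.H u₀ * g2
        have := (mul_eq_zero.1 this).resolve_right (sub_ne_zero.2 hKH)
        linarith
      refine Params.ext_of_eq he e8 ?_
      rw [e8] at g1
      have g3 := mul_left_cancel₀ hd.ne.2.2.2.2 g1
      exact mul_right_cancel₀ (hθ.H_ne_zero u₀ hu₀) (by linarith)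
    -- Here h = 0 and K is a multiple of H, so ε₈ and ε₉ are not unique. They enter only through the
    -- ratio of the new K to H, and setting ε₈ = 1 leaves for ε₉ the value `k`, computed from K̃ at
    -- the image of `u₀` and thus independent of the box.
    · have hKH : ∀ u ∈ m.src.udom, m.src.K u * m.src.H u₀ = m.src.K u₀ * m.src.H u := by
        intro u hu
        by_contra h
        exact hcase' ⟨u, hu, h⟩
      have hH0 := hθ.H_ne_zero u₀ hu₀
      obtain ⟨c, hc, hloc⟩ := loc a₁ ha₁ b₁ hb₁ hxa₁ hub₁
      obtain ⟨h4, h5, h6, h7, h8⟩ := hc.ne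
      have hΞeq : ∀ k l, ∀ x ∈ m.src.xdom, Ξ k x = Ξ l x := by
        intro k l x hx
        have := hθ.xdom_interval.sub_eq_sub_of_hasDerivAt (g := Ξ k) (k := Ξ l) (d := fun _ => 1)
          (fun s hs => by simpa [hη0 s hs] using hΞ k s hs)
          (fun s hs => by simpa [hη0 s hs] using hΞ l s hs) hx₀ hx
        rw [hΞ₀, hΞ₀] at this
        linarith
      set k := m.tgt.K (c.ε₆ * u₀ + c.ε₃) / m.src.H u₀ - m.src.K u₀ / m.src.H u₀ with hk
      refine ⟨⟨c.ε₁, c.ε₂, c.ε₃, c.ε₄, c.ε₅, c.ε₆, c.ε₇, 1, k⟩, ?_,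
        mem_transformation_iff.2 ⟨η, Ξ k, Transf.HasLocalForm.hasForm hadm hη (hΞ _) ha₁ hb₁
          fun a ha b hb haa hbb => ?_⟩⟩
      · simp only [Params.Nondegenerate]
        positivity
      · have hxa := hxa₁.trans_le haa
        have hub := hub₁.trans_le hbb
        obtain ⟨d, hd, hloc'⟩ := loc a ha b hb hxa hub
        obtain ⟨⟨e1, e2, e3, e4, e5, e6, e7⟩, -⟩ := hloc.params_eq hadm hc hx₀ hu₀ hη₀ hΞ₀ hΞ
          hxa₁ hub₁ (hloc'.mono haa hbb)
        rw [e6, e3] at hk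
        refine ⟨fun t ht x hx hxa u hu hub => ?_, fun x hx hxa => ?_, fun u hu hub => ?_⟩
        · simp only [e1, e2, e3, e4, e5, e6, hΞeq k d.ε₉ x hx]
          exact hloc'.φ_eq t ht x hx hxa u hu hub
        · have g := hloc'.fh_eq x hx hxa
          simp only [e2, e4, e5, e7, hΞeq k d.ε₉ x hx, hη0 x hx, hh0 x hx, mul_zero,
            zero_mul] at g ⊢
          exact g
        · have g := hloc'.HK_eq u hu hub
          have g0 := (hloc'.HK_eq u₀ hu₀ (hub₁.trans_le hbb)).2
          simp only [e3, e5, e6, e7]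
          refine ⟨g.1, ?_⟩
          rw [g.2, hk, g0]
          have := hKH u hu
          field_simp
          linear_combination (d.ε₈ - 1) * this

/-! ### The group equals the family -/

theorem extendedEquivGroup_eq : extendedEquivGroup =
    {m | ∃ c : Params, c.Nondegenerate ∧ m ∈ transformation c} := by
  ext m
  constructor
  · rintro ⟨𝒯, h𝒯, hm⟩
    exact h𝒯.exists_mem_transformation hm
  · rintro ⟨c, hc, hm⟩
    exact ⟨transformation c, isExtendedEquivalence_transformation hc, hm⟩

end TelegraphG1

theorem mainTheorem6 :
    -- each choice of constants gives an extended equivalence transformation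
    (∀ c : TelegraphG1.Params, c.Nondegenerate →
      TelegraphG1.IsExtendedEquivalence (TelegraphG1.transformation c)) ∧
    -- the extended equivalence group is formed by these transformations
    TelegraphG1.extendedEquivGroup =
      {m | ∃ c : TelegraphG1.Params, c.Nondegenerate ∧ m ∈ TelegraphG1.transformation c} ∧
    -- it is a group: identities, compositions and inverses belong to it
    (∀ m : TelegraphG1.Transf, m.IsIdentity → m ∈ TelegraphG1.extendedEquivGroup) ∧
    (∀ m ∈ TelegraphG1.extendedEquivGroup, ∀ m' ∈ TelegraphG1.extendedEquivGroup,
      m'.Composable m → m'.comp m ∈ TelegraphG1.extendedEquivGroup) ∧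
    (∀ m ∈ TelegraphG1.extendedEquivGroup,
      ∃ m' ∈ TelegraphG1.extendedEquivGroup, m'.IsInverse m) ∧
    (∀ m ∈ TelegraphG1.extendedEquivGroup, ∀ m' : TelegraphG1.Transf, m'.IsInverse m →
      m' ∈ TelegraphG1.extendedEquivGroup) := by
  rw [TelegraphG1.extendedEquivGroup_eq]
  have hinv : ∀ m : TelegraphG1.Transf,
      (∃ c : TelegraphG1.Params, c.Nondegenerate ∧ m ∈ TelegraphG1.transformation c) →
      ∀ m' : TelegraphG1.Transf, m'.IsInverse m →
        ∃ c : TelegraphG1.Params, c.Nondegenerate ∧ m' ∈ TelegraphG1.transformation c := by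
    rintro m ⟨c, hc, hm⟩ m' h
    obtain ⟨η, ξ, hform⟩ := TelegraphG1.mem_transformation_iff.1 hm
    exact hform.inverse_mem hc h
  refine ⟨fun c hc => TelegraphG1.isExtendedEquivalence_transformation hc, rfl,
    fun m hm => hm.exists_mem, ?_, ?_, hinv⟩
  · rintro m ⟨c, hc, hm⟩ m' ⟨c', hc', hm'⟩ h
    obtain ⟨η, ξ, hform⟩ := TelegraphG1.mem_transformation_iff.1 hm
    obtain ⟨η', ξ', hform'⟩ := TelegraphG1.mem_transformation_iff.1 hm'
    exact hform.comp_mem hform' hc hc' h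
  -- Injectivity of φ provides some inverse, and every inverse of a member of the family lies in the
  -- family.
  · rintro m ⟨c, hc, hm⟩
    obtain ⟨η, ξ, hform⟩ := TelegraphG1.mem_transformation_iff.1 hm
    obtain ⟨m', h⟩ := (hform.isPointTransf hc).exists_isInverse
    exact ⟨m', hinv m ⟨c, hc, hm⟩ m' h, h⟩
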